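/- Let $k$ be an arbitrary field, let $n\le 6$ be a non-negative integer, let $S=k[x_1,\dots,x_n]$ with the standard grading, and let $S^{(2)}=\bigoplus_{j\ge 0}S_{2j}$ be its second Veronese subring, a standard graded $k$-algebra whose component of degree $j$ is $S_{2j}$. Then $S^{(2)}$ has the Backelin--Roos property: there exist a standard graded complete intersection ring $Q$ over $k$ and a surjective Golod morphism $\varphi\colon Q\to S^{(2)}$ of graded $k$-algebras. Here a standard graded $k$-algebra is a commutative graded algebra $A=\bigoplus_{j\ge 0}A_j$ with $A_0=k$ that is generated by the finite-dimensional space $A_1$; it is a complete intersection ring if $A\cong k[y_1,\dots,y_m]/(f_1,\dots,f_c)$ as graded algebras (with $\deg y_i=1$) for some regular sequence $f_1,\dots,f_c$ of homogeneous polynomials. For a finitely generated graded $A$-module $M$, let $$P^A_M(s,z)=\sum_{i}\sum_{j}\dim_k \operatorname{Tor}^A_i(k,M)_j\, s^j z^i$$ be its graded Poincaré series. A surjective morphism $\varphi\colon Q\to R$ of standard graded $k$-algebras is Golod if $\operatorname{Ker}\varphi\subseteq (Q_{\ge 1})^2$ and $$P^R_k(s,z)=\frac{P^Q_k(s,z)}{1-z\,(P^Q_R(s,z)-1)}.$$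 -/

import Mathlib

noncomputable section

namespace BackelinRoos

open MvPolynomial

/-! ### Standard graded algebras -/

section Standard

variable {k A : Type*} [Field k] [CommRing A] [Algebra k A]

/-- The graded algebra `A = ⨁ A_j` is a standard graded `k`-algebra: `A_0 = k`, the space `A_1`
is finite dimensional over `k`, and `A_1` generates `A` as a `k`-algebra. -/
structure IsStandardGraded (𝒜 : ℕ → Submodule k A) [GradedAlgebra 𝒜] : Prop where
  nontrivial : Nontrivial A
  zero_eq : 𝒜 0 = 1
  finite_one : Module.Finite k (𝒜 1)
  adjoin_one : Algebra.adjoin k (𝒜 1 : Set A) = ⊤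

/-- The homogeneous maximal ideal `A_{≥ 1}`. -/
def maxIdeal (𝒜 : ℕ → Submodule k A) [GradedAlgebra 𝒜] : Ideal A :=
  (HomogeneousIdeal.irrelevant 𝒜).toIdeal

/-- `A` is a standard graded complete intersection ring: it is standard graded, and as a graded
algebra it is the quotient of a polynomial ring `k[x_1, …, x_m]` (with `deg x_i = 1`) by an ideal
generated by a regular sequence of homogeneous polynomials. -/
def IsCompleteIntersection (𝒜 : ℕ → Submodule k A) [GradedAlgebra 𝒜] : Prop :=
  IsStandardGraded 𝒜 ∧
  ∃ (m : ℕ) (π : MvPolynomial (Fin m) k →ₐ[k] A) (fs : List (MvPolynomial (Fin m) k)),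
    Function.Surjective π ∧
    (∀ (j : ℕ) (p : MvPolynomial (Fin m) k), p.IsHomogeneous j → π p ∈ 𝒜 j) ∧
    (∀ f ∈ fs, ∃ e : ℕ, f.IsHomogeneous e) ∧
    RingTheory.Sequence.IsRegular (MvPolynomial (Fin m) k) fs ∧
    RingHom.ker π = Ideal.ofList fs

end Standard

/-! ### Graded free resolutions, graded Tor and Poincaré series -/

section Resolution

variable {k A : Type*} [Field k] [CommRing A] [Algebra k A]

/-- The degree `j` component of the twist `A(-e)`, that is, `A_{j-e}` (zero if `j < e`). -/
def twist (𝒜 : ℕ → Submodule k A) (e j : ℕ) : Submodule k A :=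
  if e ≤ j then 𝒜 (j - e) else ⊥

/-- The degree `j` component of the graded free module `⨁ₐ A(-deg a)`. -/
def freePart (𝒜 : ℕ → Submodule k A) {r : ℕ} (deg : Fin r → ℕ) (j : ℕ) :
    Submodule k (Fin r → A) :=
  Submodule.pi Set.univ fun a => twist 𝒜 (deg a) j

/-- A graded free resolution `⋯ → F_1 → F_0 → M → 0`, with all maps homogeneous of degree zero, of
the graded `A`-module `M = ⨁ M_j` by the finitely generated graded free modules
`F_i = ⨁ₐ A(-deg i a)`. It is not required to be minimal. -/
structure GradedFreeResolution (𝒜 : ℕ → Submodule k A) {M : Type*} [AddCommGroup M]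
    [Module k M] [Module A M] (ℳ : ℕ → Submodule k M) where
  /-- the rank of `F_i` -/
  rank : ℕ → ℕ
  /-- the degrees of the basis elements of `F_i` -/
  deg : ∀ i, Fin (rank i) → ℕ
  /-- the differential `F_{i+1} → F_i` -/
  d : ∀ i, (Fin (rank (i + 1)) → A) →ₗ[A] (Fin (rank i) → A)
  /-- the augmentation `F_0 → M` -/
  aug : (Fin (rank 0) → A) →ₗ[A] M
  d_mem : ∀ i j, ∀ v ∈ freePart 𝒜 (deg (i + 1)) j, d i v ∈ freePart 𝒜 (deg i) j
  aug_mem : ∀ j, ∀ v ∈ freePart 𝒜 (deg 0) j, aug v ∈ ℳ j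
  aug_surjective : Function.Surjective aug
  exact_zero : Function.Exact (d 0) aug
  exact_succ : ∀ i, Function.Exact (d (i + 1)) (d i)

namespace GradedFreeResolution

variable {𝒜 : ℕ → Submodule k A} [GradedAlgebra 𝒜] {M : Type*} [AddCommGroup M]
    [Module k M] [Module A M] {ℳ : ℕ → Submodule k M} (F : GradedFreeResolution 𝒜 ℳ)

/-- The submodule `𝔪 F_i`, where `𝔪 = A_{≥ 1}`; the term `k ⊗_A F_i` of the complex `k ⊗_A F` is
`F_i / 𝔪 F_i`. -/
def maxSMul (i : ℕ) : Submodule A (Fin (F.rank i) → A) :=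
  maxIdeal 𝒜 • (⊤ : Submodule A (Fin (F.rank i) → A))

/-- The elements of degree `j` of `F_i` that represent cycles of the complex `k ⊗_A F`. -/
def cycles : (i j : ℕ) → Submodule k (Fin (F.rank i) → A)
  | 0, j => freePart 𝒜 (F.deg 0) j
  | i + 1, j => freePart 𝒜 (F.deg (i + 1)) j ⊓
      ((F.maxSMul i).comap (F.d i)).restrictScalars k

/-- The elements of `F_i` that represent boundaries of the complex `k ⊗_A F`. -/
def boundaries (i : ℕ) : Submodule k (Fin (F.rank i) → A) :=
  (F.maxSMul i ⊔ LinearMap.range (F.d i)).restrictScalars k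

/-- `Tor_i^A(k, M)_j`, the degree `j` component of `H_i(k ⊗_A F)`. -/
abbrev Tor (i j : ℕ) : Type _ :=
  F.cycles i j ⧸ (F.boundaries i).comap (F.cycles i j).subtype

/-- The graded Betti number `β_{i,j}(M) = dim_k Tor_i^A(k, M)_j`. -/
def betti (i j : ℕ) : ℕ := Module.finrank k (F.Tor i j)

/-- The graded Poincaré series `∑_i (∑_j β_{i,j}(M) s^j) z^i`; the inner variable is `s`, the outer
variable is `z`. -/
def poincareSeries : PowerSeries (PowerSeries ℤ) :=
  PowerSeries.mk fun i => PowerSeries.mk fun j => (F.betti i j : ℤ)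

end GradedFreeResolution

/-- `P` is the graded Poincaré series `P^A_M(s, z)` of the graded `A`-module `M`. As usual, `Tor` is
computed from some graded free resolution of `M`, and does not depend on which one. -/
def IsPoincareSeries (𝒜 : ℕ → Submodule k A) [GradedAlgebra 𝒜] {M : Type*} [AddCommGroup M]
    [Module k M] [Module A M] (ℳ : ℕ → Submodule k M) (P : PowerSeries (PowerSeries ℤ)) : Prop :=
  ∃ F : GradedFreeResolution 𝒜 ℳ, F.poincareSeries = P

/-- The grading of the residue field `k = A / A_{≥ 1}`, which is concentrated in degree `0`. -/
def residueGrading (𝒜 : ℕ → Submodule k A) [GradedAlgebra 𝒜] (j : ℕ) :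
    Submodule k (A ⧸ maxIdeal 𝒜) :=
  if j = 0 then ⊤ else ⊥

end Resolution

/-! ### Golod morphisms and the Backelin-Roos property -/

section Golod

variable {k : Type*} [Field k]

/-- A surjective morphism `φ : Q → R` of standard graded `k`-algebras is Golod if
`Ker φ ⊆ (Q_{≥ 1})²` and `P^R_k = P^Q_k / (1 - z (P^Q_R - 1))`. The denominator has constant term
`1`, and the equality is written with the denominator cleared. -/
def IsGolod {Q R : Type*} [CommRing Q] [Algebra k Q] [CommRing R] [Algebra k R]
    (𝒬 : ℕ → Submodule k Q) [GradedAlgebra 𝒬] (ℛ : ℕ → Submodule k R) [GradedAlgebra ℛ]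
    (φ : Q →ₐ[k] R) : Prop :=
  letI : Module Q R := Module.compHom R (φ : Q →+* R)
  Function.Surjective φ ∧
  (∀ j, ∀ q ∈ 𝒬 j, φ q ∈ ℛ j) ∧
  RingHom.ker φ ≤ maxIdeal 𝒬 ^ 2 ∧
  ∃ PRk PQk PQR : PowerSeries (PowerSeries ℤ),
    IsPoincareSeries ℛ (residueGrading ℛ) PRk ∧
    IsPoincareSeries 𝒬 (residueGrading 𝒬) PQk ∧
    IsPoincareSeries 𝒬 ℛ PQR ∧
    PRk * (1 - PowerSeries.X * (PQR - 1)) = PQk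

end Golod

/-- The standard graded `k`-algebra `R` has the Backelin-Roos property: there is a surjective Golod
morphism `Q → R` where `Q` is a standard graded complete intersection ring. -/
def HasBackelinRoosProperty.{u, v} {k : Type u} [Field k] {R : Type v} [CommRing R] [Algebra k R]
    (ℛ : ℕ → Submodule k R) [GradedAlgebra ℛ] : Prop :=
  IsStandardGraded ℛ ∧
  ∃ (Q : Type u) (_ : CommRing Q) (_ : Algebra k Q) (𝒬 : ℕ → Submodule k Q)
    (_ : GradedAlgebra 𝒬) (φ : Q →ₐ[k] R), IsCompleteIntersection 𝒬 ∧ IsGolod 𝒬 ℛ φ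

/-! ### Veronese subrings -/

section Veronese

variable (k : Type*) [Field k] (n c : ℕ)

/-- The `c`-th Veronese subring `S^(c) = ⨁_j S_{cj}` of `S = k[x_1, …, x_n]`: the polynomials all
of whose monomials have degree divisible by `c`. -/
def veronese : Subalgebra k (MvPolynomial (Fin n) k) where
  carrier := {p | ∀ m ∈ p.support, c ∣ m.degree}
  mul_mem' := by
    classical
    intro p q hp hq m hm
    obtain ⟨a, ha, b, hb, rfl⟩ := Finset.mem_add.1 (MvPolynomial.support_mul p q hm)
    simpa using dvd_add (hp a ha) (hq b hb)
  add_mem' := by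
    classical
    intro p q hp hq m hm
    rcases Finset.mem_union.1 (MvPolynomial.support_add hm) with h | h
    exacts [hp m h, hq m h]
  algebraMap_mem' := by
    classical
    intro r m hm
    rw [MvPolynomial.algebraMap_eq, MvPolynomial.mem_support_iff, MvPolynomial.coeff_C] at hm
    have : 0 = m := by
      by_contra h
      simp [h] at hm
    simp [← this]

/-- The grading of the Veronese subring: its component of degree `j` is `S_{cj}`. -/
def veroneseGrading (j : ℕ) : Submodule k (veronese k n c) :=
  (homogeneousSubmodule (Fin n) k (c * j)).comap (veronese k n c).val.toLinearMap

instance veroneseGradedMonoid : SetLike.GradedMonoid (veroneseGrading k n c) where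
  one_mem := by
    change (1 : MvPolynomial (Fin n) k).IsHomogeneous (c * 0)
    simpa using MvPolynomial.isHomogeneous_one (Fin n) k
  mul_mem := by
    intro i j p q hp hq
    change (p.1 * q.1).IsHomogeneous (c * (i + j))
    rw [mul_add]
    exact MvPolynomial.IsHomogeneous.mul hp hq

theorem veroneseGrading_isInternal [NeZero c] : DirectSum.IsInternal (veroneseGrading k n c) := by
  classical
  rw [DirectSum.isInternal_submodule_iff_iSupIndep_and_iSup_eq_top]
  constructor
  · let _ : GradedAlgebra (homogeneousSubmodule (Fin n) k) := MvPolynomial.gradedAlgebra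
    have hS : iSupIndep fun j => homogeneousSubmodule (Fin n) k (c * j) :=
      (DirectSum.Decomposition.isInternal
        (homogeneousSubmodule (Fin n) k)).submodule_iSupIndep.comp
        (fun a b h => Nat.eq_of_mul_eq_mul_left (NeZero.pos c) h)
    intro j
    rw [Submodule.disjoint_def]
    intro x hx hx'
    refine Subtype.ext (Submodule.disjoint_def.1 (hS j) x.1 hx ?_)
    have h := Submodule.mem_map_of_mem (f := (veronese k n c).val.toLinearMap) hx'
    simp only [Submodule.map_iSup] at h
    exact iSup₂_mono (fun i _ => Submodule.map_comap_le _ _) h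
  · rw [eq_top_iff]
    intro x _
    have key : ∀ i, c ∣ i → homogeneousComponent i x.1 ∈ veronese k n c := by
      intro i hi m hm
      rw [support_homogeneousComponent, Finset.mem_filter] at hm
      exact hm.2 ▸ hi
    have hx : x = ∑ i ∈ Finset.range (x.1.totalDegree + 1),
        if h : c ∣ i then (⟨_, key i h⟩ : veronese k n c) else 0 := by
      apply Subtype.ext
      conv_lhs => rw [← sum_homogeneousComponent x.1]
      rw [AddSubmonoidClass.coe_finsetSum]
      refine Finset.sum_congr rfl fun i _ => ?_
      split_ifs with h
      · rfl
      · refine homogeneousComponent_eq_zero' _ _ fun m hm hmi => h ?_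
        exact hmi ▸ x.2 m hm
    rw [hx]
    refine Submodule.sum_mem _ fun i _ => ?_
    split_ifs with h
    · obtain ⟨j, rfl⟩ := h
      exact Submodule.mem_iSup_of_mem j (homogeneousComponent_mem (c * j) x.1)
    · exact Submodule.zero_mem _

instance veroneseGradedAlgebra [NeZero c] : GradedAlgebra (veroneseGrading k n c) :=
  { veroneseGradedMonoid k n c with
    toDecomposition := (veroneseGrading_isInternal k n c).chooseDecomposition }

end Veronese

end BackelinRoos

end

/-! Write R for the Veronese ring and P for the polynomial ring with one variable X_ij for each
product x_i x_j. The proof finds a complete intersection Q = P/(f, g), or Q = P, such that Q and R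
are Koszul and the kernel I of Q → R has a linear resolution over Q with generators in degree 2.
Then P^R_k and P^Q_k are power series in sz, and P^Q_R - 1 is s times such a series. All three are
determined by Hilbert series, and the Golod identity follows from H_I = H_Q - H_R
(`isGolod_of_linFlag`).

Linearity comes from a variant of Koszul filtrations, `LinFlag`: a family 𝓛 of ideals, each built
from 0 by adjoining linear forms, with all successive colon ideals again in 𝓛. If a graded submodule
N of a free module F satisfies N ∩ LF = LN above its initial degree for all L in 𝓛, then N is
generated in that degree, and its syzygies inherit the property (`inter_ker`). The kernel I has the
property as soon as, in degrees at least 2, the colon ideals computed in R are covered by the images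
of those in Q (`mem_mul_ker`). On R itself the contractions of the ideals (x_0, …, x_{a-1}) form
such a family (`linFlag_varExps`).

It remains to choose Q. The squares x_i² form a regular sequence on R, and modulo them degree t of R
is spanned by the squarefree monomials of degree 2t. For n ≤ 3 nothing is left in degrees t ≥ 2, and
Q = P works. For 4 ≤ n ≤ 6 one uses a, b in R_1 with ab in the ideal of squares such that, modulo
squares and in degrees at least 2, each generates the annihilator of the other, while a and x_0x_1
together generate everything. Here f lifts the relation for ab, and g = X_01² - X_00 X_11. With q =
x_0x_1 + x_2x_3 + ε(x_0x_2 - x_1x_3), the choice is a = b = q for n = 4, 5, and a, b = q ∓ x_4x_5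
for n = 6. Two conditions fix ε: q² ≡ 2(1 - ε²)x_0x_1x_2x_3 modulo squares has to vanish, and 1 +
ε², the determinant of the blocks of multiplication by q from linear to squarefree cubic forms in
x_0, …, x_3, has to be nonzero. So ε = 0 in characteristic 2 and ε = 1 otherwise. -/

noncomputable section
set_option linter.unusedSectionVars false
namespace BackelinRoos
open MvPolynomial

/-! ### Homogeneous components of ring elements and of vectors. -/

section GradedVectors

variable {k A : Type*} [Field k] [CommRing A] [Algebra k A]
  (𝒜 : ℕ → Submodule k A) [GradedAlgebra 𝒜]

theorem gproj_mem (t : ℕ) (x : A) : GradedAlgebra.proj 𝒜 t x ∈ 𝒜 t := by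
  rw [GradedAlgebra.proj_apply]; exact SetLike.coe_mem _

theorem gproj_of_mem {t : ℕ} {x : A} (hx : x ∈ 𝒜 t) : GradedAlgebra.proj 𝒜 t x = x := by
  rw [GradedAlgebra.proj_apply]; exact DirectSum.decompose_of_mem_same 𝒜 hx

theorem gproj_of_mem_ne {t i : ℕ} {x : A} (hx : x ∈ 𝒜 i) (h : i ≠ t) :
    GradedAlgebra.proj 𝒜 t x = 0 := by
  rw [GradedAlgebra.proj_apply]; exact DirectSum.decompose_of_mem_ne 𝒜 hx h

theorem gproj_mul_left {i : ℕ} {a : A} (ha : a ∈ 𝒜 i) (t : ℕ) (x : A) :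
    GradedAlgebra.proj 𝒜 (i + t) (a * x) = a * GradedAlgebra.proj 𝒜 t x := by
  simp only [GradedAlgebra.proj_apply]
  exact DirectSum.coe_decompose_mul_add_of_left_mem 𝒜 ha

theorem gproj_mul_right {i : ℕ} {a : A} (ha : a ∈ 𝒜 i) (t : ℕ) (x : A) :
    GradedAlgebra.proj 𝒜 (t + i) (x * a) = GradedAlgebra.proj 𝒜 t x * a := by
  simp only [GradedAlgebra.proj_apply]
  exact DirectSum.coe_decompose_mul_add_of_right_mem 𝒜 ha

theorem gproj_mul_left_of_lt {i t : ℕ} (h : t < i) {a : A} (ha : a ∈ 𝒜 i) (x : A) :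
    GradedAlgebra.proj 𝒜 t (a * x) = 0 := by
  simp only [GradedAlgebra.proj_apply]
  exact DirectSum.coe_decompose_mul_of_left_mem_of_not_le 𝒜 ha (by omega)

theorem gproj_mem_of_isHomogeneous {L : Ideal A} (hL : L.IsHomogeneous 𝒜) {x : A} (hx : x ∈ L)
    (t : ℕ) : GradedAlgebra.proj 𝒜 t x ∈ L := by
  rw [GradedAlgebra.proj_apply]; exact hL t hx

theorem exists_eq_sum_gproj (x : A) :
    ∃ T : ℕ, ∀ T', T ≤ T' → x = ∑ t ∈ Finset.range T', GradedAlgebra.proj 𝒜 t x := by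
  classical
  refine ⟨((DirectSum.decompose 𝒜 x).support.sup id) + 1, fun T' hT => ?_⟩
  conv_lhs => rw [← DirectSum.sum_support_decompose 𝒜 x]
  refine Finset.sum_subset (fun t ht => ?_) fun t _ ht => ?_
  · have := Finset.le_sup (f := id) ht
    simp only [id] at this
    exact Finset.mem_range.2 (by omega)
  · rw [DFinsupp.notMem_support_iff] at ht
    simp [ht]

/-- The vectors all of whose coordinates are homogeneous of degree `t`. -/
def homVec (r t : ℕ) : Submodule k (Fin r → A) := Submodule.pi Set.univ fun _ => 𝒜 t

variable {𝒜} in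
theorem mem_homVec {r t : ℕ} {v : Fin r → A} : v ∈ homVec 𝒜 r t ↔ ∀ a, v a ∈ 𝒜 t := by
  simp [homVec, Submodule.mem_pi]

/-- The degree `t` component of a vector, taken coordinatewise. -/
def vproj (r t : ℕ) : (Fin r → A) →ₗ[k] (Fin r → A) :=
  LinearMap.pi fun a => GradedAlgebra.proj 𝒜 t ∘ₗ LinearMap.proj a

theorem vproj_apply (r t : ℕ) (v : Fin r → A) (a : Fin r) :
    vproj 𝒜 r t v a = GradedAlgebra.proj 𝒜 t (v a) := rfl

theorem vproj_mem (r t : ℕ) (v : Fin r → A) : vproj 𝒜 r t v ∈ homVec 𝒜 r t :=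
  mem_homVec.2 fun _ => gproj_mem 𝒜 t _

theorem vproj_of_mem {r t : ℕ} {v : Fin r → A} (hv : v ∈ homVec 𝒜 r t) : vproj 𝒜 r t v = v :=
  funext fun a => gproj_of_mem 𝒜 (mem_homVec.1 hv a)

theorem exists_eq_sum_vproj {r : ℕ} (v : Fin r → A) :
    ∃ T : ℕ, v = ∑ t ∈ Finset.range T, vproj 𝒜 r t v := by
  choose T hT using fun a => exists_eq_sum_gproj 𝒜 (v a)
  refine ⟨Finset.univ.sup T, funext fun a => ?_⟩
  rw [Finset.sum_apply]
  exact hT a _ (Finset.le_sup (Finset.mem_univ a))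

theorem le_of_homVec_le {r : ℕ} {N N' : Submodule A (Fin r → A)}
    (hN : ∀ v ∈ N, ∀ t, vproj 𝒜 r t v ∈ N)
    (h : ∀ t, ∀ v ∈ N, v ∈ homVec 𝒜 r t → v ∈ N') : N ≤ N' := by
  intro v hv
  obtain ⟨T, hT⟩ := exists_eq_sum_vproj 𝒜 v
  rw [hT]
  exact Submodule.sum_mem _ fun t _ => h t _ (hN v hv t) (vproj_mem 𝒜 r t v)

end GradedVectors

/-! ### Filtrations by linear ideals and the linearity of syzygies. -/

section LinearFiltrations

variable {k A B : Type*} [Field k] [CommRing A] [Algebra k A] [CommRing B]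
  (𝒜 : ℕ → Submodule k A) [GradedAlgebra 𝒜]

/-- The ideals obtained from `0` by successively adjoining linear forms `ℓ`, all the colon ideals
being members of `𝓛`; moreover, in degrees at least `2` the colon ideals of the images under `φ`
are the images of the colon ideals. -/
inductive LinFlag (𝓛 : Set (Ideal A)) (φ : A →+* B) : Ideal A → Prop
  | bot : LinFlag 𝓛 φ ⊥
  | step {L₀ L₁ : Ideal A} {ℓ : A} : LinFlag 𝓛 φ L₀ → ℓ ∈ 𝒜 1 → L₁ ∈ 𝓛 →
      (∀ x, ℓ * x ∈ L₀ ↔ x ∈ L₁) →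
      (∀ t, 2 ≤ t → ∀ w ∈ 𝒜 t, φ (ℓ * w) ∈ L₀.map φ → φ w ∈ L₁.map φ) →
      LinFlag 𝓛 φ (L₀ ⊔ Ideal.span {ℓ})

variable {𝒜} {𝓛 : Set (Ideal A)} {φ : A →+* B}

theorem LinFlag.isHomogeneous {L : Ideal A} (h : LinFlag 𝒜 𝓛 φ L) : L.IsHomogeneous 𝒜 := by
  induction h with
  | bot => exact Ideal.IsHomogeneous.bot 𝒜
  | step _ hl _ _ _ ih =>
    refine Ideal.IsHomogeneous.sup ih (Ideal.homogeneous_span 𝒜 _ ?_)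
    rintro x rfl
    exact ⟨1, hl⟩

theorem exists_of_mem_sup_span {L₀ : Ideal A} (hL : L₀.IsHomogeneous 𝒜) {ℓ : A} (hl : ℓ ∈ 𝒜 1)
    {t : ℕ} {x : A} (hx : x ∈ 𝒜 (1 + t)) (h : x ∈ L₀ ⊔ Ideal.span {ℓ}) :
    ∃ u ∈ L₀, ∃ w ∈ 𝒜 t, u ∈ 𝒜 (1 + t) ∧ x = u + ℓ * w := by
  obtain ⟨u, hu, y, hy, rfl⟩ := Submodule.mem_sup.1 h
  obtain ⟨w, rfl⟩ := Ideal.mem_span_singleton'.1 hy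
  refine ⟨_, gproj_mem_of_isHomogeneous 𝒜 hL hu (1 + t), _, gproj_mem 𝒜 t w,
    gproj_mem 𝒜 _ _, ?_⟩
  rw [← gproj_mul_left 𝒜 hl, ← map_add, mul_comm ℓ w, gproj_of_mem 𝒜 hx]

variable (𝒜) in
/-- `N` is a graded submodule of `A^r`, zero in degrees less than `δ`, and in degrees greater than
`δ` it satisfies `N ∩ L A^r = L N` for all `L` in `𝓛`. -/
structure IsLin (𝓛 : Set (Ideal A)) {r : ℕ} (N : Submodule A (Fin r → A)) (δ : ℕ) : Prop where
  homogeneous : ∀ v ∈ N, ∀ t, vproj 𝒜 r t v ∈ N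
  low : ∀ v ∈ N, ∀ t < δ, vproj 𝒜 r t v = 0
  inter : ∀ L ∈ 𝓛, ∀ t, δ < t → ∀ v ∈ N, v ∈ homVec 𝒜 r t → (∀ a, v a ∈ L) → v ∈ L • N

/-- The graded Nakayama step: the degree t part of 𝔪N consists of combinations of elements of N of
degree less than t. -/
theorem vproj_smul_mem {r : ℕ} {N N' : Submodule A (Fin r → A)} {t : ℕ}
    (hN : ∀ v ∈ N, ∀ t, vproj 𝒜 r t v ∈ N)
    (h : ∀ q < t, ∀ v ∈ N, v ∈ homVec 𝒜 r q → v ∈ N') {v : Fin r → A}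
    (hv : v ∈ maxIdeal 𝒜 • N) : vproj 𝒜 r t v ∈ N' := by
  induction hv using Submodule.smul_induction_on' with
  | add x _ y _ hx hy => rw [map_add]; exact add_mem hx hy
  | smul a ha n hn =>
    obtain ⟨T, hT⟩ := exists_eq_sum_gproj 𝒜 a
    rw [hT T le_rfl, Finset.sum_smul, map_sum]
    refine Submodule.sum_mem _ fun i _ => ?_
    rcases Nat.eq_zero_or_pos i with rfl | hi
    · have : GradedAlgebra.proj 𝒜 0 a = 0 := by
        rw [GradedAlgebra.proj_apply, ← GradedRing.proj_apply]
        exact (HomogeneousIdeal.mem_irrelevant_iff 𝒜 a).1 ha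
      simp [this]
    rcases lt_or_ge t i with hti | hti
    · have : vproj 𝒜 r t (GradedAlgebra.proj 𝒜 i a • n) = 0 :=
        funext fun b => gproj_mul_left_of_lt 𝒜 hti (gproj_mem 𝒜 i a) _
      rw [this]; exact zero_mem _
    · obtain ⟨q, rfl⟩ := Nat.exists_eq_add_of_le hti
      have : vproj 𝒜 r (i + q) (GradedAlgebra.proj 𝒜 i a • n)
          = GradedAlgebra.proj 𝒜 i a • vproj 𝒜 r q n :=
        funext fun b => gproj_mul_left 𝒜 (gproj_mem 𝒜 i a) _ _
      rw [this]
      exact Submodule.smul_mem _ _ (h q (by omega) _ (hN n hn q) (vproj_mem 𝒜 r q n))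

theorem mem_maxIdeal_of_mem {t : ℕ} (ht : 0 < t) {x : A} (hx : x ∈ 𝒜 t) : x ∈ maxIdeal 𝒜 :=
  HomogeneousIdeal.mem_irrelevant_of_mem 𝒜 ht hx

/-- The intersection property for L = 𝔪 puts every element of N of degree greater than δ into 𝔪N, so
induction on the degree reaches degree δ. -/
theorem IsLin.le_span {r : ℕ} {N : Submodule A (Fin r → A)} {δ : ℕ} (h : IsLin 𝒜 𝓛 N δ)
    (hm : maxIdeal 𝒜 ∈ 𝓛) : N ≤ Submodule.span A {v | v ∈ N ∧ v ∈ homVec 𝒜 r δ} := by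
  refine le_of_homVec_le 𝒜 h.homogeneous fun t => ?_
  induction t using Nat.strong_induction_on with
  | _ t ih =>
    intro v hv hvt
    rcases lt_trichotomy t δ with ht | rfl | ht
    · rw [← vproj_of_mem 𝒜 hvt, h.low v hv t ht]; exact zero_mem _
    · exact Submodule.subset_span ⟨hv, hvt⟩
    · have := h.inter _ hm t ht v hv hvt
        fun a => mem_maxIdeal_of_mem (by omega) (mem_homVec.1 hvt a)
      rw [← vproj_of_mem 𝒜 hvt]
      exact vproj_smul_mem h.homogeneous ih this

/-- The linear map `A^s → A^r` raises degrees by `δ`. -/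
def RaisesDegree (𝒜 : ℕ → Submodule k A) [GradedAlgebra 𝒜] {s r : ℕ}
    (d : (Fin s → A) →ₗ[A] (Fin r → A)) (δ : ℕ) : Prop :=
  ∀ v t, vproj 𝒜 r (t + δ) (d v) = d (vproj 𝒜 s t v)

theorem RaisesDegree.mem_homVec {s r δ : ℕ} {d : (Fin s → A) →ₗ[A] (Fin r → A)}
    (hd : RaisesDegree 𝒜 d δ) {v : Fin s → A} {t : ℕ} (hv : v ∈ homVec 𝒜 s t) :
    d v ∈ homVec 𝒜 r (t + δ) := by
  have := hd v t
  rw [vproj_of_mem 𝒜 hv] at this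
  rw [← this]
  exact vproj_mem 𝒜 _ _ _

theorem raisesDegree_linearCombination {s r δ : ℕ} {n : Fin s → Fin r → A}
    (hn : ∀ i, n i ∈ homVec 𝒜 r δ) : RaisesDegree 𝒜 (Fintype.linearCombination A n) δ := by
  intro v t
  simp only [Fintype.linearCombination_apply, map_sum]
  refine Finset.sum_congr rfl fun i _ => funext fun a => ?_
  exact gproj_mul_right 𝒜 (BackelinRoos.mem_homVec.1 (hn i) a) t (v i)

theorem mem_smul_top_iff {s : ℕ} {x : Fin s → A} {L : Ideal A} :
    x ∈ L • (⊤ : Submodule A (Fin s → A)) ↔ ∀ a, x a ∈ L := by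
  constructor
  · intro hx a
    induction hx using Submodule.smul_induction_on' with
    | add x _ y _ hx hy => exact add_mem hx hy
    | smul r hr n _ => exact L.mul_mem_right _ hr
  · intro hx
    rw [pi_eq_sum_univ' x]
    exact Submodule.sum_mem _ fun a _ => Submodule.smul_mem_smul (hx a) trivial

/-- Write v = u + ℓw with u in L₀. Since dv = 0, ℓ·dw lies in L₀, so dw lies in L₁, hence in L₁N,
and dw = dw₀ with w₀ in L₁A^s. Then w - w₀ is a syzygy, and v - ℓ(w - w₀) = u + ℓw₀ has coordinates
in L₀ because ℓL₁ ⊆ L₀. Induction along the flag finishes. -/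
theorem inter_ker {s r δ : ℕ} {N : Submodule A (Fin r → A)} (h : IsLin 𝒜 𝓛 N δ)
    {d : (Fin s → A) →ₗ[A] (Fin r → A)} (hd : RaisesDegree 𝒜 d δ)
    (hr : LinearMap.range d = N) {L : Ideal A} (hL : LinFlag 𝒜 𝓛 φ L) {t : ℕ} (ht : 1 < t)
    (v : Fin s → A) (hv : v ∈ LinearMap.ker d) (hvt : v ∈ homVec 𝒜 s t) (hvL : ∀ a, v a ∈ L) :
    v ∈ L • LinearMap.ker d := by
  induction hL generalizing v with
  | bot =>
    have : v = 0 := funext fun a => by simpa using hvL a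
    rw [this]; exact zero_mem _
  | @step L₀ L₁ ℓ h₀ hl h₁ hc _ ih =>
    obtain ⟨t, rfl⟩ := Nat.exists_eq_add_of_le ht.le
    choose u hu w hw hut huw using fun a =>
      exists_of_mem_sup_span h₀.isHomogeneous hl (mem_homVec.1 hvt a) (hvL a)
    have hv' : v = u + ℓ • w := funext huw
    have hdu : ∀ a, d u a ∈ L₀ := by
      refine mem_smul_top_iff.1 ?_
      have := Submodule.mem_map_of_mem (f := d) (mem_smul_top_iff.2 hu)
      rw [Submodule.map_smul''] at this
      exact Submodule.smul_mono le_rfl le_top this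
    have hdw : ∀ a, d w a ∈ L₁ := by
      intro a
      rw [← hc]
      have : d u a + ℓ * d w a = 0 := by
        have := congrFun (show d v = 0 from hv) a
        rw [hv', map_add, map_smul] at this
        simpa using this
      rw [eq_neg_of_add_eq_zero_right this]
      exact neg_mem (hdu a)
    have hdw' : d w ∈ L₁ • N :=
      h.inter L₁ h₁ (t + δ) (by omega) (d w) (hr ▸ LinearMap.mem_range_self d w)
        (hd.mem_homVec (mem_homVec.2 hw)) hdw
    rw [← hr, ← Submodule.map_top, ← Submodule.map_smul''] at hdw'
    obtain ⟨w₀, hw₀, hdw₀⟩ := hdw'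
    have hw₀' := mem_smul_top_iff.1 hw₀
    -- The lift w₀ need not be homogeneous, so the syzygy w - w₀ is replaced by its degree t
    -- component.
    set w₁ : Fin s → A := vproj 𝒜 s t (w - w₀) with hw₁
    have hk : w₁ ∈ LinearMap.ker d := by
      rw [LinearMap.mem_ker, hw₁, ← hd, map_sub, hdw₀, sub_self, map_zero]
    have hs : ℓ • w₁ ∈ (L₀ ⊔ Ideal.span {ℓ}) • LinearMap.ker d :=
      Submodule.smul_mem_smul (le_sup_right (a := L₀) (Ideal.mem_span_singleton_self ℓ)) hk
    rw [show v = (v - ℓ • w₁) + ℓ • w₁ by abel]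
    refine add_mem (Submodule.smul_mono_left le_sup_left (ih _ ?_ ?_ ?_)) hs
    · exact sub_mem hv (Submodule.smul_mem _ _ hk)
    · refine sub_mem hvt (mem_homVec.2 fun a => ?_)
      exact SetLike.mul_mem_graded hl (gproj_mem 𝒜 t _)
    · intro a
      have h1 : w₁ a = w a - GradedAlgebra.proj 𝒜 t (w₀ a) := by
        rw [hw₁, vproj_apply, Pi.sub_apply, map_sub, gproj_of_mem 𝒜 (hw a)]
      have h2 : (v - ℓ • w₁) a = u a + GradedAlgebra.proj 𝒜 (1 + t) (ℓ * w₀ a) := by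
        rw [gproj_mul_left 𝒜 hl, hv']
        simp only [Pi.sub_apply, Pi.add_apply, Pi.smul_apply, smul_eq_mul, h1]
        ring
      rw [h2]
      exact add_mem (hu a) (gproj_mem_of_isHomogeneous 𝒜 h₀.isHomogeneous
        ((hc _).2 (hw₀' a)) _)

theorem IsLin.exists_cover [∀ t, Module.Finite k (𝒜 t)] (h0 : 𝒜 0 = 1)
    (hm : maxIdeal 𝒜 ∈ 𝓛) (hF : ∀ L ∈ 𝓛, LinFlag 𝒜 𝓛 φ L) {r δ : ℕ}
    {N : Submodule A (Fin r → A)} (h : IsLin 𝒜 𝓛 N δ) :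
    ∃ (s : ℕ) (d : (Fin s → A) →ₗ[A] (Fin r → A)), RaisesDegree 𝒜 d δ ∧
      LinearMap.range d = N ∧ IsLin 𝒜 𝓛 (LinearMap.ker d) 1 := by
  let V : Submodule k (Fin r → A) := N.restrictScalars k ⊓ homVec 𝒜 r δ
  have : Module.Finite k (homVec 𝒜 r δ) := by
    refine Module.Finite.of_injective
      (LinearMap.pi fun a => (LinearMap.proj a).restrict
        (p := homVec 𝒜 r δ) (q := 𝒜 δ) fun v hv => mem_homVec.1 hv a) ?_
    intro v w hvw
    refine Subtype.ext (funext fun a => ?_)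
    exact congrArg Subtype.val (congrFun hvw a)
  have : Module.Finite k V := Submodule.finiteDimensional_of_le inf_le_right
  -- A basis of the lowest component, rather than a mere generating set, makes the cover minimal.
  let b := Module.finBasis k V
  let n : Fin (Module.finrank k V) → Fin r → A := fun i => b i
  have hn : ∀ i, n i ∈ homVec 𝒜 r δ := fun i => (b i).2.2
  have hd := raisesDegree_linearCombination hn
  have hr : LinearMap.range (Fintype.linearCombination A n) = N := by
    rw [Fintype.range_linearCombination]
    apply le_antisymm
    · rw [Submodule.span_le]
      rintro _ ⟨i, rfl⟩
      exact (b i).2.1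
    · refine (h.le_span hm).trans (Submodule.span_le.2 fun v hv => ?_)
      have h1 : (⟨v, hv.1, hv.2⟩ : V) ∈ Submodule.span k (Set.range b) := by
        rw [b.span_eq]; trivial
      have h2 := Submodule.mem_map_of_mem (f := V.subtype) h1
      rw [Submodule.map_span, ← Set.range_comp] at h2
      exact Submodule.span_le_restrictScalars k A _ h2
  refine ⟨_, Fintype.linearCombination A n, hd, hr, ?_, ?_, ?_⟩
  · intro v hv t
    rw [LinearMap.mem_ker, ← hd, LinearMap.mem_ker.1 hv, map_zero]
  · intro v hv t ht
    -- A syzygy of degree 0 has coefficients in k, so linear independence of the basis makes it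
    -- zero.
    obtain rfl : t = 0 := by omega
    have hk : ∀ i, ∃ c : k, algebraMap k A c = vproj 𝒜 _ 0 v i := by
      intro i
      have := gproj_mem 𝒜 0 (v i)
      rw [h0] at this
      exact Submodule.mem_one.1 this
    choose c hc using hk
    have h1 : Fintype.linearCombination A n (vproj 𝒜 _ 0 v) = 0 := by
      rw [← hd, LinearMap.mem_ker.1 hv, map_zero]
    have h2 : ∑ i, c i • b i = 0 := by
      apply Subtype.ext
      rw [Fintype.linearCombination_apply] at h1
      simpa [n, ← hc, algebraMap_smul] using h1
    have h3 := Fintype.linearIndependent_iff.1 b.linearIndependent c h2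
    funext i
    rw [← hc, h3 i, map_zero]; rfl
  · exact fun L hL t ht v hv hvt hvL => inter_ker h hd hr (hF L hL) ht v hv hvt hvL

end LinearFiltrations
end BackelinRoos
end

noncomputable section
set_option linter.unusedSectionVars false
namespace BackelinRoos
open MvPolynomial

/-! ### Power series identities behind Euler characteristics. -/

section Series

/-- The ring homomorphism `ℤ⟦u⟧ → ℤ⟦s⟧⟦z⟧` with `u ↦ s z`. -/
def diagonalSeries : PowerSeries ℤ →+* PowerSeries (PowerSeries ℤ) :=
  (PowerSeries.rescale (PowerSeries.X : PowerSeries ℤ)).comp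
    (PowerSeries.map (PowerSeries.C (R := ℤ)))

theorem coeff_diagonalSeries (B : PowerSeries ℤ) (i : ℕ) :
    PowerSeries.coeff i (diagonalSeries B) =
      PowerSeries.X ^ i * PowerSeries.C (PowerSeries.coeff i B) := by
  simp [diagonalSeries, PowerSeries.coeff_rescale]

theorem diagonalSeries_X :
    diagonalSeries PowerSeries.X = PowerSeries.X * PowerSeries.C PowerSeries.X := by
  ext1 i
  rw [coeff_diagonalSeries, PowerSeries.coeff_mul_C, PowerSeries.coeff_X, PowerSeries.coeff_X]
  split_ifs with h
  · simp [h]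
  · simp

/-- Iterating the relation shows that each term is divisible by every power of the variable. -/
theorem eq_zero_of_eq_neg_X_mul {e : ℕ → PowerSeries ℤ}
    (h : ∀ i, e i = -(PowerSeries.X * e (i + 1))) (i : ℕ) : e i = 0 := by
  have key : ∀ m i, (PowerSeries.X : PowerSeries ℤ) ^ m ∣ e i := by
    intro m
    induction m with
    | zero => simp
    | succ m ih =>
      intro i
      rw [h i, dvd_neg, pow_succ']
      exact mul_dvd_mul_left _ (ih (i + 1))
  ext n
  exact PowerSeries.X_pow_dvd_iff.1 (key (n + 1) i) n (Nat.lt_succ_self n)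

theorem rescale_neg_one_mk (b : ℕ → ℤ) :
    PowerSeries.rescale (-1) (PowerSeries.mk b) = PowerSeries.C (b 0) -
      PowerSeries.X * PowerSeries.rescale (-1) (PowerSeries.mk fun n => b (n + 1)) := by
  ext n
  cases n with
  | zero => simp
  | succ n =>
    simp [PowerSeries.coeff_rescale, PowerSeries.coeff_succ_X_mul, pow_succ, -eq_intCast]

/-- The Euler characteristic of a linear resolution: h i is the Hilbert series of the i-th syzygy
module, in the grading of its own ambient free module, so the generator degrees are δ, 1, 1, …. -/
theorem eq_of_series_recursion {b : ℕ → ℤ} {h : ℕ → PowerSeries ℤ} {H : PowerSeries ℤ} {δ : ℕ}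
    (h0 : h 0 + PowerSeries.X ^ δ * h 1 = PowerSeries.C (b 0) * PowerSeries.X ^ δ * H)
    (hs : ∀ i, h (i + 1) + PowerSeries.X * h (i + 2)
      = PowerSeries.C (b (i + 1)) * PowerSeries.X * H) :
    h 0 = PowerSeries.X ^ δ * H * PowerSeries.rescale (-1) (PowerSeries.mk b) := by
  -- The error between h (i + 1) and its predicted value satisfies the homogeneous recursion.
  have he := eq_zero_of_eq_neg_X_mul (e := fun i => h (i + 1) - PowerSeries.X * H *
    PowerSeries.rescale (-1) (PowerSeries.mk fun n => b (n + (i + 1)))) (fun i => by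
      have := rescale_neg_one_mk fun n => b (n + (i + 1))
      simp only [zero_add, add_assoc, add_comm 1] at this ⊢
      rw [this]
      linear_combination hs i) 0
  have := rescale_neg_one_mk b
  simp only [zero_add] at he
  rw [this]
  linear_combination h0 - PowerSeries.X ^ δ * he

end Series

/-! ### Construction of linear resolutions and their Poincaré series. -/

section Resolutions

variable {k A : Type*} [Field k] [CommRing A] [Algebra k A]
  (𝒜 : ℕ → Submodule k A) [GradedAlgebra 𝒜]

/-- The Hilbert series of a graded algebra. -/
def hilbertSeries : PowerSeries ℤ := PowerSeries.mk fun t => (Module.finrank k (𝒜 t) : ℤ)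

/-- The homogeneous vectors of degree `t` are the vectors with coordinates in `𝒜 t`. -/
def homVecEquiv (r t : ℕ) : homVec 𝒜 r t ≃ₗ[k] (Fin r → 𝒜 t) where
  toFun v a := ⟨v.1 a, mem_homVec.1 v.2 a⟩
  invFun w := ⟨fun a => w a, mem_homVec.2 fun a => (w a).2⟩
  map_add' _ _ := rfl
  map_smul' _ _ := rfl
  left_inv _ := rfl
  right_inv _ := rfl

instance finite_homVec [∀ t, Module.Finite k (𝒜 t)] (r t : ℕ) :
    Module.Finite k (homVec 𝒜 r t) :=
  Module.Finite.equiv (homVecEquiv 𝒜 r t).symm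

theorem finrank_homVec [∀ t, Module.Finite k (𝒜 t)] (r t : ℕ) :
    Module.finrank k (homVec 𝒜 r t) = r * Module.finrank k (𝒜 t) := by
  rw [(homVecEquiv 𝒜 r t).finrank_eq, Module.finrank_pi_fintype]
  simp

/-- The dimension of the degree `t` component of a submodule of a free module. -/
def gradedRank {r : ℕ} (N : Submodule A (Fin r → A)) (t : ℕ) : ℕ :=
  Module.finrank k ↥(N.restrictScalars k ⊓ homVec 𝒜 r t)

variable {𝒜}

theorem gradedRank_add_gradedRank [∀ t, Module.Finite k (𝒜 t)] {r s δ : ℕ}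
    {d : (Fin s → A) →ₗ[A] (Fin r → A)} (hd : RaisesDegree 𝒜 d δ) (t : ℕ) :
    gradedRank 𝒜 (LinearMap.range d) (t + δ) + gradedRank 𝒜 (LinearMap.ker d) t
      = s * Module.finrank k (𝒜 t) := by
  let g : homVec 𝒜 s t →ₗ[k] (Fin r → A) := d.restrictScalars k ∘ₗ (homVec 𝒜 s t).subtype
  have h1 : (LinearMap.range d).restrictScalars k ⊓ homVec 𝒜 r (t + δ) = LinearMap.range g := by
    ext x
    constructor
    · rintro ⟨⟨v, rfl⟩, hx⟩
      refine ⟨⟨vproj 𝒜 s t v, vproj_mem 𝒜 s t v⟩, ?_⟩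
      change d (vproj 𝒜 s t v) = _
      rw [← hd, vproj_of_mem 𝒜 hx]
    · rintro ⟨v, rfl⟩
      exact ⟨⟨v.1, rfl⟩, hd.mem_homVec v.2⟩
  have h2 : (LinearMap.ker d).restrictScalars k ⊓ homVec 𝒜 s t =
      (LinearMap.ker g).map (homVec 𝒜 s t).subtype := by
    ext x
    constructor
    · rintro ⟨h1, h2⟩
      exact ⟨⟨x, h2⟩, h1, rfl⟩
    · rintro ⟨v, h1, rfl⟩
      exact ⟨h1, v.2⟩
  rw [← finrank_homVec, ← LinearMap.finrank_range_add_finrank_ker g, gradedRank, gradedRank, h1,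
    h2, Submodule.finrank_map_subtype_eq]

/-- Rank-nullity for 0 → ker d → A^s(-δ) → N → 0 in each degree; below δ both sides vanish by `low`.
-/
theorem series_eq_of_range_eq [∀ t, Module.Finite k (𝒜 t)] {𝓛 : Set (Ideal A)} {r s δ : ℕ}
    {N : Submodule A (Fin r → A)} (hN : IsLin 𝒜 𝓛 N δ)
    {d : (Fin s → A) →ₗ[A] (Fin r → A)} (hd : RaisesDegree 𝒜 d δ)
    (hr : LinearMap.range d = N) :
    (PowerSeries.mk fun t => (gradedRank 𝒜 N t : ℤ)) +
        PowerSeries.X ^ δ * (PowerSeries.mk fun t => (gradedRank 𝒜 (LinearMap.ker d) t : ℤ)) =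
      PowerSeries.C (s : ℤ) * PowerSeries.X ^ δ * hilbertSeries 𝒜 := by
  ext t
  rw [mul_assoc, PowerSeries.coeff_C_mul, map_add, PowerSeries.coeff_X_pow_mul',
    PowerSeries.coeff_X_pow_mul', PowerSeries.coeff_mk]
  split_ifs with h
  · obtain ⟨t, rfl⟩ := Nat.exists_eq_add_of_le' h
    simp only [Nat.add_sub_cancel, PowerSeries.coeff_mk, hilbertSeries]
    have := gradedRank_add_gradedRank hd t
    rw [hr] at this
    exact_mod_cast this
  · have : N.restrictScalars k ⊓ homVec 𝒜 r t = ⊥ := by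
      rw [eq_bot_iff]
      rintro v ⟨h1, h2⟩
      rw [Submodule.mem_bot, ← vproj_of_mem 𝒜 h2]
      exact hN.low v h1 t (by omega)
    simp [gradedRank, this]

theorem mem_freePart_const {r e j : ℕ} {deg : Fin r → ℕ} (hdeg : ∀ a, deg a = e)
    {v : Fin r → A} :
    v ∈ freePart 𝒜 deg j ↔ if e ≤ j then v ∈ homVec 𝒜 r (j - e) else v = 0 := by
  simp only [freePart, Submodule.mem_pi, Set.mem_univ, true_implies, twist, hdeg]
  split_ifs with h
  · exact mem_homVec.symm
  · simp [funext_iff]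

theorem eq_zero_of_mem_maxIdeal {x : A} (h0 : x ∈ 𝒜 0) (hm : x ∈ maxIdeal 𝒜) : x = 0 := by
  have := (HomogeneousIdeal.mem_irrelevant_iff 𝒜 x).1 hm
  rwa [GradedRing.proj_apply, DirectSum.decompose_of_mem_same 𝒜 h0] at this

theorem finrank_zero_eq_one [Nontrivial A] (h0 : 𝒜 0 = 1) : Module.finrank k (𝒜 0) = 1 := by
  rw [h0, Submodule.one_eq_span]
  exact finrank_span_singleton one_ne_zero

/-- By minimality k ⊗ F has zero differential, and F_i/𝔪F_i lives only in degree e i. -/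
theorem betti_eq [Nontrivial A] [∀ t, Module.Finite k (𝒜 t)] (h0 : 𝒜 0 = 1)
    {M : Type*} [AddCommGroup M] [Module k M] [Module A M] {ℳ : ℕ → Submodule k M}
    (F : GradedFreeResolution 𝒜 ℳ) {e : ℕ → ℕ} (hdeg : ∀ i a, F.deg i a = e i)
    (hmin : ∀ i v, F.d i v ∈ F.maxSMul i) (i j : ℕ) :
    F.betti i j = if j = e i then F.rank i else 0 := by
  have hc : F.cycles i j = freePart 𝒜 (F.deg i) j := by
    cases i with
    | zero => rfl
    | succ i => exact inf_eq_left.2 fun v _ => hmin i v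
  have hb : F.boundaries i = (F.maxSMul i).restrictScalars k := by
    rw [GradedFreeResolution.boundaries, sup_eq_left.2]
    rintro _ ⟨v, rfl⟩
    exact hmin i v
  have hmem : ∀ v, v ∈ F.boundaries i ↔ ∀ a, v a ∈ maxIdeal 𝒜 := by
    intro v
    rw [hb]
    exact mem_smul_top_iff
  rw [GradedFreeResolution.betti]
  split_ifs with h
  · have h1 : (F.boundaries i).comap (F.cycles i j).subtype = ⊥ := by
      rw [eq_bot_iff]
      rintro ⟨v, hv⟩ hv'
      rw [hc, mem_freePart_const (hdeg i), if_pos h.ge, h, Nat.sub_self] at hv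
      exact Subtype.ext (funext fun a =>
        eq_zero_of_mem_maxIdeal (mem_homVec.1 hv a) ((hmem v).1 hv' a))
    have h2 : F.cycles i j = homVec 𝒜 (F.rank i) 0 := by
      ext v
      rw [hc, mem_freePart_const (hdeg i), if_pos h.ge, h, Nat.sub_self]
    change Module.finrank k (F.cycles i j ⧸ (F.boundaries i).comap (F.cycles i j).subtype) = _
    rw [h1, (Submodule.quotEquivOfEqBot _ rfl).finrank_eq, h2,
      finrank_homVec, finrank_zero_eq_one h0, mul_one]
  · have h1 : (F.boundaries i).comap (F.cycles i j).subtype = ⊤ := by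
      rw [eq_top_iff]
      rintro ⟨v, hv⟩ -
      rw [hc, mem_freePart_const (hdeg i)] at hv
      refine (hmem v).2 fun a => ?_
      split_ifs at hv with h'
      · exact mem_maxIdeal_of_mem (by omega) (mem_homVec.1 hv a)
      · rw [hv]; exact zero_mem _
    change Module.finrank k (F.cycles i j ⧸ (F.boundaries i).comap (F.cycles i j).subtype) = _
    rw [h1]
    exact Module.finrank_zero_of_subsingleton

/-- A stage in the construction of a linear resolution. -/
structure LinStage (𝒜 : ℕ → Submodule k A) [GradedAlgebra 𝒜] (𝓛 : Set (Ideal A)) where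
  /-- the rank of the ambient free module -/
  r : ℕ
  /-- the module of syzygies -/
  N : Submodule A (Fin r → A)
  /-- the degree of the generators of the module of syzygies -/
  δ : ℕ
  lin : IsLin 𝒜 𝓛 N δ

/-- Iterating `IsLin.exists_cover` gives a resolution whose term in position i + 1 is generated in
degree i + δ. Its Poincaré series is therefore 1 + z s^δ b(sz), and b is read off from the Hilbert
series of the kernel of ε. -/
theorem exists_poincareSeries [Nontrivial A] [∀ t, Module.Finite k (𝒜 t)] (h0 : 𝒜 0 = 1)
    {B : Type*} [CommRing B] {φ : A →+* B} {𝓛 : Set (Ideal A)}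
    (hm : maxIdeal 𝒜 ∈ 𝓛) (hF : ∀ L ∈ 𝓛, LinFlag 𝒜 𝓛 φ L)
    {M : Type*} [AddCommGroup M] [Module k M] [Module A M] (ℳ : ℕ → Submodule k M)
    (ε : A →ₗ[A] M) (hε : Function.Surjective ε) (hℳ : ∀ j, ∀ a ∈ 𝒜 j, ε a ∈ ℳ j)
    {δ : ℕ} (hδ : 0 < δ)
    (h : IsLin 𝒜 𝓛 (Submodule.pi Set.univ fun _ : Fin 1 => LinearMap.ker ε) δ) :
    ∃ b : PowerSeries ℤ,
      IsPoincareSeries 𝒜 ℳ (1 + PowerSeries.X * PowerSeries.C (PowerSeries.X ^ δ) *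
        diagonalSeries b) ∧
      (PowerSeries.mk fun t => (gradedRank 𝒜
        (Submodule.pi Set.univ fun _ : Fin 1 => LinearMap.ker ε) t : ℤ)) =
        PowerSeries.X ^ δ * hilbertSeries 𝒜 * PowerSeries.rescale (-1) b := by
  choose s d hd hr hk using fun S : LinStage 𝒜 𝓛 => S.lin.exists_cover h0 hm hF
  let S : ℕ → LinStage 𝒜 𝓛 := fun i =>
    Nat.rec ⟨1, _, δ, h⟩ (fun _ S => ⟨s S, LinearMap.ker (d S), 1, hk S⟩) i
  -- Only the first syzygies are generated in degree δ relative to F_0; all later ones are generated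
  -- in relative degree 1.
  let e : ℕ → ℕ := fun i => Nat.casesOn i 0 fun i => i + δ
  have he : ∀ i, e (i + 1) = e i + (S i).δ := by
    intro i
    cases i with
    | zero => rfl
    | succ i => exact Nat.add_right_comm _ _ _
  have hpos : ∀ i, 0 < (S i).δ := by
    intro i
    cases i with
    | zero => exact hδ
    | succ i => exact Nat.one_pos
  let F : GradedFreeResolution 𝒜 ℳ :=
    { rank := fun i => (S i).r
      deg := fun i _ => e i
      d := fun i => d (S i)
      aug := ε ∘ₗ LinearMap.proj (R := A) (φ := fun _ : Fin 1 => A) 0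
      d_mem := by
        intro i j v hv
        rw [mem_freePart_const fun _ => rfl] at hv ⊢
        rw [he i] at hv
        split_ifs at hv with h1
        · rw [if_pos (by omega)]
          have := (hd (S i)).mem_homVec hv
          rwa [show j - (e i + (S i).δ) + (S i).δ = j - e i by omega] at this
        · rw [hv, map_zero]
          split_ifs
          exacts [zero_mem _, rfl]
      aug_mem := by
        intro j v hv
        rw [mem_freePart_const (e := e 0) fun _ => rfl,
          if_pos (show e 0 ≤ j from Nat.zero_le _)] at hv
        exact hℳ j _ (mem_homVec.1 hv 0)
      aug_surjective := fun x => by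
        obtain ⟨a, ha⟩ := hε x
        exact ⟨fun _ => a, ha⟩
      exact_zero := by
        rw [LinearMap.exact_iff, hr (S 0)]
        ext v
        change ε (v 0) = 0 ↔ v ∈ Submodule.pi Set.univ fun _ : Fin 1 => LinearMap.ker ε
        simp [Submodule.mem_pi]
      exact_succ := by
        intro i
        rw [LinearMap.exact_iff, hr (S (i + 1))] }
  -- Every differential raises internal degrees by at least 1, so the resolution is minimal.
  have hmin : ∀ i v, F.d i v ∈ F.maxSMul i := by
    intro i v
    obtain ⟨T, hT⟩ := exists_eq_sum_vproj 𝒜 v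
    rw [hT, map_sum]
    refine Submodule.sum_mem _ fun t _ => mem_smul_top_iff.2 fun a => ?_
    exact mem_maxIdeal_of_mem (by have := hpos i; omega : 0 < t + (S i).δ)
      (mem_homVec.1 ((hd (S i)).mem_homVec (vproj_mem 𝒜 _ t v)) a)
  have hbetti := betti_eq h0 F (e := e) (fun _ _ => rfl) hmin
  refine ⟨PowerSeries.mk fun i => (s (S i) : ℤ), ⟨F, ?_⟩, ?_⟩
  · ext i j
    rw [GradedFreeResolution.poincareSeries, PowerSeries.coeff_mk, PowerSeries.coeff_mk, hbetti,
      mul_assoc]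
    cases i with
    | zero =>
      simp only [map_add, PowerSeries.coeff_zero_X_mul, add_zero,
        PowerSeries.coeff_one, if_true]
      change ((if j = 0 then 1 else 0 : ℕ) : ℤ) = _
      split_ifs <;> rfl
    | succ i =>
      rw [map_add, PowerSeries.coeff_succ_X_mul, PowerSeries.coeff_C_mul, coeff_diagonalSeries,
        PowerSeries.coeff_mk, ← mul_assoc, ← pow_add, PowerSeries.coeff_one,
        if_neg (Nat.succ_ne_zero i), zero_add, PowerSeries.coeff_mul_C, PowerSeries.coeff_X_pow]
      change ((if j = i + δ then s (S i) else 0 : ℕ) : ℤ) = _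
      rw [Nat.add_comm δ i]
      split_ifs <;> simp
  · refine eq_of_series_recursion (h := fun i => PowerSeries.mk fun t =>
      (gradedRank 𝒜 (S i).N t : ℤ)) ?_ ?_
    · exact series_eq_of_range_eq (S 0).lin (hd (S 0)) (hr (S 0))
    · intro i
      have := series_eq_of_range_eq (S (i + 1)).lin (hd (S (i + 1))) (hr (S (i + 1)))
      rw [show (S (i + 1)).δ = 1 from rfl, pow_one] at this
      exact this

end Resolutions
end BackelinRoos
end

noncomputable section
set_option linter.unusedSectionVars false
namespace BackelinRoos
open MvPolynomial

/-! ### Ideals as submodules of A^1, and Koszulness. -/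

section Ideals

variable {k A : Type*} [Field k] [CommRing A] [Algebra k A]
  {𝒜 : ℕ → Submodule k A} [GradedAlgebra 𝒜]

/-- An ideal of `A`, as a submodule of `A^1`. -/
abbrev idealVec (J : Ideal A) : Submodule A (Fin 1 → A) := Submodule.pi Set.univ fun _ => J

theorem mem_idealVec {J : Ideal A} {v : Fin 1 → A} : v ∈ idealVec J ↔ v 0 ∈ J := by
  simp [Submodule.mem_pi]

theorem mem_smul_idealVec {L J : Ideal A} {v : Fin 1 → A} :
    v ∈ L • idealVec J ↔ v 0 ∈ L * J := by
  constructor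
  · intro h
    induction h using Submodule.smul_induction_on' with
    | add x _ y _ hx hy => exact add_mem hx hy
    | smul r hr n hn => exact Ideal.mul_mem_mul hr (mem_idealVec.1 hn)
  · intro h
    have key : ∀ x ∈ L * J, (fun _ : Fin 1 => x) ∈ L • idealVec J := by
      intro x hx
      induction hx using Submodule.mul_induction_on' with
      | mem_mul_mem a ha b hb =>
        exact Submodule.smul_mem_smul (n := fun _ : Fin 1 => b) ha (mem_idealVec.2 hb)
      | add x _ y _ hx hy => exact add_mem hx hy
    convert key _ h using 1
    funext a
    rw [Subsingleton.elim a 0]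

theorem isLin_idealVec {𝓛 : Set (Ideal A)} {J : Ideal A} {δ : ℕ} (hJ : J.IsHomogeneous 𝒜)
    (low : ∀ t < δ, ∀ x ∈ J, x ∈ 𝒜 t → x = 0)
    (inter : ∀ L ∈ 𝓛, ∀ t, δ < t → ∀ x ∈ J, x ∈ 𝒜 t → x ∈ L → x ∈ L * J) :
    IsLin 𝒜 𝓛 (idealVec J) δ where
  homogeneous v hv t := mem_idealVec.2 (gproj_mem_of_isHomogeneous 𝒜 hJ (mem_idealVec.1 hv) t)
  low v hv t ht := by
    funext a
    rw [Subsingleton.elim a 0]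
    exact low t ht _ (gproj_mem_of_isHomogeneous 𝒜 hJ (mem_idealVec.1 hv) t) (gproj_mem 𝒜 _ _)
  inter L hL t ht v hv hvt hvL := mem_smul_idealVec.2
    (inter L hL t ht _ (mem_idealVec.1 hv) (mem_homVec.1 hvt 0) (hvL 0))

theorem gradedRank_idealVec (J : Ideal A) (t : ℕ) :
    gradedRank 𝒜 (idealVec J) t = Module.finrank k ↥(J.restrictScalars k ⊓ 𝒜 t) := by
  let e : ↥((idealVec J).restrictScalars k ⊓ homVec 𝒜 1 t) ≃ₗ[k]
      ↥(J.restrictScalars k ⊓ 𝒜 t) :=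
    { toFun := fun v => ⟨v.1 0, mem_idealVec.1 v.2.1, mem_homVec.1 v.2.2 0⟩
      invFun := fun x => ⟨fun _ => x.1, mem_idealVec.2 x.2.1, mem_homVec.2 fun _ => x.2.2⟩
      map_add' := fun _ _ => rfl
      map_smul' := fun _ _ => rfl
      left_inv := fun v => Subtype.ext (funext fun a => by rw [Subsingleton.elim a 0])
      right_inv := fun _ => rfl }
  exact e.finrank_eq

/-- In x = u + ℓw the cofactor w has positive degree, so ℓw already lies in L·𝔪; the flag takes care
of u. -/
theorem mem_mul_maxIdeal {B : Type*} [CommRing B] {φ : A →+* B} {𝓛 : Set (Ideal A)} {L : Ideal A}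
    (h : LinFlag 𝒜 𝓛 φ L) {t : ℕ} (ht : 1 < t) {x : A} (hx : x ∈ 𝒜 t) (hL : x ∈ L) :
    x ∈ L * maxIdeal 𝒜 := by
  induction h generalizing x with
  | bot => rw [Submodule.mem_bot] at hL; rw [hL]; exact zero_mem _
  | @step L₀ L₁ ℓ h₀ hl h₁ hc _ ih =>
    obtain ⟨t, rfl⟩ := Nat.exists_eq_add_of_le ht.le
    obtain ⟨u, hu, w, hw, hut, rfl⟩ := exists_of_mem_sup_span h₀.isHomogeneous hl hx hL
    refine add_mem (Ideal.mul_mono_left le_sup_left (ih hut hu)) (Ideal.mul_mem_mul ?_ ?_)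
    · exact le_sup_right (a := L₀) (Ideal.mem_span_singleton_self ℓ)
    · exact mem_maxIdeal_of_mem (by omega) hw

theorem maxIdeal_isHomogeneous : (maxIdeal 𝒜).IsHomogeneous 𝒜 :=
  (HomogeneousIdeal.irrelevant 𝒜).isHomogeneous

theorem isLin_maxIdeal {B : Type*} [CommRing B] {φ : A →+* B} {𝓛 : Set (Ideal A)}
    (hF : ∀ L ∈ 𝓛, LinFlag 𝒜 𝓛 φ L) : IsLin 𝒜 𝓛 (idealVec (maxIdeal 𝒜)) 1 := by
  refine isLin_idealVec maxIdeal_isHomogeneous (fun t ht x hx hxt => ?_)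
    fun L hL t ht x _ hxt hxL => mem_mul_maxIdeal (hF L hL) ht hxt hxL
  obtain rfl : t = 0 := by omega
  exact eq_zero_of_mem_maxIdeal hxt hx

theorem maxIdeal_series [Nontrivial A] (h0 : 𝒜 0 = 1) :
    (PowerSeries.mk fun t => (gradedRank 𝒜 (idealVec (maxIdeal 𝒜)) t : ℤ))
      = hilbertSeries 𝒜 - 1 := by
  ext t
  rw [PowerSeries.coeff_mk, gradedRank_idealVec, map_sub, hilbertSeries, PowerSeries.coeff_mk,
    PowerSeries.coeff_one]
  split_ifs with h
  · subst h
    rw [finrank_zero_eq_one h0]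
    have : (maxIdeal 𝒜).restrictScalars k ⊓ 𝒜 0 = ⊥ :=
      eq_bot_iff.2 fun x hx => eq_zero_of_mem_maxIdeal hx.2 hx.1
    rw [this]
    simp
  · have : (maxIdeal 𝒜).restrictScalars k ⊓ 𝒜 t = 𝒜 t :=
      inf_eq_right.2 fun x hx => mem_maxIdeal_of_mem (Nat.pos_of_ne_zero h) hx
    rw [this, sub_zero]

/-- The case δ = 1 for the residue field. Since P(s, -1) = 1 - s b(-s), the second identity is the
Koszul relation H(s) P(s, -1) = 1. -/
theorem exists_residue_poincareSeries [Nontrivial A] [∀ t, Module.Finite k (𝒜 t)] (h0 : 𝒜 0 = 1)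
    {B : Type*} [CommRing B] {φ : A →+* B} {𝓛 : Set (Ideal A)}
    (hm : maxIdeal 𝒜 ∈ 𝓛) (hF : ∀ L ∈ 𝓛, LinFlag 𝒜 𝓛 φ L) :
    ∃ b : PowerSeries ℤ,
      IsPoincareSeries 𝒜 (residueGrading 𝒜) (1 + PowerSeries.X * PowerSeries.C PowerSeries.X *
        diagonalSeries b) ∧
      hilbertSeries 𝒜 * (1 - PowerSeries.X * PowerSeries.rescale (-1) b) = 1 := by
  have hlin := isLin_maxIdeal hF
  have hker : LinearMap.ker (Submodule.mkQ (maxIdeal 𝒜)) = maxIdeal 𝒜 := Submodule.ker_mkQ _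
  obtain ⟨b, h1, h2⟩ := exists_poincareSeries h0 hm hF (residueGrading 𝒜)
    (Submodule.mkQ (maxIdeal 𝒜)) (Submodule.mkQ_surjective _) (fun j a ha => by
      rw [residueGrading]
      split_ifs with hj
      · trivial
      · exact (Submodule.Quotient.mk_eq_zero _).2
          (mem_maxIdeal_of_mem (Nat.pos_of_ne_zero hj) ha)) Nat.one_pos (by rwa [hker])
  rw [hker, maxIdeal_series h0, pow_one] at h2
  rw [pow_one] at h1
  exact ⟨b, h1, by linear_combination h2⟩

end Ideals

/-! ### The Golod identity from linear resolutions. -/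

section Golod

variable {k Q R : Type*} [Field k] [CommRing Q] [Algebra k Q] [CommRing R] [Algebra k R]
    {𝒬 : ℕ → Submodule k Q} [GradedAlgebra 𝒬] {ℛ : ℕ → Submodule k R} [GradedAlgebra ℛ]
    {φ : Q →ₐ[k] R}

theorem map_gproj (hφ : ∀ j, ∀ q ∈ 𝒬 j, φ q ∈ ℛ j) (t : ℕ) (x : Q) :
    φ (GradedAlgebra.proj 𝒬 t x) = GradedAlgebra.proj ℛ t (φ x) := by
  obtain ⟨T, hT⟩ := exists_eq_sum_gproj 𝒬 x
  conv_rhs => rw [hT (T + t + 1) (by omega), map_sum, map_sum]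
  rw [Finset.sum_eq_single t]
  · rw [gproj_of_mem ℛ (hφ t _ (gproj_mem 𝒬 t x))]
  · intro i _ hi
    exact gproj_of_mem_ne ℛ (hφ i _ (gproj_mem 𝒬 i x)) hi
  · intro h
    exact absurd (Finset.mem_range.2 (by omega)) h

theorem ker_isHomogeneous (hφ : ∀ j, ∀ q ∈ 𝒬 j, φ q ∈ ℛ j) :
    (RingHom.ker φ).IsHomogeneous 𝒬 := by
  intro t x hx
  rw [RingHom.mem_ker] at hx ⊢
  rw [← GradedAlgebra.proj_apply, map_gproj hφ, hx, map_zero]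

theorem exists_mem_of_surjective (hφ : ∀ j, ∀ q ∈ 𝒬 j, φ q ∈ ℛ j) (hs : Function.Surjective φ)
    {t : ℕ} {y : R} (hy : y ∈ ℛ t) : ∃ x ∈ 𝒬 t, φ x = y := by
  obtain ⟨x, rfl⟩ := hs y
  exact ⟨_, gproj_mem 𝒬 t x, by rw [map_gproj hφ, gproj_of_mem ℛ hy]⟩

/-- Write x = u + ℓw. As φ(x) = 0, φ(ℓw) lies in L₀R, so φ(w) = φ(w') with w' in L₁ by the condition
on colon ideals in R; the degree of w is at least 2, as that condition demands. Then w - w' is in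
the kernel, and u + ℓw' lies in L₀ and in the kernel, so the induction applies. -/
theorem mem_mul_ker (hφ : ∀ j, ∀ q ∈ 𝒬 j, φ q ∈ ℛ j) (hs : Function.Surjective φ)
    {𝓛 : Set (Ideal Q)} (hF : ∀ L ∈ 𝓛, LinFlag 𝒬 𝓛 (φ : Q →+* R) L) {L : Ideal Q}
    (h : LinFlag 𝒬 𝓛 (φ : Q →+* R) L) {t : ℕ} (ht : 2 < t) {x : Q} (hx : x ∈ 𝒬 t) (hL : x ∈ L)
    (hk : φ x = 0) : x ∈ L * RingHom.ker φ := by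
  induction h generalizing x with
  | bot => rw [Submodule.mem_bot] at hL; rw [hL]; exact zero_mem _
  | @step L₀ L₁ ℓ h₀ hl h₁ hc hc' ih =>
    obtain ⟨t, rfl⟩ := Nat.exists_eq_add_of_le (show 1 ≤ t by omega)
    obtain ⟨u, hu, w, hw, hut, rfl⟩ := exists_of_mem_sup_span h₀.isHomogeneous hl hx hL
    have h2 : φ (ℓ * w) ∈ L₀.map (φ : Q →+* R) := by
      rw [map_add] at hk
      rw [eq_neg_of_add_eq_zero_right hk]
      exact neg_mem (Ideal.mem_map_of_mem (φ : Q →+* R) hu)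
    obtain ⟨w₀, hw₀, hww⟩ := (Ideal.mem_map_iff_of_surjective (φ : Q →+* R) hs).1
      (hc' t (by omega) w hw h2)
    set w' := GradedAlgebra.proj 𝒬 t w₀
    have hw' : w' ∈ L₁ := gproj_mem_of_isHomogeneous 𝒬 (hF L₁ h₁).isHomogeneous hw₀ t
    have hφw : φ (w - w') = 0 := by
      rw [map_sub, map_gproj hφ, show φ w₀ = φ w from hww, ← map_gproj hφ, gproj_of_mem 𝒬 hw,
        sub_self]
    rw [show u + ℓ * w = (u + ℓ * w') + ℓ * (w - w') by ring] at hk ⊢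
    refine add_mem (Ideal.mul_mono_left le_sup_left (ih ?_ ?_ ?_)) (Ideal.mul_mem_mul ?_ hφw)
    · exact add_mem hut (SetLike.mul_mem_graded hl (gproj_mem 𝒬 t w₀))
    · exact add_mem hu ((hc _).2 hw')
    · rwa [map_add, map_mul φ ℓ (w - w'), hφw, mul_zero, add_zero] at hk
    · exact le_sup_right (a := L₀) (Ideal.mem_span_singleton_self ℓ)

theorem ker_series [∀ t, Module.Finite k (𝒬 t)] (hφ : ∀ j, ∀ q ∈ 𝒬 j, φ q ∈ ℛ j)
    (hs : Function.Surjective φ) :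
    (PowerSeries.mk fun t => (gradedRank 𝒬 (idealVec (RingHom.ker φ)) t : ℤ))
      = hilbertSeries 𝒬 - hilbertSeries ℛ := by
  ext t
  rw [PowerSeries.coeff_mk, gradedRank_idealVec, map_sub, hilbertSeries, hilbertSeries,
    PowerSeries.coeff_mk, PowerSeries.coeff_mk]
  let g : 𝒬 t →ₗ[k] R := φ.toLinearMap ∘ₗ (𝒬 t).subtype
  have h1 : LinearMap.range g = ℛ t := by
    ext y
    constructor
    · rintro ⟨x, rfl⟩
      exact hφ t _ x.2
    · intro hy
      obtain ⟨x, hx, rfl⟩ := exists_mem_of_surjective hφ hs hy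
      exact ⟨⟨x, hx⟩, rfl⟩
  have h2 : (RingHom.ker φ).restrictScalars k ⊓ 𝒬 t = (LinearMap.ker g).map (𝒬 t).subtype := by
    ext x
    constructor
    · rintro ⟨h1, h2⟩
      exact ⟨⟨x, h2⟩, h1, rfl⟩
    · rintro ⟨v, h1, rfl⟩
      exact ⟨h1, v.2⟩
  have := LinearMap.finrank_range_add_finrank_ker g
  rw [h2, Submodule.finrank_map_subtype_eq, ← this, h1]
  push_cast
  ring

theorem isGolod_of_linFlag [Nontrivial R] [∀ t, Module.Finite k (𝒬 t)]
    [∀ t, Module.Finite k (ℛ t)] (hQ0 : 𝒬 0 = 1) (hR0 : ℛ 0 = 1)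
    (hφ : ∀ j, ∀ q ∈ 𝒬 j, φ q ∈ ℛ j) (hs : Function.Surjective φ)
    (hinj : ∀ t < 2, ∀ q ∈ 𝒬 t, φ q = 0 → q = 0)
    {𝓛 : Set (Ideal Q)} (hm : maxIdeal 𝒬 ∈ 𝓛)
    (hF : ∀ L ∈ 𝓛, LinFlag 𝒬 𝓛 (φ : Q →+* R) L)
    {𝓛' : Set (Ideal R)} (hm' : maxIdeal ℛ ∈ 𝓛')
    (hF' : ∀ L ∈ 𝓛', LinFlag ℛ 𝓛' (RingHom.id R) L) : IsGolod 𝒬 ℛ φ := by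
  let _ : Module Q R := Module.compHom R (φ : Q →+* R)
  have : Nontrivial Q := hs.nontrivial
  let ε : Q →ₗ[Q] R :=
    { toFun := φ
      map_add' := map_add φ
      map_smul' := fun a x => map_mul φ a x }
  have hker : LinearMap.ker ε = RingHom.ker φ := by
    ext x; rfl
  have hlin : IsLin 𝒬 𝓛 (idealVec (RingHom.ker φ)) 2 :=
    isLin_idealVec (ker_isHomogeneous hφ) (fun t ht x hx hxt => hinj t ht x hxt hx)
      fun L hL t ht x hx hxt hxL => mem_mul_ker hφ hs hF (hF L hL) ht hxt hxL hx
  obtain ⟨b, hb, hb'⟩ := exists_poincareSeries hQ0 hm hF ℛ ε hs hφ Nat.two_pos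
    (by rwa [hker])
  obtain ⟨c, hc, hc'⟩ := exists_residue_poincareSeries hQ0 hm hF
  obtain ⟨e, he, he'⟩ := exists_residue_poincareSeries hR0 hm' hF'
  rw [hker, ker_series hφ hs] at hb'
  refine ⟨hs, hφ, ?_, _, _, _, he, hc, hb, ?_⟩
  -- The kernel begins in degree 2, and elements of 𝔪 of degree at least 2 lie in 𝔪².
  · intro x hx
    obtain ⟨T, hT⟩ := exists_eq_sum_gproj 𝒬 x
    rw [hT T le_rfl, pow_two]
    refine Ideal.sum_mem _ fun t _ => ?_
    have hx' : φ (GradedAlgebra.proj 𝒬 t x) = 0 :=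
      gproj_mem_of_isHomogeneous 𝒬 (ker_isHomogeneous hφ) hx t
    rcases lt_or_ge t 2 with ht | ht
    · rw [hinj t ht _ (gproj_mem 𝒬 t x) hx']
      exact zero_mem _
    · exact mem_mul_maxIdeal (hF _ hm) ht (gproj_mem 𝒬 t x)
        (mem_maxIdeal_of_mem (by omega) (gproj_mem 𝒬 t x))
  · have hne : hilbertSeries 𝒬 ≠ 0 := by
      intro h
      rw [h, zero_mul] at hc'
      exact zero_ne_one hc'
    set ρ := PowerSeries.rescale (-1 : ℤ) with hρ
    -- Substitute H_R = H_Q (1 - s² b(-s)) into the two Koszul relations and cancel H_Q.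
    have h1 : (1 - PowerSeries.X * ρ e) * (1 - PowerSeries.X ^ 2 * ρ b) =
        1 - PowerSeries.X * ρ c := by
      apply mul_left_cancel₀ hne
      linear_combination he' - hc' + (1 - PowerSeries.X * ρ e) * hb'
    have hX : ρ PowerSeries.X = -PowerSeries.X := by
      ext n
      rw [hρ, PowerSeries.coeff_rescale, map_neg, PowerSeries.coeff_X]
      split_ifs with h <;> simp [h]
    have hinv : ∀ x, ρ (ρ x) = x := by
      intro x
      ext n
      rw [hρ, PowerSeries.coeff_rescale, PowerSeries.coeff_rescale, ← mul_assoc, ← mul_pow]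
      simp
    -- Replace s by -s, then by sz: this is the Golod identity, with z(P^Q_R - 1) = z² s² b(sz).
    have h2 := congrArg ρ h1
    simp only [map_mul, map_sub, map_one, map_pow, hinv, hX] at h2
    have h3 := congrArg diagonalSeries h2
    simp only [map_mul, map_sub, map_one, map_pow, map_neg, diagonalSeries_X] at h3
    rw [map_pow]
    linear_combination h3

end Golod
end BackelinRoos
end

noncomputable section
set_option linter.unusedSectionVars false
namespace BackelinRoos
open MvPolynomial

/-! ### Flags in a quotient ring, described upstairs. -/

section Quotients

variable {k A R : Type*} [Field k] [CommRing A] [Algebra k A] [CommRing R] [Algebra k R]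
  (𝒜 : ℕ → Submodule k A) [GradedAlgebra 𝒜] (𝔠 : Ideal A)

/-- The grading of the quotient of a graded algebra by a homogeneous ideal. -/
def quotGrading (j : ℕ) : Submodule k (A ⧸ 𝔠) :=
  (𝒜 j).map (Ideal.Quotient.mkₐ k 𝔠).toLinearMap

variable {𝒜 𝔠}

theorem quotGrading_isInternal (h : 𝔠.IsHomogeneous 𝒜) :
    DirectSum.IsInternal (quotGrading 𝒜 𝔠) := by
  classical
  rw [DirectSum.isInternal_submodule_iff_iSupIndep_and_iSup_eq_top]
  constructor
  · intro i
    rw [Submodule.disjoint_def]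
    rintro x ⟨a, ha, rfl⟩ hx
    have hmap : (⨆ j, ⨆ _ : j ≠ i, quotGrading 𝒜 𝔠 j) =
        (⨆ j, ⨆ _ : j ≠ i, 𝒜 j).map (Ideal.Quotient.mkₐ k 𝔠).toLinearMap := by
      rw [Submodule.map_iSup]
      exact iSup_congr fun j => (Submodule.map_iSup _ _).symm
    rw [hmap] at hx
    obtain ⟨b, hb, hab⟩ := hx
    have hb0 : GradedAlgebra.proj 𝒜 i b = 0 := by
      have : (⨆ j, ⨆ _ : j ≠ i, 𝒜 j) ≤ LinearMap.ker (GradedAlgebra.proj 𝒜 i) :=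
        iSup₂_le fun j hj y hy => gproj_of_mem_ne 𝒜 hy hj
      exact this hb
    have h1 := gproj_mem_of_isHomogeneous 𝒜 h (Ideal.Quotient.eq.1 hab) i
    rw [map_sub, hb0, gproj_of_mem 𝒜 ha, zero_sub] at h1
    exact Ideal.Quotient.eq_zero_iff_mem.2 ((neg_mem_iff).1 h1)
  · change ⨆ j, (𝒜 j).map (Ideal.Quotient.mkₐ k 𝔠).toLinearMap = ⊤
    rw [← Submodule.map_iSup, (DirectSum.Decomposition.isInternal 𝒜).submodule_iSup_eq_top,
      Submodule.map_top, LinearMap.range_eq_top]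
    exact Ideal.Quotient.mk_surjective

instance quotGradedMonoid : SetLike.GradedMonoid (quotGrading 𝒜 𝔠) where
  one_mem := ⟨1, SetLike.one_mem_graded 𝒜, rfl⟩
  mul_mem := by
    rintro i j _ _ ⟨a, ha, rfl⟩ ⟨b, hb, rfl⟩
    exact ⟨a * b, SetLike.mul_mem_graded ha hb, rfl⟩

/-- The quotient of a graded algebra by a homogeneous ideal is a graded algebra. -/
abbrev quotGradedAlgebra (h : 𝔠.IsHomogeneous 𝒜) : GradedAlgebra (quotGrading 𝒜 𝔠) :=
  { quotGradedMonoid with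
    toDecomposition := (quotGrading_isInternal h).chooseDecomposition }

/-- A version of `LinFlag` for the quotient ring `A ⧸ 𝔠`, stated in terms of ideals of `A`. -/
inductive LinFlagMod (𝒜 : ℕ → Submodule k A) (𝔠 : Ideal A) (𝓛 : Set (Ideal A)) (ψ : A →+* R) :
    Ideal A → Prop
  | bot : LinFlagMod 𝒜 𝔠 𝓛 ψ ⊥
  | step {L₀ L₁ : Ideal A} {ℓ : A} : LinFlagMod 𝒜 𝔠 𝓛 ψ L₀ → ℓ ∈ 𝒜 1 → L₁ ∈ 𝓛 →
      (∀ x, ℓ * x ∈ L₀ ⊔ 𝔠 ↔ x ∈ L₁ ⊔ 𝔠) →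
      (∀ t, 2 ≤ t → ∀ w ∈ 𝒜 t, ψ (ℓ * w) ∈ L₀.map ψ → ψ w ∈ L₁.map ψ) →
      LinFlagMod 𝒜 𝔠 𝓛 ψ (L₀ ⊔ Ideal.span {ℓ})

theorem LinFlagMod.linFlag (h : 𝔠.IsHomogeneous 𝒜) {𝓛 : Set (Ideal A)} {ψ : A →+* R}
    {φ : A ⧸ 𝔠 →+* R} (hφ : φ.comp (Ideal.Quotient.mk 𝔠) = ψ) {L : Ideal A}
    (hL : LinFlagMod 𝒜 𝔠 𝓛 ψ L) :
    letI := quotGradedAlgebra h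
    LinFlag (quotGrading 𝒜 𝔠) (Ideal.map (Ideal.Quotient.mk 𝔠) '' 𝓛) φ
      (L.map (Ideal.Quotient.mk 𝔠)) := by
  let _ := quotGradedAlgebra h
  have hmap : ∀ I : Ideal A, (I.map (Ideal.Quotient.mk 𝔠)).map φ = I.map ψ := by
    intro I
    rw [Ideal.map_map, hφ]
  have hψ : ∀ a, φ (Ideal.Quotient.mk 𝔠 a) = ψ a := fun a => by rw [← hφ]; rfl
  induction hL with
  | bot => rw [Ideal.map_bot]; exact LinFlag.bot
  | @step L₀ L₁ ℓ _ hl h₁ hc hc' ih =>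
    rw [Ideal.map_sup, Ideal.map_span, Set.image_singleton]
    refine LinFlag.step ih ⟨ℓ, hl, rfl⟩ ⟨L₁, h₁, rfl⟩ ?_ ?_
    · intro x
      obtain ⟨x, rfl⟩ := Ideal.Quotient.mk_surjective x
      rw [← map_mul, Ideal.mem_quotient_iff_mem_sup, Ideal.mem_quotient_iff_mem_sup, hc]
    · rintro t ht _ ⟨w, hw, rfl⟩ hx
      change φ (Ideal.Quotient.mk 𝔠 ℓ * Ideal.Quotient.mk 𝔠 w) ∈ _ at hx
      change φ (Ideal.Quotient.mk 𝔠 w) ∈ _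
      rw [← map_mul, hmap, hψ] at hx
      rw [hmap, hψ]
      exact hc' t ht w hw hx

end Quotients

/-! ### The criterion in terms of a presentation by a polynomial ring. -/

section Presentations

attribute [local instance] MvPolynomial.gradedAlgebra

variable {k R : Type*} [Field k] [CommRing R] [Algebra k R]

theorem maxIdeal_quotGrading {A : Type*} [CommRing A] [Algebra k A] {𝒜 : ℕ → Submodule k A}
    [GradedAlgebra 𝒜] {𝔠 : Ideal A} (h : 𝔠.IsHomogeneous 𝒜) :
    letI := quotGradedAlgebra h
    maxIdeal (quotGrading 𝒜 𝔠) = (maxIdeal 𝒜).map (Ideal.Quotient.mk 𝔠) := by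
  let _ := quotGradedAlgebra h
  apply le_antisymm
  · refine (HomogeneousIdeal.toIdeal_irrelevant_le _).2 ?_
    rintro i hi _ ⟨a, ha, rfl⟩
    exact Ideal.mem_map_of_mem _ (mem_maxIdeal_of_mem hi ha)
  · refine Ideal.map_le_iff_le_comap.2 ((HomogeneousIdeal.toIdeal_irrelevant_le _).2 ?_)
    intro i hi a ha
    exact mem_maxIdeal_of_mem (𝒜 := quotGrading 𝒜 𝔠) hi ⟨a, ha, rfl⟩

theorem mem_maxIdeal_iff {V : Type*} {p : MvPolynomial V k} :
    p ∈ maxIdeal (homogeneousSubmodule V k) ↔ coeff 0 p = 0 := by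
  have h : GradedRing.proj (homogeneousSubmodule V k) 0 p = C (coeff 0 p) := by
    rw [← homogeneousComponent_zero]
    exact decomposition.decompose'_apply p 0
  refine (HomogeneousIdeal.mem_irrelevant_iff _ p).trans ?_
  rw [h, C_eq_zero]

theorem isStandardGraded_of_surjective {V : Type*} [Finite V] {ℛ : ℕ → Submodule k R}
    [GradedAlgebra ℛ] [Nontrivial R] {ψ : MvPolynomial V k →ₐ[k] R} (hs : Function.Surjective ψ)
    (hψ : ∀ j, ∀ p ∈ homogeneousSubmodule V k j, ψ p ∈ ℛ j) :
    IsStandardGraded ℛ ∧ ∀ j, Module.Finite k (ℛ j) := by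
  have hmap : ∀ j, (homogeneousSubmodule V k j).map ψ.toLinearMap = ℛ j := by
    intro j
    ext y
    constructor
    · rintro ⟨p, hp, rfl⟩
      exact hψ j p hp
    · intro hy
      obtain ⟨x, hx, rfl⟩ := exists_mem_of_surjective hψ hs hy
      exact ⟨x, hx, rfl⟩
  have hfin : ∀ j, Module.Finite k (ℛ j) := by
    intro j
    rw [← hmap]
    exact Module.Finite.iff_fg.2 ((homogeneousSubmodule_fg V k j).map _)
  refine ⟨⟨inferInstance, ?_, hfin 1, ?_⟩, hfin⟩
  · rw [← hmap, homogeneousSubmodule_zero]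
    exact Submodule.map_one ψ
  · rw [eq_top_iff, ← (AlgHom.range_eq_top ψ).2 hs, ← Algebra.map_top, ← adjoin_range_X,
      AlgHom.map_adjoin]
    refine Algebra.adjoin_mono ?_
    rintro _ ⟨_, ⟨i, rfl⟩, rfl⟩
    exact hψ 1 _ (isHomogeneous_X k i)

/-- Here Q is the quotient of the polynomial ring by `fs`, and every condition on Q is pulled back
to the polynomial ring, where colon ideals can be computed. -/
theorem hasBackelinRoosProperty_of_linFlagMod.{u, v} {k : Type u} [Field k] {R : Type v}
    [CommRing R] [Algebra k R] [Nontrivial R] (ℛ : ℕ → Submodule k R) [GradedAlgebra ℛ]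
    {V : Type} [Fintype V] (ψ : MvPolynomial V k →ₐ[k] R) (hs : Function.Surjective ψ)
    (hψ : ∀ j, ∀ p ∈ homogeneousSubmodule V k j, ψ p ∈ ℛ j)
    (hinj : ∀ t < 2, ∀ p ∈ homogeneousSubmodule V k t, ψ p = 0 → p = 0)
    (fs : List (MvPolynomial V k)) (hfs : ∀ f ∈ fs, ∃ e : ℕ, f.IsHomogeneous e)
    (hreg : RingTheory.Sequence.IsRegular (MvPolynomial V k) fs) (hker : ∀ f ∈ fs, ψ f = 0)
    {𝓛 : Set (Ideal (MvPolynomial V k))}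
    (hm : maxIdeal (homogeneousSubmodule V k) ∈ 𝓛)
    (hF : ∀ L ∈ 𝓛, LinFlagMod (homogeneousSubmodule V k) (Ideal.ofList fs) 𝓛
      (ψ : MvPolynomial V k →+* R) L)
    {𝓛' : Set (Ideal R)} (hm' : maxIdeal ℛ ∈ 𝓛')
    (hF' : ∀ L ∈ 𝓛', LinFlag ℛ 𝓛' (RingHom.id R) L) : HasBackelinRoosProperty ℛ := by
  classical
  set 𝔠 : Ideal (MvPolynomial V k) := Ideal.ofList fs with h𝔠
  have h : 𝔠.IsHomogeneous (homogeneousSubmodule V k) := by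
    refine Ideal.homogeneous_span _ _ fun f hf => ?_
    obtain ⟨e, he⟩ := hfs f hf
    exact ⟨e, he⟩
  let _ := quotGradedAlgebra h
  have hle : ∀ p ∈ 𝔠, ψ p = 0 := by
    have : 𝔠 ≤ RingHom.ker ψ := Ideal.span_le.2 hker
    exact this
  let φ : (MvPolynomial V k ⧸ 𝔠) →ₐ[k] R := Ideal.Quotient.liftₐ 𝔠 ψ hle
  have hφψ : (φ : (MvPolynomial V k ⧸ 𝔠) →+* R).comp (Ideal.Quotient.mk 𝔠) = ψ :=
    RingHom.ext fun p => rfl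
  have hφs : Function.Surjective φ := fun y => by
    obtain ⟨p, rfl⟩ := hs y
    exact ⟨Ideal.Quotient.mk 𝔠 p, rfl⟩
  have hφ : ∀ j, ∀ q ∈ quotGrading (homogeneousSubmodule V k) 𝔠 j, φ q ∈ ℛ j := by
    rintro j _ ⟨p, hp, rfl⟩
    exact hψ j p hp
  have : Nontrivial (MvPolynomial V k ⧸ 𝔠) := hφs.nontrivial
  obtain ⟨hR, hRfin⟩ := isStandardGraded_of_surjective hs hψ
  obtain ⟨hQ, hQfin⟩ := isStandardGraded_of_surjective
    (ℛ := quotGrading (homogeneousSubmodule V k) 𝔠) (ψ := Ideal.Quotient.mkₐ k 𝔠)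
    Ideal.Quotient.mk_surjective (fun j p hp => ⟨p, hp, rfl⟩)
  refine ⟨hR, _, inferInstance, inferInstance, quotGrading (homogeneousSubmodule V k) 𝔠,
    inferInstance, φ, ⟨hQ, ?_⟩, ?_⟩
  · let e := Fintype.equivFin V
    let E := MvPolynomial.renameEquiv k e
    refine ⟨Fintype.card V, (Ideal.Quotient.mkₐ k 𝔠).comp E.symm.toAlgHom, fs.map E,
      ?_, ?_, ?_, ?_, ?_⟩
    · exact Ideal.Quotient.mk_surjective.comp E.symm.surjective
    · intro j p hp
      exact ⟨E.symm p, hp.rename_isHomogeneous, rfl⟩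
    · intro f hf
      obtain ⟨g, hg, rfl⟩ := List.mem_map.1 hf
      obtain ⟨d, hd⟩ := hfs g hg
      exact ⟨d, hd.rename_isHomogeneous⟩
    · refine (AddEquiv.isRegular_congr (e := (E : _ ≃+ _)) ?_).1 hreg
      refine List.forall₂_map_right_iff.mpr (List.forall₂_same.mpr fun r _ x => ?_)
      exact map_mul E r x
    · ext p
      have h1 : Ideal.ofList (fs.map E) = Ideal.map (E : _ →+* _) 𝔠 := by
        rw [h𝔠, Ideal.map_ofList]
        rfl
      rw [h1, RingHom.mem_ker]
      have h2 : p ∈ Ideal.map (E : _ →+* _) 𝔠 ↔ E.symm p ∈ 𝔠 := by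
        constructor
        · intro hp
          obtain ⟨q, hq, rfl⟩ := (Ideal.mem_map_iff_of_surjective _ E.surjective).1 hp
          exact (E.symm_apply_apply q).symm ▸ hq
        · intro hp
          rw [← E.apply_symm_apply p]
          exact Ideal.mem_map_of_mem _ hp
      rw [h2]
      exact Ideal.Quotient.eq_zero_iff_mem
  · refine isGolod_of_linFlag hQ.zero_eq hR.zero_eq hφ hφs ?_
      (𝓛 := Ideal.map (Ideal.Quotient.mk 𝔠) '' 𝓛) ?_ ?_ hm' hF'
    · rintro t ht _ ⟨p, hp, rfl⟩ hp0
      rw [hinj t ht p hp hp0, map_zero]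
    · rw [maxIdeal_quotGrading h]
      exact ⟨_, hm, rfl⟩
    · rintro _ ⟨L, hL, rfl⟩
      exact (hF L hL).linFlag h hφψ

end Presentations
end BackelinRoos
end

noncomputable section
set_option linter.unusedSectionVars false
namespace BackelinRoos
open MvPolynomial

/-! ### Setting variables to zero; colon ideals modulo two coprime forms. -/

section KillingVariables

variable {k V : Type*} [Field k]

open Classical in
/-- The endomorphism of the polynomial ring that sends the variables in `s` to zero. -/
def kill (s : Set V) : MvPolynomial V k →ₐ[k] MvPolynomial V k :=
  aeval fun i => if i ∈ s then 0 else X i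

/-- The ideal generated by the variables in `s`. -/
def varIdeal (k : Type*) [Field k] {V : Type*} (s : Set V) : Ideal (MvPolynomial V k) :=
  Ideal.span (X '' s)

theorem sub_mem_of_retract {τ : MvPolynomial V k →ₐ[k] MvPolynomial V k}
    {L : Ideal (MvPolynomial V k)} (h : ∀ i, X i - τ (X i) ∈ L) (p : MvPolynomial V k) :
    p - τ p ∈ L := by
  have : (Ideal.Quotient.mkₐ k L) = (Ideal.Quotient.mkₐ k L).comp τ :=
    MvPolynomial.algHom_ext fun i => Ideal.Quotient.eq.2 (h i)
  exact Ideal.Quotient.eq.1 (AlgHom.congr_fun this p)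

/-- The map τ is a retraction with kernel L, so membership modulo L can be tested after applying τ.
-/
theorem mem_sup_iff_of_retract {τ : MvPolynomial V k →ₐ[k] MvPolynomial V k}
    {L : Ideal (MvPolynomial V k)} (h : ∀ i, X i - τ (X i) ∈ L) (hL : ∀ p ∈ L, τ p = 0)
    {J : Ideal (MvPolynomial V k)} {p : MvPolynomial V k} :
    p ∈ L ⊔ J ↔ τ p ∈ J.map τ := by
  constructor
  · intro hp
    obtain ⟨a, ha, b, hb, rfl⟩ := Submodule.mem_sup.1 hp
    rw [map_add, hL a ha, zero_add]
    exact Ideal.mem_map_of_mem _ hb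
  · intro hp
    have h1 : J.map τ ≤ L ⊔ J := by
      refine Ideal.map_le_iff_le_comap.2 fun b hb => ?_
      rw [show b = (b - τ b) + τ b by ring] at hb
      have : τ b = b - (b - τ b) := by ring
      change τ b ∈ L ⊔ J
      rw [this]
      refine sub_mem (le_sup_right (a := L) ?_) (le_sup_left (b := J) (sub_mem_of_retract h b))
      simpa using hb
    rw [show p = (p - τ p) + τ p by ring]
    exact add_mem (le_sup_left (b := J) (sub_mem_of_retract h p)) (h1 hp)

section

variable {s : Set V}

open Classical in
theorem kill_X (i : V) : kill s (X i : MvPolynomial V k) = if i ∈ s then 0 else X i := by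
  simp [kill]

theorem kill_X_of_mem {i : V} (h : i ∈ s) : kill s (X i : MvPolynomial V k) = 0 := by
  rw [kill_X, if_pos h]

theorem kill_X_of_notMem {i : V} (h : i ∉ s) : kill s (X i : MvPolynomial V k) = X i := by
  rw [kill_X, if_neg h]

theorem X_mem_varIdeal {i : V} (h : i ∈ s) : (X i : MvPolynomial V k) ∈ varIdeal k s :=
  Ideal.subset_span ⟨i, h, rfl⟩

theorem X_sub_kill_mem (i : V) : X i - kill s (X i : MvPolynomial V k) ∈ varIdeal k s := by
  rw [kill_X]
  split_ifs with h
  · rw [sub_zero]; exact X_mem_varIdeal h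
  · rw [sub_self]; exact zero_mem _

theorem kill_eq_zero {p : MvPolynomial V k} (h : p ∈ varIdeal k s) : kill s p = 0 := by
  have : varIdeal k s ≤ RingHom.ker (kill (k := k) s) := by
    refine Ideal.span_le.2 ?_
    rintro _ ⟨i, hi, rfl⟩
    exact kill_X_of_mem hi
  exact this h

theorem mem_varIdeal_iff {p : MvPolynomial V k} : p ∈ varIdeal k s ↔ kill s p = 0 := by
  refine ⟨kill_eq_zero, fun h => ?_⟩
  have := sub_mem_of_retract (τ := kill s) (L := varIdeal k s) X_sub_kill_mem p
  rwa [h, sub_zero] at this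

theorem mem_varIdeal_sup_iff {J : Ideal (MvPolynomial V k)} {p : MvPolynomial V k} :
    p ∈ varIdeal k s ⊔ J ↔
      kill s p ∈ J.map (kill (k := k) s) :=
  mem_sup_iff_of_retract X_sub_kill_mem fun _ => kill_eq_zero

theorem kill_kill {t u : Set V}
    (hu : u = s ∪ t) (p : MvPolynomial V k) : kill t (kill s p) = kill u p := by
  have : (kill (k := k) t).comp (kill s) = kill u := by
    refine MvPolynomial.algHom_ext fun i => ?_
    rw [AlgHom.comp_apply, kill_X, kill_X]
    by_cases h1 : i ∈ s
    · rw [if_pos h1, map_zero, if_pos (hu ▸ Or.inl h1)]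
    · rw [if_neg h1, kill_X]
      congr 1
      simp [hu, h1]
  exact AlgHom.congr_fun this p

theorem kill_isHomogeneous {p : MvPolynomial V k} {n : ℕ} (h : p.IsHomogeneous n) :
    (kill s p).IsHomogeneous n := by
  rw [← one_mul n]
  refine h.aeval _ fun i => ?_
  split_ifs
  exacts [isHomogeneous_zero _ _ _, isHomogeneous_X _ _]

theorem kill_monomial (m : V →₀ ℕ) (a : k) [Decidable (∀ i ∈ s, m i = 0)] :
    kill s (monomial m a) = if ∀ i ∈ s, m i = 0 then monomial m a else 0 := by
  rw [kill, aeval_monomial]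
  split_ifs with h
  · rw [monomial_eq, algebraMap_eq]
    congr 1
    refine Finsupp.prod_congr fun i hi => ?_
    rw [if_neg fun his => Finsupp.mem_support_iff.1 hi (h i his)]
  · push Not at h
    obtain ⟨i, hi, hm⟩ := h
    rw [Finsupp.prod, Finset.prod_eq_zero (Finsupp.mem_support_iff.2 hm), mul_zero]
    rw [if_pos hi, zero_pow hm]

theorem coeff_kill (p : MvPolynomial V k) (m : V →₀ ℕ) [Decidable (∀ i ∈ s, m i = 0)] :
    coeff m (kill s p) = if ∀ i ∈ s, m i = 0 then coeff m p else 0 := by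
  classical
  induction p using MvPolynomial.induction_on' with
  | monomial u a =>
    rw [kill_monomial]
    split_ifs with h1 h2 h2
    · rfl
    · rw [coeff_monomial, if_neg]
      rintro rfl
      exact h2 h1
    · rw [coeff_zero, coeff_monomial, if_neg]
      rintro rfl
      exact h1 h2
    · rfl
  | add p q hp hq =>
    rw [map_add, coeff_add, hp, hq, coeff_add]
    split_ifs <;> simp

theorem X_mul_mem_varIdeal_iff {i : V} (hi : i ∉ s) {p : MvPolynomial V k} :
    X i * p ∈ varIdeal k s ↔ p ∈ varIdeal k s := by
  rw [mem_varIdeal_iff, mem_varIdeal_iff, map_mul, kill_X_of_notMem hi, mul_eq_zero,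
    or_iff_right (X_ne_zero i)]

end

theorem varIdeal_mono {s t : Set V} (h : s ⊆ t) : varIdeal k s ≤ varIdeal k t :=
  Ideal.span_mono (Set.image_mono h)

theorem varIdeal_insert (i : V) (s : Set V) :
    varIdeal k (insert i s) = varIdeal k s ⊔ Ideal.span {X i} := by
  rw [varIdeal, Set.image_insert_eq, Set.insert_eq, Ideal.span_union, sup_comm]
  rfl

/-- Write p = de. Setting variables to zero preserves the degree of p and cannot raise that of e; as
d becomes a constant, e carries the full degree of p and d has degree 0. -/
theorem isUnit_of_isUnit_kill {s : Set V} {p d : MvPolynomial V k} {n : ℕ}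
    (hp : p.IsHomogeneous n) (hp0 : kill s p ≠ 0) (hd : d ∣ p) (hu : IsUnit (kill s d)) :
    IsUnit d := by
  classical
  obtain ⟨e, rfl⟩ := hd
  have hp1 : d * e ≠ 0 := fun h => hp0 (by rw [h, map_zero])
  obtain ⟨hd0, he0⟩ := mul_ne_zero_iff.1 hp1
  have h1 := totalDegree_mul_of_isDomain hd0 he0
  rw [hp.totalDegree hp1] at h1
  have h2 : (kill s e).totalDegree ≤ e.totalDegree := by
    refine Finset.sup_mono fun m hm => ?_
    rw [mem_support_iff, coeff_kill] at hm
    rw [mem_support_iff]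
    split_ifs at hm
    · exact hm
    · exact absurd rfl hm
  have h3 : (kill s d).totalDegree = 0 := by
    obtain ⟨c, hc, hc'⟩ := MvPolynomial.isUnit_iff_eq_C_of_isReduced.1 hu
    rw [hc', totalDegree_C]
  have h4 := kill_isHomogeneous (s := s) hp
  rw [map_mul] at h4 hp0
  obtain ⟨hd0', he0'⟩ := mul_ne_zero_iff.1 hp0
  have h5 := totalDegree_mul_of_isDomain hd0' he0'
  rw [h4.totalDegree hp0, h3] at h5
  have h6 : d.totalDegree = 0 := by omega
  rw [totalDegree_eq_zero_iff_eq_C] at h6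
  rw [h6] at hd0 ⊢
  exact (isUnit_iff_ne_zero.2 fun h => hd0 (by rw [h, C_0])).map C

theorem isRelPrime_of_kill {s : Set V} {p q : MvPolynomial V k} {n : ℕ}
    (hp : p.IsHomogeneous n) (hp0 : kill s p ≠ 0) (h : IsRelPrime (kill s p) (kill s q)) :
    IsRelPrime p q := fun _ hdp hdq =>
  isUnit_of_isUnit_kill hp hp0 hdp (h (map_dvd (kill s) hdp) (map_dvd (kill s) hdq))

/-- Multiplication by a variable `x` is injective modulo two forms that remain relatively prime
modulo `x`. -/
theorem mem_span_pair_of_X_mul_mem {i : V} {f g p : MvPolynomial V k}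
    (hf : kill {i} f ≠ 0) (h : IsRelPrime (kill {i} f) (kill {i} g))
    (hp : X i * p ∈ Ideal.span {f, g}) : p ∈ Ideal.span {f, g} := by
  obtain ⟨u, v, huv⟩ := Ideal.mem_span_pair.1 hp
  have h0 := congrArg (kill {i}) huv
  rw [map_add, map_mul, map_mul, map_mul, kill_X_of_mem (Set.mem_singleton i), zero_mul] at h0
  -- Modulo x, uf + vg = 0, so coprimality makes (u, v) a multiple of (-g, f) there. Subtracting
  -- this Koszul relation leaves coefficients divisible by x.
  have h1 : kill {i} f ∣ kill {i} v :=
    h.dvd_of_dvd_mul_right ⟨-kill {i} u, by linear_combination h0⟩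
  obtain ⟨w, hw⟩ := h1
  have hid : ∀ q : MvPolynomial V k, kill {i} (kill {i} q) = kill {i} q :=
    kill_kill (by simp)
  have hw' := congrArg (kill {i}) hw
  rw [map_mul, hid, hid] at hw'
  have h2 : v - f * w ∈ varIdeal k {i} := by
    rw [mem_varIdeal_iff, map_sub, map_mul, hw', sub_self]
  have h3 : u + g * w ∈ varIdeal k {i} := by
    rw [mem_varIdeal_iff]
    apply mul_right_cancel₀ hf
    rw [map_add, map_mul]
    linear_combination h0 - kill {i} g * hw'
  rw [varIdeal, Set.image_singleton, Ideal.mem_span_singleton] at h2 h3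
  obtain ⟨v', hv'⟩ := h2
  obtain ⟨u', hu'⟩ := h3
  refine Ideal.mem_span_pair.2 ⟨u', v', mul_left_cancel₀ (X_ne_zero (R := k) i) ?_⟩
  linear_combination huv - f * hu' - g * hv'

theorem isRegular_pair {P : Type*} [CommRing P] [IsDomain P] [DecompositionMonoid P] {f g : P}
    (hf : f ≠ 0) (h : IsRelPrime f g) (htop : Ideal.ofList [f, g] ≠ ⊤) :
    RingTheory.Sequence.IsRegular P [f, g] := by
  refine ⟨⟨?_⟩, ?_⟩
  · intro i hi
    rw [isSMulRegular_quotient_iff_mem_of_smul_mem]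
    simp only [smul_eq_mul, Ideal.mul_top]
    match i, hi with
    | 0, _ =>
      intro x hx
      simpa [hf] using hx
    | 1, _ =>
      intro x hx
      simp only [List.take_succ_cons, List.take_zero, Ideal.ofList_cons, Ideal.ofList_nil,
        sup_bot_eq, Ideal.mem_span_singleton, List.getElem_cons_succ,
        List.getElem_cons_zero] at hx ⊢
      exact h.dvd_of_dvd_mul_left hx
  · rw [smul_eq_mul, Ideal.mul_top]
    exact htop.symm

end KillingVariables
end BackelinRoos
end

noncomputable section
set_option linter.unusedSectionVars false
namespace BackelinRoos
open MvPolynomial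

/-! ### Flags obtained by adjoining variables. -/

section Filtrations

attribute [local instance] MvPolynomial.gradedAlgebra

variable {k V R : Type*} [Field k] [CommRing R] [Algebra k R]

theorem maxIdeal_eq_varIdeal :
    maxIdeal (homogeneousSubmodule V k) = varIdeal k (Set.univ : Set V) := by
  ext p
  rw [mem_maxIdeal_iff, varIdeal, mem_ideal_span_X_image]
  constructor
  · intro h m hm
    by_contra! h'
    obtain rfl : m = 0 := Finsupp.ext fun i => h' i (Set.mem_univ i)
    exact mem_support_iff.1 hm h
  · intro h
    by_contra h'
    obtain ⟨i, -, hi⟩ := h 0 (mem_support_iff.2 h')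
    exact hi rfl

variable {𝔠 : Ideal (MvPolynomial V k)} {𝓛 : Set (Ideal (MvPolynomial V k))}
  {ψ : MvPolynomial V k →ₐ[k] R}

/-- Each new variable is a nonzerodivisor modulo the previous ideal, and on R in the required
degrees, so the colon ideal is the previous ideal itself. -/
theorem linFlagMod_of_subset [Finite V] {s t : Set V} (hst : s ⊆ t)
    (hs : LinFlagMod (homogeneousSubmodule V k) 𝔠 𝓛 (ψ : MvPolynomial V k →+* R) (varIdeal k s))
    (h : ∀ (u : Set V) (i : V), s ⊆ u → insert i u ⊆ t → i ∉ u →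
      varIdeal k u ∈ 𝓛 ∧ (∀ x, X i * x ∈ varIdeal k u ⊔ 𝔠 → x ∈ varIdeal k u ⊔ 𝔠) ∧
      (∀ j, 2 ≤ j → ∀ w ∈ homogeneousSubmodule V k j,
        ψ (X i) * ψ w ∈ (varIdeal k u).map (ψ : MvPolynomial V k →+* R) →
        ψ w ∈ (varIdeal k u).map (ψ : MvPolynomial V k →+* R))) :
    LinFlagMod (homogeneousSubmodule V k) 𝔠 𝓛 (ψ : MvPolynomial V k →+* R) (varIdeal k t) := by
  suffices key : ∀ u : Set V, u ⊆ t →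
      LinFlagMod (homogeneousSubmodule V k) 𝔠 𝓛 (ψ : MvPolynomial V k →+* R)
        (varIdeal k (s ∪ u)) by
    have := key t subset_rfl
    rwa [Set.union_eq_self_of_subset_left hst] at this
  intro u
  induction u, u.toFinite using Set.Finite.induction_on with
  | empty => intro _; rwa [Set.union_empty]
  | @insert i u _ _ ih =>
    intro hu
    have ih' := ih ((Set.subset_insert i u).trans hu)
    rw [Set.union_insert]
    by_cases hi : i ∈ s ∪ u
    · rwa [Set.insert_eq_of_mem hi]
    · obtain ⟨h1, h2, h3⟩ := h (s ∪ u) i Set.subset_union_left (Set.insert_subset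
        (hu (Set.mem_insert i u)) (Set.union_subset hst ((Set.subset_insert i u).trans hu))) hi
      rw [varIdeal_insert]
      refine LinFlagMod.step ih' (isHomogeneous_X k i) h1
        (fun x => ⟨h2 x, fun hx => Ideal.mul_mem_left _ _ hx⟩) fun j hj w hw hx => ?_
      rw [map_mul] at hx
      exact h3 j hj w hw hx

theorem linFlagMod_bot_varIdeal :
    LinFlagMod (homogeneousSubmodule V k) 𝔠 𝓛 (ψ : MvPolynomial V k →+* R)
      (varIdeal k (∅ : Set V)) := by
  rw [varIdeal, Set.image_empty, Ideal.span_empty]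
  exact LinFlagMod.bot

end Filtrations

/-! ### Two criteria: Golod over the polynomial ring, and over two quadrics. -/

section Main

attribute [local instance] MvPolynomial.gradedAlgebra

universe u v

variable {k : Type u} [Field k] {R : Type v} [CommRing R] [Algebra k R] [Nontrivial R]
    (ℛ : ℕ → Submodule k R) [GradedAlgebra ℛ]
    {V : Type} [Fintype V] (ψ : MvPolynomial V k →ₐ[k] R)

/-- If `R` becomes zero in degrees at least two modulo a sequence of variables that is regular
on `R`, then the presentation of `R` by a polynomial ring is Golod. -/
theorem hasBackelinRoosProperty_of_minimal (hs : Function.Surjective ψ)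
    (hψ : ∀ j, ∀ p ∈ homogeneousSubmodule V k j, ψ p ∈ ℛ j)
    (hinj : ∀ t < 2, ∀ p ∈ homogeneousSubmodule V k t, ψ p = 0 → p = 0)
    {D : Set V}
    (hD : ∀ (s : Set V) (i : V), s ⊆ D → i ∈ D → i ∉ s → ∀ y,
      ψ (X i) * y ∈ (varIdeal k s).map (ψ : MvPolynomial V k →+* R) →
      y ∈ (varIdeal k s).map (ψ : MvPolynomial V k →+* R))
    (htop : ∀ t, 2 ≤ t → ∀ y ∈ ℛ t, y ∈ (varIdeal k D).map (ψ : MvPolynomial V k →+* R))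
    {𝓛' : Set (Ideal R)} (hm' : maxIdeal ℛ ∈ 𝓛')
    (hF' : ∀ L ∈ 𝓛', LinFlag ℛ 𝓛' (RingHom.id R) L) : HasBackelinRoosProperty ℛ := by
  classical
  refine hasBackelinRoosProperty_of_linFlagMod ℛ ψ hs hψ hinj [] (by simp)
    (RingTheory.Sequence.IsRegular.nil _ _) (by simp)
    (𝓛 := varIdeal k '' {s | s ⊆ D ∨ D ⊆ s}) ?_ ?_ hm' hF'
  · rw [maxIdeal_eq_varIdeal]
    exact ⟨_, Or.inr (Set.subset_univ _), rfl⟩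
  rw [Ideal.ofList_nil]
  have h1 : ∀ s ⊆ D, LinFlagMod (homogeneousSubmodule V k) ⊥
      (varIdeal k '' {s | s ⊆ D ∨ D ⊆ s}) (ψ : MvPolynomial V k →+* R) (varIdeal k s) := by
    intro s hs
    refine linFlagMod_of_subset (Set.empty_subset s) linFlagMod_bot_varIdeal
      fun u i _ hu hi => ⟨⟨u, Or.inl ?_, rfl⟩, fun x hx => ?_, fun j _ w _ hx => ?_⟩
    · exact ((Set.subset_insert i u).trans hu).trans hs
    · rw [sup_bot_eq] at hx ⊢
      exact (X_mul_mem_varIdeal_iff hi).1 hx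
    · exact hD u i (((Set.subset_insert i u).trans hu).trans hs)
        (hs (hu (Set.mem_insert i u))) hi _ hx
  rintro _ ⟨s, hs | hs, rfl⟩
  · exact h1 s hs
  · refine linFlagMod_of_subset hs (h1 D subset_rfl)
      fun u i hDu hu hi => ⟨⟨u, Or.inr hDu, rfl⟩, fun x hx => ?_, fun j hj w hw _ => ?_⟩
    · rw [sup_bot_eq] at hx ⊢
      exact (X_mul_mem_varIdeal_iff hi).1 hx
    -- Beyond D the condition on R is automatic: D already generates everything in degrees at least
    -- 2.
    · exact Ideal.map_mono (varIdeal_mono hDu) (htop j hj _ (hψ j w hw))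

section CodimensionTwo

variable {ψ} {D : Set V} {v c e : V} {lam : k} {f g : MvPolynomial V k}

theorem X_add_C_mul_X_ne_zero {v e : V} (hve : v ≠ e) (lam : k) :
    (X v + C lam * X e : MvPolynomial V k) ≠ 0 := by
  classical
  intro h
  have := congrArg (coeff (Finsupp.single v 1)) h
  rw [coeff_add, coeff_C_mul, coeff_X, coeff_X, if_pos rfl, if_neg, mul_zero, add_zero,
    coeff_zero] at this
  · exact one_ne_zero this
  · intro h
    exact hve ((Finsupp.single_left_inj one_ne_zero).1 h).symm

/-- Quadrics of the form `f ≡ x_v (x_v + λ x_e)` and `g ≡ x_c²` modulo the variables in `D`. -/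
structure QuadricPair (D : Set V) (v c e : V) (lam : k) (f g : MvPolynomial V k) : Prop where
  v_notMem : v ∉ D
  c_notMem : c ∉ D
  e_notMem : e ∉ D
  v_ne_c : v ≠ c
  v_ne_e : v ≠ e
  c_ne_e : c ≠ e
  f_hom : f.IsHomogeneous 2
  g_hom : g.IsHomogeneous 2
  kill_f : kill D f = X v * (X v + C lam * X e)
  kill_g : kill D g = X c ^ 2

namespace QuadricPair

/-- Modulo D the forms are x_v(x_v + λx_e) and x_c², coprime since x_c does not divide the first.
Coprimality lifts back to fewer killed variables. -/
theorem isRelPrime (h : QuadricPair D v c e lam f g) {s : Set V} (hs : s ⊆ D) :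
    kill s f ≠ 0 ∧ IsRelPrime (kill s f) (kill s g) := by
  have h1 : ∀ p : MvPolynomial V k, kill D (kill s p) = kill D p :=
    kill_kill (Set.union_eq_self_of_subset_left hs).symm
  have h0 := mul_ne_zero (X_ne_zero (R := k) v) (X_add_C_mul_X_ne_zero h.v_ne_e lam)
  have hf : kill D (kill s f) ≠ 0 := by rwa [h1, h.kill_f]
  refine ⟨fun h2 => hf (by rw [h2, map_zero]),
    isRelPrime_of_kill (kill_isHomogeneous h.f_hom) hf ?_⟩
  rw [h1, h1, h.kill_f, h.kill_g]
  refine IsRelPrime.pow_right (IsRelPrime.symm ?_)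
  refine (X_prime (R := k) (i := c)).irreducible.isRelPrime_iff_not_dvd.2 fun hd => h0 ?_
  have h3 := Ideal.mem_span_singleton.2 hd
  rw [← Set.image_singleton] at h3
  have h4 := kill_eq_zero (s := ({c} : Set V)) h3
  rwa [map_mul, map_add, map_mul, kill_X_of_notMem (by simpa using h.v_ne_c),
    kill_X_of_notMem (by simpa using h.c_ne_e.symm), kill, algHom_C] at h4

open Classical in
theorem kill_insert (h : QuadricPair D v c e lam f g) {s : Set V} (hs : insert v D ⊆ s) :
    kill s f = 0 ∧ kill s g = if c ∈ s then 0 else X c ^ 2 := by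
  have h1 : ∀ p : MvPolynomial V k, kill s (kill D p) = kill s p :=
    kill_kill (Set.union_eq_self_of_subset_left ((Set.subset_insert v D).trans hs)).symm
  rw [← h1 f, ← h1 g, h.kill_f, h.kill_g, map_mul, kill_X_of_mem (hs (Set.mem_insert v D)),
    zero_mul, map_pow, kill_X]
  refine ⟨rfl, ?_⟩
  split_ifs <;> simp

/-- Within D each variable is regular modulo the previous ones and f, g, because these forms remain
coprime after the variable is killed. -/
theorem mem_sup_of_X_mul_mem (h : QuadricPair D v c e lam f g) {s : Set V} {i : V}
    (hs : insert i s ⊆ D) (hi : i ∉ s) {p : MvPolynomial V k}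
    (hp : X i * p ∈ varIdeal k s ⊔ Ideal.span {f, g}) :
    p ∈ varIdeal k s ⊔ Ideal.span {f, g} := by
  have h1 : ∀ p : MvPolynomial V k, kill {i} (kill s p) = kill (insert i s) p :=
    kill_kill Set.union_singleton.symm
  obtain ⟨h2, h3⟩ := h.isRelPrime hs
  rw [mem_varIdeal_sup_iff, Ideal.map_span, Set.image_pair] at hp ⊢
  rw [map_mul, kill_X_of_notMem hi] at hp
  rw [← h1] at h2 h3
  rw [← h1] at h3
  exact mem_span_pair_of_X_mul_mem h2 h3 hp

theorem mem_insert_sup_iff (h : QuadricPair D v c e lam f g) {p : MvPolynomial V k} :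
    p ∈ varIdeal k (insert v D) ⊔ Ideal.span {f, g} ↔
      ∃ y w, kill D p = X v * y + X c ^ 2 * w := by
  have h1 : ∀ p : MvPolynomial V k, kill {v} (kill D p) = kill (insert v D) p :=
    kill_kill Set.union_singleton.symm
  rw [mem_varIdeal_sup_iff, Ideal.map_span, Set.image_pair, (h.kill_insert subset_rfl).1,
    (h.kill_insert subset_rfl).2, if_neg (by simp [h.v_ne_c.symm, h.c_notMem]), Ideal.mem_span_pair]
  constructor
  · rintro ⟨a, b, hab⟩
    have h2 : kill D p - X c ^ 2 * b ∈ varIdeal k ({v} : Set V) := by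
      rw [show kill D p - X c ^ 2 * b = (kill D p - kill {v} (kill D p)) by
        rw [h1, ← hab]; ring]
      exact sub_mem_of_retract X_sub_kill_mem _
    rw [varIdeal, Set.image_singleton, Ideal.mem_span_singleton] at h2
    obtain ⟨y, hy⟩ := h2
    exact ⟨y, b, by linear_combination hy⟩
  · rintro ⟨y, w, hyw⟩
    refine ⟨0, kill {v} w, ?_⟩
    rw [← h1, hyw, map_add, map_mul, map_mul, map_pow, kill_X_of_mem (Set.mem_singleton v),
      kill_X_of_notMem (by simpa using h.v_ne_c.symm)]
    ring

theorem mem_sup_iff (h : QuadricPair D v c e lam f g) {p : MvPolynomial V k} :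
    p ∈ varIdeal k D ⊔ Ideal.span {f, g} ↔
      ∃ y w, kill D p = X v * (X v + C lam * X e) * y + X c ^ 2 * w := by
  rw [mem_varIdeal_sup_iff, Ideal.map_span, Set.image_pair, h.kill_f, h.kill_g,
    Ideal.mem_span_pair]
  exact exists₂_congr fun a b => by rw [eq_comm, mul_comm a, mul_comm b]

theorem kill_linear (h : QuadricPair D v c e lam f g) :
    kill D (X v + C lam * X e) = X v + C lam * X e := by
  rw [map_add, map_mul, kill_X_of_notMem h.v_notMem, kill_X_of_notMem h.e_notMem, kill, algHom_C]
  rfl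

theorem mem_linear_sup_iff (h : QuadricPair D v c e lam f g) {p : MvPolynomial V k} :
    p ∈ varIdeal k D ⊔ Ideal.span {X v + C lam * X e} ⊔ Ideal.span {f, g} ↔
      ∃ y w, kill D p = (X v + C lam * X e) * y + X c ^ 2 * w := by
  rw [sup_assoc, mem_varIdeal_sup_iff, ← Ideal.span_union, Ideal.map_span, Set.image_union,
    Set.image_singleton, Set.image_pair, h.kill_f, h.kill_g, h.kill_linear, Ideal.span_union,
    Submodule.mem_sup]
  constructor
  · rintro ⟨a, ha, b, hb, hab⟩
    obtain ⟨a, rfl⟩ := Ideal.mem_span_singleton'.1 ha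
    obtain ⟨x, y, rfl⟩ := Ideal.mem_span_pair.1 hb
    exact ⟨a + x * X v, y, by rw [← hab]; ring⟩
  · rintro ⟨y, w, hyw⟩
    refine ⟨_, Ideal.mem_span_singleton'.2 ⟨y, rfl⟩, _, Ideal.mem_span_pair.2 ⟨0, w, rfl⟩, ?_⟩
    rw [hyw]
    ring

/-- With b = x_v + λx_e and modulo D: if bp = x_v b y + x_c² w, setting b to zero forces b | w, and
cancelling b leaves p in (x_v, x_c²). -/
theorem linear_mul_mem_iff (h : QuadricPair D v c e lam f g) (p : MvPolynomial V k) :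
    (X v + C lam * X e) * p ∈ varIdeal k D ⊔ Ideal.span {f, g} ↔
      p ∈ varIdeal k (insert v D) ⊔ Ideal.span {f, g} := by
  classical
  rw [h.mem_sup_iff, h.mem_insert_sup_iff, map_mul, h.kill_linear]
  constructor
  · rintro ⟨y, w, hyw⟩
    -- The substitution x_v ↦ -λx_e, a retraction that kills b and fixes x_c.
    let σ : MvPolynomial V k →ₐ[k] MvPolynomial V k :=
      aeval fun i => if i = v then -(C lam * X e) else X i
    have hσ : ∀ i, i ≠ v → σ (X i) = X i := fun i hi => by simp [σ, hi]
    have hσv : σ (X v) = -(C lam * X e) := by simp [σ]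
    have hσb : σ (X v + C lam * X e) = 0 := by
      rw [map_add, map_mul, hσv, hσ e h.v_ne_e.symm, algHom_C]
      exact neg_add_cancel _
    have hw : σ w = 0 := by
      have := congrArg σ hyw
      rw [map_mul, hσb, map_add, map_mul, map_mul, hσb, map_mul, map_pow,
        hσ c h.v_ne_c.symm] at this
      simpa using this
    have hwd : w ∈ Ideal.span {(X v + C lam * X e : MvPolynomial V k)} := by
      have := sub_mem_of_retract (τ := σ) (L := Ideal.span {(X v + C lam * X e)}) (fun i => by
        by_cases hi : i = v
        · rw [hi, hσv, sub_neg_eq_add]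
          exact Ideal.mem_span_singleton_self _
        · rw [hσ i hi, sub_self]
          exact zero_mem _) w
      rwa [hw, sub_zero] at this
    obtain ⟨w', rfl⟩ := Ideal.mem_span_singleton.1 hwd
    refine ⟨y, w', mul_left_cancel₀ (X_add_C_mul_X_ne_zero h.v_ne_e lam) ?_⟩
    linear_combination hyw
  · rintro ⟨y, w, hyw⟩
    exact ⟨y, (X v + C lam * X e) * w, by rw [hyw]; ring⟩

/-- The other half of the exact pair: if x_v p = x_v b y + x_c² w, then the prime x_v divides w and
can be cancelled. -/
theorem X_mul_mem_iff (h : QuadricPair D v c e lam f g) (p : MvPolynomial V k) :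
    X v * p ∈ varIdeal k D ⊔ Ideal.span {f, g} ↔
      p ∈ varIdeal k D ⊔ Ideal.span {X v + C lam * X e} ⊔ Ideal.span {f, g} := by
  rw [h.mem_sup_iff, h.mem_linear_sup_iff, map_mul, kill_X_of_notMem h.v_notMem]
  constructor
  · rintro ⟨y, w, hyw⟩
    have hw : X v ∣ X c ^ 2 * w :=
      ⟨kill D p - (X v + C lam * X e) * y, by linear_combination -hyw⟩
    have hv := X_prime (R := k) (i := v)
    obtain ⟨w', rfl⟩ := (hv.dvd_or_dvd hw).resolve_left fun h1 => by
      have h2 := hv.dvd_of_dvd_pow h1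
      rw [X_dvd_X] at h2
      exact h.v_ne_c h2
    refine ⟨y, w', mul_left_cancel₀ (X_ne_zero (R := k) v) ?_⟩
    linear_combination hyw
  · rintro ⟨y, w, hyw⟩
    exact ⟨y, X v * w, by rw [hyw]; ring⟩

/-- Modulo D and x_v only x_c² survives of f and g, and (x_c²) : x_c = (x_c). -/
theorem X_mul_mem_insert_iff (h : QuadricPair D v c e lam f g) (p : MvPolynomial V k) :
    X c * p ∈ varIdeal k (insert v D) ⊔ Ideal.span {f, g} ↔
      p ∈ varIdeal k (insert c (insert v D)) ⊔ Ideal.span {f, g} := by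
  have hc : c ∉ insert v D := by simp [h.v_ne_c.symm, h.c_notMem]
  have h1 : ∀ p : MvPolynomial V k, kill {c} (kill (insert v D) p)
      = kill (insert c (insert v D)) p :=
    kill_kill Set.union_singleton.symm
  have h2 := h.kill_insert (s := insert c (insert v D)) (Set.subset_insert _ _)
  rw [mem_varIdeal_sup_iff, mem_varIdeal_sup_iff, Ideal.map_span, Ideal.map_span, Set.image_pair,
    Set.image_pair, (h.kill_insert subset_rfl).1, (h.kill_insert subset_rfl).2, if_neg hc, h2.1,
    h2.2, if_pos (Set.mem_insert _ _), map_mul, kill_X_of_notMem hc, ← h1]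
  simp only [Ideal.mem_span_pair, mul_zero, zero_add, exists_const]
  rw [eq_comm (a := (0 : MvPolynomial V k)), ← mem_varIdeal_iff, varIdeal, Set.image_singleton,
    Ideal.mem_span_singleton]
  constructor
  · rintro ⟨w, hw⟩
    refine ⟨w, mul_left_cancel₀ (X_ne_zero (R := k) c) ?_⟩
    linear_combination -hw
  · rintro ⟨w, hw⟩
    exact ⟨w, by rw [hw]; ring⟩

theorem span_le (h : QuadricPair D v c e lam f g) {s : Set V} (hs : insert v D ⊆ s)
    (hc : c ∈ s) : Ideal.span {f, g} ≤ varIdeal k s := by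
  obtain ⟨h1, h2⟩ := h.kill_insert hs
  rw [if_pos hc] at h2
  rw [Ideal.span_le]
  rintro x (rfl | rfl)
  · exact mem_varIdeal_iff.2 h1
  · exact mem_varIdeal_iff.2 h2

end QuadricPair

/-- Suppose that the variables in `D` form a regular sequence on `R`, that modulo these variables
`f` and `g` become `x_v (x_v + λ x_e)` and `x_c²`, that `x_v` and `x_v + λ x_e` are a pair of exact
zero divisors on `R / D R` in degrees at least two, and that `R / (D, x_v, x_c) R` is zero in
degrees at least two. Then `R` is a Golod quotient of the complete intersection defined by `f`
and `g`. -/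
theorem hasBackelinRoosProperty_of_quadricPair (hs : Function.Surjective ψ)
    (hψ : ∀ j, ∀ p ∈ homogeneousSubmodule V k j, ψ p ∈ ℛ j)
    (hinj : ∀ t < 2, ∀ p ∈ homogeneousSubmodule V k t, ψ p = 0 → p = 0)
    (h : QuadricPair D v c e lam f g) (hf : ψ f = 0) (hg : ψ g = 0)
    (hD : ∀ (s : Set V) (i : V), s ⊆ D → i ∈ D → i ∉ s → ∀ y,
      ψ (X i) * y ∈ (varIdeal k s).map (ψ : MvPolynomial V k →+* R) →
      y ∈ (varIdeal k s).map (ψ : MvPolynomial V k →+* R))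
    (hv : ∀ t, 2 ≤ t → ∀ y ∈ ℛ t,
      ψ (X v) * y ∈ (varIdeal k D).map (ψ : MvPolynomial V k →+* R) →
      y ∈ (varIdeal k D ⊔ Ideal.span {X v + C lam * X e}).map (ψ : MvPolynomial V k →+* R))
    (hb : ∀ t, 2 ≤ t → ∀ y ∈ ℛ t,
      ψ (X v + C lam * X e) * y ∈ (varIdeal k D).map (ψ : MvPolynomial V k →+* R) →
      y ∈ (varIdeal k (insert v D)).map (ψ : MvPolynomial V k →+* R))
    (htop : ∀ t, 2 ≤ t → ∀ y ∈ ℛ t,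
      y ∈ (varIdeal k (insert c (insert v D))).map (ψ : MvPolynomial V k →+* R))
    {𝓛' : Set (Ideal R)} (hm' : maxIdeal ℛ ∈ 𝓛')
    (hF' : ∀ L ∈ 𝓛', LinFlag ℛ 𝓛' (RingHom.id R) L) : HasBackelinRoosProperty ℛ := by
  have hspan : Ideal.ofList [f, g] = Ideal.span {f, g} := by
    rw [Ideal.ofList]
    congr 1
    ext x
    simp
  -- The family: subsets of D, the two ideals (D, b) and (D, x_v), which are each other's colon
  -- ideals over D, and the variable ideals containing D, x_v and x_c, modulo which f and g vanish.
  set 𝓛 : Set (Ideal (MvPolynomial V k)) := insert (varIdeal k D ⊔ Ideal.span {X v + C lam * X e})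
    (varIdeal k '' {s | s ⊆ D ∨ insert v D ⊆ s ∧ (c ∈ s ∨ s = insert v D)}) with h𝓛
  have hmem : ∀ s : Set V, s ⊆ D ∨ insert v D ⊆ s ∧ (c ∈ s ∨ s = insert v D) →
      varIdeal k s ∈ 𝓛 := fun s hs => Or.inr ⟨s, hs, rfl⟩
  refine hasBackelinRoosProperty_of_linFlagMod ℛ ψ hs hψ hinj [f, g] ?_ ?_ ?_
    (𝓛 := 𝓛) ?_ ?_ hm' hF'
  · intro x hx
    simp only [List.mem_cons, List.not_mem_nil, or_false] at hx
    rcases hx with rfl | rfl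
    exacts [⟨2, h.f_hom⟩, ⟨2, h.g_hom⟩]
  · have h0 := h.isRelPrime (Set.empty_subset D)
    have hid : ∀ p : MvPolynomial V k, kill ∅ p = p := fun p => by
      have : kill (k := k) (∅ : Set V) = AlgHom.id k _ :=
        MvPolynomial.algHom_ext fun i => kill_X_of_notMem (Set.notMem_empty i)
      rw [this, AlgHom.id_apply]
    rw [hid, hid] at h0
    refine isRegular_pair h0.1 h0.2 fun htop => ?_
    have hle : Ideal.span {f, g} ≤ RingHom.ker ψ := by
      rw [Ideal.span_le]
      rintro x (rfl | rfl)
      exacts [hf, hg]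
    rw [← hspan, htop] at hle
    have h1 : ψ 1 = 0 := hle (Submodule.mem_top : (1 : MvPolynomial V k) ∈ _)
    rw [map_one] at h1
    exact one_ne_zero h1
  · intro x hx
    simp only [List.mem_cons, List.not_mem_nil, or_false] at hx
    rcases hx with rfl | rfl
    exacts [hf, hg]
  · rw [maxIdeal_eq_varIdeal]
    exact hmem _ (Or.inr ⟨Set.subset_univ _, Or.inl (Set.mem_univ c)⟩)
  rw [hspan]
  have h1 : ∀ s ⊆ D, LinFlagMod (homogeneousSubmodule V k) (Ideal.span {f, g}) 𝓛
      (ψ : MvPolynomial V k →+* R) (varIdeal k s) := by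
    intro s hs
    refine linFlagMod_of_subset (Set.empty_subset s) linFlagMod_bot_varIdeal
      fun u i _ hu hi => ⟨hmem u (Or.inl ?_), fun x hx => ?_, fun j _ w _ hx => ?_⟩
    · exact ((Set.subset_insert i u).trans hu).trans hs
    · exact h.mem_sup_of_X_mul_mem (hu.trans hs) hi hx
    · exact hD u i (((Set.subset_insert i u).trans hu).trans hs)
        (hs (hu (Set.mem_insert i u))) hi _ hx
  have h2 : LinFlagMod (homogeneousSubmodule V k) (Ideal.span {f, g}) 𝓛
      (ψ : MvPolynomial V k →+* R) (varIdeal k (insert v D)) := by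
    rw [varIdeal_insert]
    refine LinFlagMod.step (h1 D subset_rfl) (isHomogeneous_X k v) (Or.inl rfl)
      h.X_mul_mem_iff fun j hj w hw hx => ?_
    rw [map_mul] at hx
    exact hv j hj _ (hψ j w hw) hx
  have h3 : LinFlagMod (homogeneousSubmodule V k) (Ideal.span {f, g}) 𝓛
      (ψ : MvPolynomial V k →+* R) (varIdeal k (insert c (insert v D))) := by
    rw [varIdeal_insert c]
    refine LinFlagMod.step h2 (isHomogeneous_X k c)
      (hmem _ (Or.inr ⟨Set.subset_insert c _, Or.inl (Set.mem_insert c _)⟩))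
      h.X_mul_mem_insert_iff fun j hj w hw _ => ?_
    exact htop j hj _ (hψ j w hw)
  rintro L (rfl | ⟨s, hs | ⟨hs, hc | rfl⟩, rfl⟩)
  · refine LinFlagMod.step (h1 D subset_rfl) ?_
      (hmem _ (Or.inr ⟨subset_rfl, Or.inr rfl⟩)) h.linear_mul_mem_iff fun j hj w hw hx => ?_
    · exact (isHomogeneous_X k v).add ((isHomogeneous_X k e).C_mul lam)
    · rw [map_mul] at hx
      exact hb j hj _ (hψ j w hw) hx
  · exact h1 s hs
  · refine linFlagMod_of_subset (Set.insert_subset hc hs) h3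
      fun u i hDu hu hi => ⟨?_, fun x hx => ?_, fun j hj w hw _ => ?_⟩
    · exact hmem u (Or.inr ⟨(Set.subset_insert c _).trans hDu,
        Or.inl (hDu (Set.mem_insert c _))⟩)
    · rw [sup_eq_left.2 (h.span_le ((Set.subset_insert c _).trans hDu)
        (hDu (Set.mem_insert c _)))] at hx ⊢
      exact (X_mul_mem_varIdeal_iff hi).1 hx
    · exact Ideal.map_mono (varIdeal_mono hDu) (htop j hj _ (hψ j w hw))
  · exact h2

end CodimensionTwo

end Main
end BackelinRoos
end

noncomputable section
set_option linter.unusedSectionVars false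
namespace BackelinRoos
open MvPolynomial

/-! ### Contracted monomial ideals of the second Veronese ring. -/

section MonomialIdeals

variable {k : Type*} [Field k] {n : ℕ}

/-- A monomial of even degree, as an element of the second Veronese subring. -/
def mon (k : Type*) [Field k] {n : ℕ} (m : Fin n →₀ ℕ) (h : 2 ∣ m.degree) : veronese k n 2 :=
  ⟨monomial m 1, fun m' hm' => by
    rw [Finset.mem_singleton.1 (support_monomial_subset hm')]
    exact h⟩

theorem mon_mul_mon {m m' : Fin n →₀ ℕ} (h : 2 ∣ m.degree) (h' : 2 ∣ m'.degree) :
    mon k m h * mon k m' h' = mon k (m + m') (by rw [map_add]; exact dvd_add h h') :=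
  Subtype.ext (by simp [mon, monomial_mul])

theorem mon_mem {m : Fin n →₀ ℕ} (h : 2 ∣ m.degree) {t : ℕ} (ht : m.degree = 2 * t) :
    mon k m h ∈ veroneseGrading k n 2 t :=
  isHomogeneous_monomial 1 ht

theorem degree_eq_of_mem {t : ℕ} {r : veronese k n 2} (hr : r ∈ veroneseGrading k n 2 t)
    {m : Fin n →₀ ℕ} (hm : m ∈ r.1.support) : m.degree = 2 * t := by
  by_contra h
  exact mem_support_iff.1 hm (IsHomogeneous.coeff_eq_zero hr h)

theorem mem_of_forall_mon {M : Submodule k (veronese k n 2)} {r : veronese k n 2}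
    (h : ∀ (m : Fin n →₀ ℕ) (hm : 2 ∣ m.degree), m ∈ r.1.support → mon k m hm ∈ M) : r ∈ M := by
  have : r = ∑ m ∈ r.1.support.attach, coeff m.1 r.1 • mon k m.1 (r.2 m.1 m.2) := by
    refine Subtype.ext ?_
    conv_lhs => rw [as_sum r.1]
    rw [AddSubmonoidClass.coe_finsetSum, ← Finset.sum_attach]
    exact Finset.sum_congr rfl fun m _ => by simp [mon, smul_monomial]
  rw [this]
  exact Submodule.sum_mem _ fun m _ => M.smul_mem _ (h m.1 _ m.2)

/-- The contraction to the second Veronese subring of the ideal generated by the monomials with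
exponents in `W`. -/
def monIdeal (k : Type*) [Field k] {n : ℕ} (W : Set (Fin n →₀ ℕ)) : Ideal (veronese k n 2) :=
  (Ideal.span ((fun m => monomial m (1 : k)) '' W)).comap (veronese k n 2).val

theorem mem_monIdeal {W : Set (Fin n →₀ ℕ)} {r : veronese k n 2} :
    r ∈ monIdeal k W ↔ ∀ m ∈ r.1.support, ∃ g ∈ W, g ≤ m :=
  mem_ideal_span_monomial_image

theorem mon_mem_monIdeal {W : Set (Fin n →₀ ℕ)} {g m : Fin n →₀ ℕ} (hg : g ∈ W) (h : g ≤ m)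
    (hm : 2 ∣ m.degree) : mon k m hm ∈ monIdeal k W :=
  mem_monIdeal.2 fun m' hm' => ⟨g, hg, by
    rwa [Finset.mem_singleton.1 (support_monomial_subset hm')]⟩

theorem monIdeal_congr {W W' : Set (Fin n →₀ ℕ)}
    (h : ∀ m : Fin n →₀ ℕ, 2 ∣ m.degree → ((∃ g ∈ W, g ≤ m) ↔ ∃ g ∈ W', g ≤ m)) :
    monIdeal k W = monIdeal k W' := by
  ext r
  rw [mem_monIdeal, mem_monIdeal]
  exact forall₂_congr fun m hm => h m (r.2 m hm)

theorem monIdeal_empty : monIdeal k (∅ : Set (Fin n →₀ ℕ)) = ⊥ := by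
  rw [eq_bot_iff]
  intro r hr
  rw [mem_monIdeal] at hr
  rw [Ideal.mem_bot, ← Subtype.coe_inj]
  refine MvPolynomial.ext _ _ fun m => ?_
  by_contra h
  obtain ⟨g, hg, -⟩ := hr m (mem_support_iff.2 h)
  exact hg

theorem monIdeal_insert (W : Set (Fin n →₀ ℕ)) {g : Fin n →₀ ℕ} (hg : 2 ∣ g.degree) :
    monIdeal k (insert g W) = monIdeal k W ⊔ Ideal.span {mon k g hg} := by
  apply le_antisymm
  · intro r hr
    rw [mem_monIdeal] at hr
    refine mem_of_forall_mon (M := (monIdeal k W ⊔ Ideal.span {mon k g hg}).restrictScalars k)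
      fun m hm hmr => ?_
    obtain ⟨g', rfl | hg', hle⟩ := hr m hmr
    · obtain ⟨m', rfl⟩ := exists_add_of_le hle
      have hm' : 2 ∣ m'.degree := by
        rw [map_add] at hm
        exact (Nat.dvd_add_right hg).1 hm
      rw [← mon_mul_mon hg hm']
      exact Ideal.mul_mem_right _ _ (Ideal.mem_sup_right (Ideal.mem_span_singleton_self _))
    · exact Ideal.mem_sup_left (mon_mem_monIdeal hg' hle hm)
  · refine sup_le (fun r hr => ?_) ((Ideal.span_singleton_le_iff_mem _).2 ?_)
    · rw [mem_monIdeal] at hr ⊢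
      intro m hm
      obtain ⟨g', hg', hle⟩ := hr m hm
      exact ⟨g', Or.inr hg', hle⟩
    · exact mon_mem_monIdeal (Set.mem_insert g W) le_rfl hg

/-- Multiplication by a monomial translates supports, so colon ideals can be read off from exponents
of even degree. -/
theorem mon_mul_mem_monIdeal_iff {W W' : Set (Fin n →₀ ℕ)} {g : Fin n →₀ ℕ} (hg : 2 ∣ g.degree)
    (h : ∀ m : Fin n →₀ ℕ, 2 ∣ m.degree → ((∃ g' ∈ W, g' ≤ g + m) ↔ ∃ g' ∈ W', g' ≤ m))
    (r : veronese k n 2) : mon k g hg * r ∈ monIdeal k W ↔ r ∈ monIdeal k W' := by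
  classical
  rw [mem_monIdeal, mem_monIdeal]
  have hc : ∀ m, coeff (g + m) (mon k g hg * r).1 = coeff m r.1 := fun m => by
    change coeff (g + m) (monomial g 1 * r.1) = _
    rw [coeff_monomial_mul, one_mul]
  constructor
  · intro hr m hm
    refine (h m (r.2 m hm)).1 (hr (g + m) ?_)
    rwa [mem_support_iff, hc, ← mem_support_iff]
  · intro hr m hm
    have hle : g ≤ m := by
      by_contra hle
      rw [mem_support_iff] at hm
      change coeff m (monomial g 1 * r.1) ≠ 0 at hm
      rw [coeff_monomial_mul', if_neg hle] at hm
      exact hm rfl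
    obtain ⟨m, rfl⟩ := exists_add_of_le hle
    rw [mem_support_iff, hc, ← mem_support_iff] at hm
    exact (h m (r.2 m hm)).2 (hr m hm)

end MonomialIdeals

/-! ### A Koszul filtration of the second Veronese ring. -/

section KoszulFiltration

variable {k : Type*} [Field k] {n : ℕ}

/-- The exponents of the variables of index smaller than `a`. -/
def varExps (n a : ℕ) : Set (Fin n →₀ ℕ) := {g | ∃ i : Fin n, i.1 < a ∧ g = Finsupp.single i 1}

/-- The exponents of the products of `x_a` with the variables of index between `a` and `b`. -/
def pairExps (a : Fin n) (b : ℕ) : Set (Fin n →₀ ℕ) :=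
  {g | ∃ i : Fin n, a ≤ i ∧ i.1 < b ∧ g = Finsupp.single a 1 + Finsupp.single i 1}

theorem degree_single_add_single (i j : Fin n) :
    (Finsupp.single i 1 + Finsupp.single j 1 : Fin n →₀ ℕ).degree = 2 := by
  rw [map_add, Finsupp.degree_single, Finsupp.degree_single]

theorem exists_mem_varExps {a : ℕ} {m : Fin n →₀ ℕ} :
    (∃ g ∈ varExps n a, g ≤ m) ↔ ∃ i : Fin n, i.1 < a ∧ 1 ≤ m i := by
  constructor
  · rintro ⟨_, ⟨i, hi, rfl⟩, h⟩
    exact ⟨i, hi, Finsupp.single_le_iff.1 h⟩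
  · rintro ⟨i, hi, h⟩
    exact ⟨_, ⟨i, hi, rfl⟩, Finsupp.single_le_iff.2 h⟩

theorem single_add_single_le_iff {i j : Fin n} {m : Fin n →₀ ℕ} :
    Finsupp.single i 1 + Finsupp.single j 1 ≤ m ↔
      1 ≤ m i ∧ 1 ≤ m j ∧ (i = j → 2 ≤ m i) := by
  classical
  constructor
  · intro h
    have h1 := h i
    have h2 := h j
    rw [Finsupp.add_apply, Finsupp.single_apply, Finsupp.single_apply] at h1 h2
    refine ⟨?_, ?_, ?_⟩
    · rw [if_pos rfl] at h1; omega
    · rw [if_pos rfl] at h2; omega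
    · rintro rfl
      simpa using h1
  · rintro ⟨h1, h2, h3⟩ l
    rw [Finsupp.add_apply, Finsupp.single_apply, Finsupp.single_apply]
    by_cases hi : i = l
    · by_cases hj : j = l
      · rw [if_pos hi, if_pos hj]
        exact hi ▸ h3 (hi.trans hj.symm)
      · rw [if_pos hi, if_neg hj]
        exact hi ▸ h1
    · by_cases hj : j = l
      · rw [if_neg hi, if_pos hj]
        exact hj ▸ h2
      · rw [if_neg hi, if_neg hj]
        exact Nat.zero_le _

theorem exists_mem_union_pairExps {a : Fin n} {b : ℕ} {m : Fin n →₀ ℕ} :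
    (∃ g ∈ varExps n a ∪ pairExps a b, g ≤ m) ↔ (∃ i : Fin n, i.1 < a ∧ 1 ≤ m i) ∨
      ∃ i : Fin n, a ≤ i ∧ i.1 < b ∧ Finsupp.single a 1 + Finsupp.single i 1 ≤ m := by
  rw [← exists_mem_varExps]
  constructor
  · rintro ⟨g, hg | ⟨i, h1, h2, rfl⟩, h⟩
    exacts [Or.inl ⟨g, hg, h⟩, Or.inr ⟨i, h1, h2, h⟩]
  · rintro (⟨g, hg, h⟩ | ⟨i, h1, h2, h⟩)
    exacts [⟨g, Or.inl hg, h⟩, ⟨_, Or.inr ⟨i, h1, h2, rfl⟩, h⟩]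

theorem insert_pairExps {a b : Fin n} (h : a ≤ b) :
    varExps n a ∪ pairExps a (b + 1) =
      insert (Finsupp.single a 1 + Finsupp.single b 1) (varExps n a ∪ pairExps a b) := by
  rw [← Set.union_insert]
  congr 1
  ext g
  constructor
  · rintro ⟨i, h1, h2, rfl⟩
    rcases Nat.lt_succ_iff_lt_or_eq.1 h2 with h3 | h3
    · exact Or.inr ⟨i, h1, h3, rfl⟩
    · obtain rfl := Fin.ext h3
      exact Or.inl rfl
  · rintro (rfl | ⟨i, h1, h2, rfl⟩)
    exacts [⟨b, h, Nat.lt_succ_self _, rfl⟩, ⟨i, h1, h2.trans (Nat.lt_succ_self _), rfl⟩]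

/-- For i < b, x_i x_a x_b is a multiple of x_i if i < a, and of x_a x_i otherwise. Conversely, a
generator x_i or x_a x_i dividing x_a x_b m forces x_i | m, since i ≠ b (and i ≠ a for a generator
x_i). -/
theorem colon_pairExps {a b : Fin n} (h : a ≤ b) (m : Fin n →₀ ℕ) :
    (∃ g ∈ varExps n a ∪ pairExps a b,
      g ≤ (Finsupp.single a 1 + Finsupp.single b 1 : Fin n →₀ ℕ) + m) ↔
      ∃ g ∈ varExps n b, g ≤ m := by
  classical
  rw [exists_mem_union_pairExps, exists_mem_varExps]
  have hval : ∀ i, ((Finsupp.single a 1 + Finsupp.single b 1 : Fin n →₀ ℕ) + m) i =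
      (if a = i then 1 else 0) + (if b = i then 1 else 0) + m i := fun i => by
    rw [Finsupp.add_apply, Finsupp.add_apply, Finsupp.single_apply, Finsupp.single_apply]
  have hab : a.1 ≤ b.1 := h
  constructor
  · rintro (⟨i, hi, hm⟩ | ⟨i, hi, hi', hm⟩)
    · rw [hval, if_neg (by rintro rfl; omega), if_neg (by rintro rfl; omega)] at hm
      exact ⟨i, by omega, by omega⟩
    · obtain ⟨-, h2, h3⟩ := single_add_single_le_iff.1 hm
      refine ⟨i, hi', ?_⟩
      have hb : b ≠ i := by rintro rfl; omega
      rw [hval, if_neg hb] at h2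
      by_cases hai : a = i
      · have := h3 hai
        rw [hval, if_pos rfl, if_neg (hai ▸ hb)] at this
        rw [← hai]
        omega
      · rw [if_neg hai] at h2
        omega
  · rintro ⟨i, hi, hm⟩
    by_cases hia : i.1 < a.1
    · refine Or.inl ⟨i, hia, ?_⟩
      rw [hval]
      omega
    · refine Or.inr ⟨i, by simpa using hia, hi, single_add_single_le_iff.2 ⟨?_, ?_, ?_⟩⟩
      · rw [hval, if_pos rfl]; omega
      · rw [hval]; omega
      · rintro rfl
        rw [hval, if_pos rfl]; omega

/-- A monomial of even degree divisible by x_a has a further factor x_j: either j < a, or x_a x_j is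
one of the pairs. So the pairs complete the passage to the next contracted ideal. -/
theorem exists_mem_varExps_succ {a : Fin n} {m : Fin n →₀ ℕ} (hm : 2 ∣ m.degree) :
    (∃ g ∈ varExps n a ∪ pairExps a n, g ≤ m) ↔ ∃ g ∈ varExps n (a + 1), g ≤ m := by
  rw [exists_mem_union_pairExps, exists_mem_varExps]
  constructor
  · rintro (⟨i, hi, h⟩ | ⟨i, hi, -, h⟩)
    · exact ⟨i, by omega, h⟩
    · exact ⟨a, by omega, (single_add_single_le_iff.1 h).1⟩
  · rintro ⟨i, hi, h⟩
    by_cases hia : i.1 < a.1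
    · exact Or.inl ⟨i, hia, h⟩
    obtain rfl : i = a := Fin.ext (by omega)
    by_cases h2 : 2 ≤ m i
    · exact Or.inr ⟨i, le_rfl, i.2, single_add_single_le_iff.2 ⟨h, h, fun _ => h2⟩⟩
    have : ∃ j, j ≠ i ∧ 1 ≤ m j := by
      by_contra! hcon
      rw [Finsupp.degree_eq_sum, Finset.sum_eq_single i
        (fun j _ hj => by have := hcon j hj; omega) (by simp)] at hm
      omega
    obtain ⟨j, hj, hmj⟩ := this
    by_cases hji : j.1 < i.1
    · exact Or.inl ⟨j, hji, hmj⟩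
    · exact Or.inr ⟨j, by simpa using hji, j.2,
        single_add_single_le_iff.2 ⟨h, hmj, fun h => absurd h.symm hj⟩⟩

theorem monIdeal_varExps_eq_maxIdeal :
    monIdeal k (varExps n n) = maxIdeal (veroneseGrading k n 2) := by
  have h1 : monIdeal k (varExps n n) ≤ maxIdeal (veroneseGrading k n 2) := by
    intro r hr
    rw [mem_monIdeal] at hr
    refine mem_of_forall_mon (M := (maxIdeal (veroneseGrading k n 2)).restrictScalars k)
      fun m hm hmr => ?_
    obtain ⟨i, -, hi⟩ := exists_mem_varExps.1 (hr m hmr)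
    obtain ⟨t, ht⟩ := hm
    refine mem_maxIdeal_of_mem (t := t) (Nat.pos_of_ne_zero ?_) (mon_mem _ ht)
    rintro rfl
    have h0 := (Finsupp.degree_eq_zero_iff m).1 ht
    rw [h0] at hi
    simp at hi
  refine le_antisymm h1 fun r hr => ?_
  rw [mem_monIdeal]
  intro m hm
  rw [exists_mem_varExps]
  by_contra! hcon
  obtain rfl : m = 0 := Finsupp.ext fun i => by have := hcon i i.2; simpa using this
  have h2 : r - algebraMap k _ (coeff 0 r.1) ∈ monIdeal k (varExps n n) := by
    rw [mem_monIdeal]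
    intro m hm
    rw [exists_mem_varExps]
    by_contra! hcon
    obtain rfl : m = 0 := Finsupp.ext fun i => by have := hcon i i.2; simpa using this
    rw [mem_support_iff] at hm
    refine hm ?_
    change coeff 0 (r.1 - C (coeff 0 r.1)) = 0
    rw [coeff_sub, coeff_C, if_pos rfl, sub_self]
  have h3 := sub_mem hr (h1 h2)
  rw [sub_sub_cancel, maxIdeal] at h3
  have h4 : algebraMap k (veronese k n 2) (coeff 0 r.1) ∈ veroneseGrading k n 2 0 :=
    SetLike.algebraMap_mem_graded _ _
  have h5 : GradedAlgebra.proj (veroneseGrading k n 2) 0 _ = 0 :=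
    (HomogeneousIdeal.mem_irrelevant_iff _ _).1 h3
  refine mem_support_iff.1 hm ?_
  have h6 := congrArg (fun x : veronese k n 2 => coeff 0 x.1)
    ((gproj_of_mem _ h4).symm.trans h5)
  change coeff 0 (C (coeff 0 r.1)) = coeff 0 0 at h6
  rwa [coeff_C, if_pos rfl, coeff_zero] at h6

theorem linFlag_monIdeal_insert {𝓛 : Set (Ideal (veronese k n 2))} {W W' : Set (Fin n →₀ ℕ)}
    (hW : LinFlag (veroneseGrading k n 2) 𝓛 (RingHom.id _) (monIdeal k W))
    (hW' : monIdeal k W' ∈ 𝓛) {g : Fin n →₀ ℕ} (hg : g.degree = 2)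
    (h : ∀ m : Fin n →₀ ℕ, 2 ∣ m.degree → ((∃ g' ∈ W, g' ≤ g + m) ↔ ∃ g' ∈ W', g' ≤ m)) :
    LinFlag (veroneseGrading k n 2) 𝓛 (RingHom.id _) (monIdeal k (insert g W)) := by
  have hg' : 2 ∣ g.degree := hg ▸ dvd_rfl
  have h1 := mon_mul_mem_monIdeal_iff (k := k) hg' h
  rw [monIdeal_insert W hg']
  refine LinFlag.step hW (mon_mem hg' hg) hW' h1 fun t _ w _ hw => ?_
  rw [Ideal.map_id, RingHom.id_apply] at hw ⊢
  exact (h1 w).1 hw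

/-- The ideals of the second Veronese subring contracted from the ideals `(x_0, …, x_{a-1})` form
a Koszul filtration. -/
theorem linFlag_varExps (a : ℕ) (ha : a ≤ n) :
    LinFlag (veroneseGrading k n 2) ((fun b => monIdeal k (varExps n b)) '' Set.Iic n)
      (RingHom.id _) (monIdeal k (varExps n a)) := by
  induction a with
  | zero =>
    have : varExps n 0 = ∅ := by
      ext g
      simp [varExps]
    rw [this, monIdeal_empty]
    exact LinFlag.bot
  | succ a ih =>
    let a' : Fin n := ⟨a, ha⟩
    -- The products x_a x_a, x_a x_{a+1}, … are adjoined one at a time. The intermediate ideals need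
    -- not belong to the family; only their colon ideals must.
    have key : ∀ b, a ≤ b → b ≤ n →
        LinFlag (veroneseGrading k n 2) ((fun b => monIdeal k (varExps n b)) '' Set.Iic n)
          (RingHom.id _) (monIdeal k (varExps n a' ∪ pairExps a' b)) := by
      intro b hab
      induction b, hab using Nat.le_induction with
      | base =>
        intro _
        have : pairExps a' a = ∅ := by
          refine Set.eq_empty_of_forall_notMem ?_
          rintro _ ⟨i, h1, h2, -⟩
          exact absurd h2 (not_lt.2 h1)
        rw [this, Set.union_empty]
        exact ih (by omega)
      | succ b hab ih' =>
        intro hb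
        let b' : Fin n := ⟨b, hb⟩
        have hab' : a' ≤ b' := hab
        rw [show b + 1 = b' + 1 from rfl, insert_pairExps hab']
        exact linFlag_monIdeal_insert (ih' (by omega)) ⟨b, by simp; omega, rfl⟩
          (degree_single_add_single _ _) fun m _ => colon_pairExps hab' m
    rw [show a + 1 = a' + 1 from rfl,
      ← monIdeal_congr fun m hm => exists_mem_varExps_succ (a := a') hm]
    exact key n (by omega) le_rfl

end KoszulFiltration
end BackelinRoos
end

noncomputable section
set_option linter.unusedSectionVars false
namespace BackelinRoos
open MvPolynomial

/-! ### The presentation of the Veronese ring by products of pairs. -/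

section Presentation

variable {k : Type*} [Field k] {n : ℕ}

/-- The product of two variables, as an element of the second Veronese subring. -/
def pr (k : Type*) [Field k] {n : ℕ} (i j : Fin n) : veronese k n 2 :=
  mon k (Finsupp.single i 1 + Finsupp.single j 1) (by rw [degree_single_add_single])

theorem coe_pr (i j : Fin n) : (pr k i j : MvPolynomial (Fin n) k) = X i * X j := by
  simp [pr, mon, X, monomial_mul]

theorem pr_comm (i j : Fin n) : pr k i j = pr k j i :=
  Subtype.ext (by rw [coe_pr, coe_pr, mul_comm])

/-- The exponent of the product of an unordered pair of variables. -/
def pairExp {n : ℕ} (p : Sym2 (Fin n)) : Fin n →₀ ℕ :=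
  Sym2.lift ⟨fun i j => Finsupp.single i 1 + Finsupp.single j 1, fun _ _ => add_comm _ _⟩ p

theorem pairExp_injective : Function.Injective (pairExp (n := n)) := by
  intro p q
  induction p using Sym2.ind with | _ i j
  induction q using Sym2.ind with | _ a b
  intro h
  change Finsupp.single i 1 + Finsupp.single j 1 = Finsupp.single a 1 + Finsupp.single b 1 at h
  rw [Finsupp.single_add_single_eq_single_add_single one_ne_zero one_ne_zero] at h
  rw [Sym2.eq_iff]
  rcases h with h | h | h
  · exact Or.inl h
  · exact Or.inr ⟨h.2.1, h.2.2⟩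
  · simp at h

/-- The presentation of the second Veronese subring by a polynomial ring with one variable for each
unordered pair of variables. -/
def pairMap (k : Type*) [Field k] (n : ℕ) : MvPolynomial (Sym2 (Fin n)) k →ₐ[k] veronese k n 2 :=
  aeval (Sym2.lift ⟨pr k, pr_comm⟩)

@[simp]
theorem pairMap_X (i j : Fin n) : pairMap k n (X s(i, j)) = pr k i j := by
  simp [pairMap]

theorem coe_pairMap_X (p : Sym2 (Fin n)) :
    (pairMap k n (X p) : MvPolynomial (Fin n) k) = monomial (pairExp p) 1 := by
  induction p using Sym2.ind with | _ i j
  rw [pairMap_X]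
  rfl

theorem pairMap_surjective : Function.Surjective (pairMap k n) := by
  have key : ∀ (t : ℕ) (m : Fin n →₀ ℕ) (h : 2 ∣ m.degree), m.degree = 2 * t →
      mon k m h ∈ (pairMap k n).range := by
    intro t
    induction t with
    | zero =>
      intro m h hm
      obtain rfl := (Finsupp.degree_eq_zero_iff m).1 hm
      exact one_mem (pairMap k n).range
    | succ t ih =>
      intro m h hm
      have hne : ∀ m : Fin n →₀ ℕ, m.degree ≠ 0 → ∃ (i : Fin n) (m' : Fin n →₀ ℕ),
          m = Finsupp.single i 1 + m' := by
        intro m hm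
        obtain ⟨i, hi⟩ : ∃ i, m i ≠ 0 := by
          by_contra! hcon
          exact hm ((Finsupp.degree_eq_zero_iff m).2 (Finsupp.ext hcon))
        obtain ⟨m', hm'⟩ := exists_add_of_le (Finsupp.single_le_iff.2 (Nat.one_le_iff_ne_zero.2 hi))
        exact ⟨i, m', hm'⟩
      obtain ⟨i, m₁, rfl⟩ := hne m (by omega)
      rw [map_add, Finsupp.degree_single] at hm
      obtain ⟨j, m₂, rfl⟩ := hne m₁ (by omega)
      rw [map_add, Finsupp.degree_single] at hm
      have h2 : m₂.degree = 2 * t := by omega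
      have : mon k (Finsupp.single i 1 + (Finsupp.single j 1 + m₂)) h =
          pr k i j * mon k m₂ ⟨t, h2⟩ := by
        rw [pr, mon_mul_mon]
        congr 1
        rw [add_assoc]
      rw [this]
      exact mul_mem ⟨X s(i, j), pairMap_X i j⟩ (ih m₂ _ h2)
  intro r
  refine mem_of_forall_mon (M := Subalgebra.toSubmodule (pairMap k n).range) fun m hm _ => ?_
  obtain ⟨t, ht⟩ := hm
  exact key t m _ ht

theorem pairMap_mem (j : ℕ) (p : MvPolynomial (Sym2 (Fin n)) k)
    (hp : p ∈ homogeneousSubmodule (Sym2 (Fin n)) k j) :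
    pairMap k n p ∈ veroneseGrading k n 2 j := by
  change (pairMap k n p : MvPolynomial (Fin n) k).IsHomogeneous (2 * j)
  have : (veronese k n 2).val.comp (pairMap k n) = aeval fun p => monomial (pairExp p) 1 :=
    MvPolynomial.algHom_ext fun p => by
      rw [AlgHom.comp_apply, aeval_X]
      exact coe_pairMap_X p
  change ((veronese k n 2).val.comp (pairMap k n) p).IsHomogeneous (2 * j)
  rw [this]
  refine IsHomogeneous.aeval hp _ fun p => isHomogeneous_monomial 1 ?_
  induction p using Sym2.ind with | _ a b
  exact degree_single_add_single a b

theorem eq_zero_of_pairMap_eq_zero (t : ℕ) (ht : t < 2) (p : MvPolynomial (Sym2 (Fin n)) k)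
    (hp : p ∈ homogeneousSubmodule (Sym2 (Fin n)) k t) (h : pairMap k n p = 0) : p = 0 := by
  classical
  interval_cases t
  · obtain ⟨c, rfl⟩ : ∃ c, p = C c :=
      ⟨_, totalDegree_eq_zero_iff_eq_C.1 (Nat.le_zero.1 (IsHomogeneous.totalDegree_le hp))⟩
    have h1 := congrArg (fun x : veronese k n 2 => coeff 0 x.1) h
    rw [algHom_C] at h1
    change coeff 0 (C c) = coeff 0 0 at h1
    rw [coeff_C, if_pos rfl, coeff_zero] at h1
    rw [h1, C_0]
  · rw [homogeneousSubmodule_one_eq_span_X, Submodule.mem_span_range_iff_exists_fun] at hp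
    obtain ⟨c, rfl⟩ := hp
    refine Finset.sum_eq_zero fun q _ => ?_
    have h1 := congrArg (fun x : veronese k n 2 => coeff (pairExp q) x.1) h
    simp only [map_sum, map_smul, AddSubmonoidClass.coe_finsetSum, coeff_sum] at h1
    rw [Finset.sum_eq_single q] at h1
    · change coeff (pairExp q) (c q • (pairMap k n (X q) : MvPolynomial (Fin n) k)) =
        coeff (pairExp q) 0 at h1
      rw [coe_pairMap_X, coeff_smul, coeff_monomial, if_pos rfl, coeff_zero] at h1
      rw [show c q = 0 by simpa using h1, zero_smul]
    · intro b _ hb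
      change coeff (pairExp q) (c b • (pairMap k n (X b) : MvPolynomial (Fin n) k)) = 0
      rw [coe_pairMap_X, coeff_smul, coeff_monomial, if_neg fun h => hb (pairExp_injective h),
        smul_zero]
    · simp

end Presentation

/-! ### The squares of the variables as a regular sequence. -/

section Squares

variable {k : Type*} [Field k] {n : ℕ}

/-- The exponents of the squares of the variables `x_i` for which `(i, i)` is in `s`. -/
def sqExps (s : Set (Sym2 (Fin n))) : Set (Fin n →₀ ℕ) :=
  {g | ∃ i, s(i, i) ∈ s ∧ g = Finsupp.single i 1 + Finsupp.single i 1}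

theorem exists_mem_sqExps {s : Set (Sym2 (Fin n))} {m : Fin n →₀ ℕ} :
    (∃ g ∈ sqExps s, g ≤ m) ↔ ∃ i, s(i, i) ∈ s ∧ 2 ≤ m i := by
  have h : ∀ i, Finsupp.single i 1 + Finsupp.single i 1 ≤ m ↔ 2 ≤ m i := fun i => by
    rw [single_add_single_le_iff]
    exact ⟨fun h => h.2.2 rfl, fun h => ⟨by omega, by omega, fun _ => h⟩⟩
  constructor
  · rintro ⟨_, ⟨i, hi, rfl⟩, hm⟩
    exact ⟨i, hi, (h i).1 hm⟩
  · rintro ⟨i, hi, hm⟩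
    exact ⟨_, ⟨i, hi, rfl⟩, (h i).2 hm⟩

/-- In an even-degree monomial the cofactor of x_i² has even degree too, so the contracted ideal is
generated by the squares inside the Veronese ring. -/
theorem map_varIdeal_eq_monIdeal {ψ : MvPolynomial (Sym2 (Fin n)) k →ₐ[k] veronese k n 2}
    (hψ : ∀ i, ψ (X s(i, i)) = pr k i i) {s : Set (Sym2 (Fin n))} (hs : s ⊆ {p | p.IsDiag}) :
    (varIdeal k s).map (ψ : MvPolynomial (Sym2 (Fin n)) k →+* veronese k n 2) =
      monIdeal k (sqExps s) := by
  rw [varIdeal, Ideal.map_span]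
  apply le_antisymm
  · rw [Ideal.span_le]
    rintro _ ⟨_, ⟨p, hp, rfl⟩, rfl⟩
    have hd := hs hp
    induction p using Sym2.ind with | _ i j
    obtain rfl : i = j := Sym2.mk_isDiag_iff.1 hd
    change ψ (X s(i, i)) ∈ _
    rw [hψ]
    exact mon_mem_monIdeal (W := sqExps s) ⟨i, hp, rfl⟩ le_rfl _
  · intro r hr
    rw [mem_monIdeal] at hr
    refine mem_of_forall_mon (M := (Ideal.span _).restrictScalars k) fun m hm hmr => ?_
    obtain ⟨_, ⟨i, hi, rfl⟩, hle⟩ := hr m hmr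
    obtain ⟨m', rfl⟩ := exists_add_of_le hle
    have hm' : 2 ∣ m'.degree := by
      rw [map_add, degree_single_add_single] at hm
      exact (Nat.dvd_add_right dvd_rfl).1 hm
    rw [← mon_mul_mon (by rw [degree_single_add_single]) hm']
    refine Ideal.mul_mem_right _ _ (Ideal.subset_span ⟨X s(i, i), ⟨_, hi, rfl⟩, ?_⟩)
    exact hψ i

/-- Multiplying a monomial by x_i² does not change its divisibility by x_l² for l ≠ i, so the
squares are regular in any order. -/
theorem mem_of_X_diag_mul_mem {ψ : MvPolynomial (Sym2 (Fin n)) k →ₐ[k] veronese k n 2}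
    (hψ : ∀ i, ψ (X s(i, i)) = pr k i i) (s : Set (Sym2 (Fin n))) (p : Sym2 (Fin n))
    (hs : s ⊆ {p | p.IsDiag}) (hp : p ∈ {p : Sym2 (Fin n) | p.IsDiag}) (hps : p ∉ s)
    (y : veronese k n 2)
    (hy : ψ (X p) * y ∈ (varIdeal k s).map (ψ : MvPolynomial (Sym2 (Fin n)) k →+* veronese k n 2)) :
    y ∈ (varIdeal k s).map (ψ : MvPolynomial (Sym2 (Fin n)) k →+* veronese k n 2) := by
  classical
  rw [map_varIdeal_eq_monIdeal hψ hs] at hy ⊢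
  induction p using Sym2.ind with | _ i j
  obtain rfl : i = j := Sym2.mk_isDiag_iff.1 hp
  rw [hψ] at hy
  refine (mon_mul_mem_monIdeal_iff (W := sqExps s) _ (fun m _ => ?_) y).1 hy
  rw [exists_mem_sqExps, exists_mem_sqExps]
  refine exists_congr fun l => and_congr_right fun hl => ?_
  have hil : i ≠ l := by
    rintro rfl
    exact hps hl
  rw [Finsupp.add_apply, Finsupp.add_apply, Finsupp.single_apply, if_neg hil, zero_add, zero_add]

/-- The ideal of the second Veronese subring generated by the squares of the variables. -/
def sqIdeal (k : Type*) [Field k] (n : ℕ) : Ideal (veronese k n 2) :=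
  monIdeal k (sqExps {p | p.IsDiag})

theorem pr_self_mem_sqIdeal (i : Fin n) : pr k i i ∈ sqIdeal k n :=
  mon_mem_monIdeal (W := sqExps {p | p.IsDiag}) ⟨i, Sym2.mk_isDiag_iff.2 rfl, rfl⟩ le_rfl _

/-- Modulo the squares, only squarefree monomials of degree 2t survive in degree t. -/
theorem mem_of_forall_squarefree {t : ℕ} {M : Submodule k (veronese k n 2)}
    (hM : (sqIdeal k n).restrictScalars k ≤ M)
    (h : ∀ (s : Finset (Fin n)) (y : veronese k n 2), s.card = 2 * t → y.1 = ∏ i ∈ s, X i → y ∈ M)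
    {r : veronese k n 2} (hr : r ∈ veroneseGrading k n 2 t) : r ∈ M := by
  refine mem_of_forall_mon fun m hm hmr => ?_
  by_cases hsq : ∃ i, 2 ≤ m i
  · obtain ⟨i, hi⟩ := hsq
    obtain ⟨g, hg, hle⟩ := exists_mem_sqExps.2
      ⟨i, (Sym2.mk_isDiag_iff.2 rfl : s(i, i) ∈ {p : Sym2 (Fin n) | p.IsDiag}), hi⟩
    exact hM (mon_mem_monIdeal hg hle hm)
  · push Not at hsq
    have hone : ∀ i ∈ m.support, m i = 1 := fun i hi => by
      have h1 := hsq i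
      have h2 := Finsupp.mem_support_iff.1 hi
      omega
    refine h m.support _ ?_ ?_
    · rw [← degree_eq_of_mem hr hmr, Finsupp.degree_apply, Finset.sum_congr rfl hone]
      simp
    · change monomial m 1 = _
      rw [monomial_eq, C_1, one_mul, Finsupp.prod]
      exact Finset.prod_congr rfl fun i hi => by rw [hone i hi, pow_one]

theorem mem_sqIdeal_of_lt {t : ℕ} (ht : n < 2 * t) {r : veronese k n 2}
    (hr : r ∈ veroneseGrading k n 2 t) : r ∈ sqIdeal k n := by
  refine mem_of_forall_squarefree (M := (sqIdeal k n).restrictScalars k) le_rfl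
    (fun s y hs _ => ?_) hr
  have := s.card_le_univ
  rw [Fintype.card_fin] at this
  omega

end Squares

/-! ### At most three variables. -/

section SmallCases

variable {k : Type*} [Field k] {n : ℕ}

theorem hasBackelinRoosProperty_veronese_of_le_three (hn : n ≤ 3) :
    HasBackelinRoosProperty (veroneseGrading k n 2) := by
  have hψ : ∀ i, pairMap k n (X s(i, i)) = pr k i i := fun i => pairMap_X i i
  refine hasBackelinRoosProperty_of_minimal _ (pairMap k n) pairMap_surjective pairMap_mem
    eq_zero_of_pairMap_eq_zero (D := {p | p.IsDiag}) (mem_of_X_diag_mul_mem hψ)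
    (fun t ht y hy => ?_) (𝓛' := (fun b => monIdeal k (varExps n b)) '' Set.Iic n)
    ⟨n, Set.mem_Iic.2 le_rfl, monIdeal_varExps_eq_maxIdeal⟩ ?_
  · rw [map_varIdeal_eq_monIdeal hψ subset_rfl]
    exact mem_sqIdeal_of_lt (by omega) hy
  · rintro _ ⟨a, ha, rfl⟩
    exact linFlag_varExps a ha

end SmallCases
end BackelinRoos
end

noncomputable section
set_option linter.unusedSectionVars false
namespace BackelinRoos
open MvPolynomial

/-! ### Linear changes of one variable. -/

section ChangeOfVariables

variable {k V : Type*} [Field k]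

open Classical in
/-- The endomorphism of the polynomial ring that adds `B` to the variable `v`. -/
def shift (v : V) (B : MvPolynomial V k) : MvPolynomial V k →ₐ[k] MvPolynomial V k :=
  aeval fun i => if i = v then X v + B else X i

theorem shift_X_self (v : V) (B : MvPolynomial V k) : shift v B (X v) = X v + B := by
  simp [shift]

theorem shift_X_of_ne {v i : V} (h : i ≠ v) (B : MvPolynomial V k) : shift v B (X i) = X i := by
  simp [shift, h]

theorem shift_shift {v : V} {B B' : MvPolynomial V k} (hB : shift v B' B = B) (h : B' + B = 0)
    (p : MvPolynomial V k) : shift v B' (shift v B p) = p := by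
  have : (shift v B').comp (shift v B) = AlgHom.id k _ := by
    refine MvPolynomial.algHom_ext fun i => ?_
    rw [AlgHom.comp_apply, AlgHom.id_apply]
    by_cases hi : i = v
    · rw [hi, shift_X_self, map_add, shift_X_self, hB]
      linear_combination h
    · rw [shift_X_of_ne hi, shift_X_of_ne hi]
  exact AlgHom.congr_fun this p

theorem shift_isHomogeneous {v : V} {B p : MvPolynomial V k} (hB : B.IsHomogeneous 1) {t : ℕ}
    (hp : p.IsHomogeneous t) : (shift v B p).IsHomogeneous t := by
  rw [← one_mul t]
  refine hp.aeval _ fun i => ?_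
  split_ifs
  exacts [(isHomogeneous_X k v).add hB, isHomogeneous_X k i]

end ChangeOfVariables

/-! ### Reduction to an exact pair of zero divisors modulo squares. -/

section ExactPair

variable {k : Type*} [Field k] {n : ℕ} (i : Fin 4 → Fin n)

/-- The quadric `x_0 x_1 + x_2 x_3 + ε (x_0 x_2 - x_1 x_3)`. -/
def quadric (E : veronese k n 2) : veronese k n 2 :=
  pr k (i 0) (i 1) + pr k (i 2) (i 3) + E * (pr k (i 0) (i 2) - pr k (i 1) (i 3))

variable {i}

theorem hasBackelinRoosProperty_veronese_of_quadric (hi : Function.Injective i) {p q : Fin n}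
    (hpq : p ≠ q) (h23 : s(i 2, i 3) ≠ s(p, q)) (h01 : s(i 0, i 1) ≠ s(p, q)) {ε μ : k}
    (hε : 2 * (1 - ε ^ 2) = 0) {a b : veronese k n 2}
    (ha : a = quadric i (algebraMap k _ ε) - algebraMap k _ μ * pr k p q)
    (hb : b = quadric i (algebraMap k _ ε) + algebraMap k _ μ * pr k p q)
    (hab : ∀ t, 2 ≤ t → ∀ y ∈ veroneseGrading k n 2 t, a * y ∈ sqIdeal k n →
      y ∈ sqIdeal k n ⊔ Ideal.span {b})
    (hba : ∀ t, 2 ≤ t → ∀ y ∈ veroneseGrading k n 2 t, b * y ∈ sqIdeal k n →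
      y ∈ sqIdeal k n ⊔ Ideal.span {a})
    (htop : ∀ t, 2 ≤ t → ∀ y ∈ veroneseGrading k n 2 t,
      y ∈ sqIdeal k n ⊔ Ideal.span {a} ⊔ Ideal.span {pr k (i 0) (i 1)}) :
    HasBackelinRoosProperty (veroneseGrading k n 2) := by
  -- B is chosen so that the shifted presentation sends the variable of the pair (i 2, i 3) to a.
  let B : MvPolynomial (Sym2 (Fin n)) k := X s(i 0, i 1) +
    C ε * (X s(i 0, i 2) - X s(i 1, i 3)) - C μ * X s(p, q)
  have hB1 : B.IsHomogeneous 1 :=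
    ((isHomogeneous_X k _).add (((isHomogeneous_X k _).sub (isHomogeneous_X k _)).C_mul ε)).sub
      ((isHomogeneous_X k _).C_mul μ)
  have hB : ∀ B', shift s(i 2, i 3) B' B = B := fun B' => by
    simp only [B, map_add, map_sub, map_mul, algHom_C, algebraMap_eq]
    rw [shift_X_of_ne, shift_X_of_ne, shift_X_of_ne, shift_X_of_ne h23.symm] <;>
      simp [hi.eq_iff]
  let ψ : MvPolynomial (Sym2 (Fin n)) k →ₐ[k] veronese k n 2 :=
    (pairMap k n).comp (shift s(i 2, i 3) B)
  have hX : ∀ {x y}, s(x, y) ≠ s(i 2, i 3) → ψ (X s(x, y)) = pr k x y := fun {x y} h => by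
    rw [AlgHom.comp_apply, shift_X_of_ne h, pairMap_X]
  have hdiag : ∀ x, ψ (X s(x, x)) = pr k x x := fun x => hX (by
    simp only [ne_eq, Sym2.eq_iff]
    rintro (⟨h, h'⟩ | ⟨h, h'⟩) <;> simpa using hi (h.symm.trans h'))
  have hv : ψ (X s(i 2, i 3)) = a := by
    rw [AlgHom.comp_apply, shift_X_self, ha, quadric]
    simp only [B, map_add, map_sub, map_mul, algHom_C, pairMap_X]
    ring
  have he : ψ (X s(p, q)) = pr k p q := hX h23.symm
  -- This is where λ = 2μ comes from: b - a = 2μ x_p x_q.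
  have hb' : ψ (X s(i 2, i 3) + C (2 * μ) * X s(p, q)) = b := by
    rw [map_add, map_mul, hv, he, algHom_C, map_mul, ha, hb, map_ofNat]
    ring
  -- A lift of ab = q² - μ² x_p² x_q² in which every term contains the variable of a square; hence F
  -- vanishes modulo D and f becomes x_v(x_v + λx_e).
  let F : MvPolynomial (Sym2 (Fin n)) k := X s(i 0, i 0) * X s(i 1, i 1) +
    X s(i 2, i 2) * X s(i 3, i 3) + C (ε ^ 2) * (X s(i 0, i 0) * X s(i 2, i 2) +
    X s(i 1, i 1) * X s(i 3, i 3)) + C (2 * ε) * (X s(i 0, i 0) * X s(i 1, i 2) -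
    X s(i 1, i 1) * X s(i 0, i 3) + X s(i 2, i 2) * X s(i 0, i 3) -
    X s(i 3, i 3) * X s(i 1, i 2)) - C (μ ^ 2) * (X s(p, p) * X s(q, q))
  let f := X s(i 2, i 3) * (X s(i 2, i 3) + C (2 * μ) * X s(p, q)) - F
  let g : MvPolynomial (Sym2 (Fin n)) k :=
    X s(i 0, i 1) ^ 2 - X s(i 0, i 0) * X s(i 1, i 1)
  have hD : ∀ x, kill {p : Sym2 (Fin n) | p.IsDiag}
      (X s(x, x) : MvPolynomial (Sym2 (Fin n)) k) = 0 :=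
    fun x => kill_X_of_mem (Sym2.mk_isDiag_iff.2 rfl)
  have hne : ∀ {x y}, x ≠ y → s(x, y) ∉ {p : Sym2 (Fin n) | p.IsDiag} := fun h h' =>
    h (Sym2.mk_isDiag_iff.1 h')
  have hXX : ∀ u v : Sym2 (Fin n), (X u * X v : MvPolynomial (Sym2 (Fin n)) k).IsHomogeneous 2 :=
    fun u v => (isHomogeneous_X k u).mul (isHomogeneous_X k v)
  have hpair : QuadricPair {p : Sym2 (Fin n) | p.IsDiag} s(i 2, i 3) s(i 0, i 1) s(p, q)
      (2 * μ) f g := by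
    have n23 := hne (hi.ne (show (2 : Fin 4) ≠ 3 by decide))
    have n01 := hne (hi.ne (show (0 : Fin 4) ≠ 1 by decide))
    refine ⟨n23, n01, hne hpq, ?_, h23, h01, ?_, ?_, ?_, ?_⟩
    · simp [hi.eq_iff]
    · refine ((isHomogeneous_X k _).mul ((isHomogeneous_X k _).add
        ((isHomogeneous_X k _).C_mul _))).sub ?_
      exact ((((hXX _ _).add (hXX _ _)).add (((hXX _ _).add (hXX _ _)).C_mul _)).add
        (((((hXX _ _).sub (hXX _ _)).add (hXX _ _)).sub (hXX _ _)).C_mul _)).sub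
          ((hXX _ _).C_mul _)
    · exact ((isHomogeneous_X k _).pow 2).sub (hXX _ _)
    · simp only [f, F, map_add, map_sub, map_mul, hD, algHom_C, kill_X_of_notMem n23,
        kill_X_of_notMem (hne hpq)]
      simp
    · simp only [g, map_sub, map_mul, map_pow, hD, kill_X_of_notMem n01]
      ring
  have hf : ψ f = 0 := by
    -- The one term of q² without a square is 2(1 - ε²) times the product of the four variables.
    have hC : (2 * (1 - C ε ^ 2) : MvPolynomial (Fin n) k) = 0 := by
      have := congrArg (C (σ := Fin n)) hε
      rwa [map_mul, map_sub, map_one, map_pow, map_ofNat, map_zero] at this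
    have h2 : (C 2 : MvPolynomial (Fin n) k) = 2 := map_ofNat C 2
    simp only [f, F]
    rw [map_sub, map_mul, hv, hb', ha, hb]
    simp only [map_add, map_sub, map_mul, map_pow, hdiag, algHom_C]
    rw [hX (by simp [hi.eq_iff]), hX (by simp [hi.eq_iff])]
    refine Subtype.ext ?_
    simp [quadric, coe_pr, algebraMap_eq, h2]
    linear_combination (X (i 0) * X (i 1) * X (i 2) * X (i 3)) * hC
  have hg : ψ g = 0 := by
    simp only [g]
    rw [map_sub, map_mul, map_pow, hdiag, hdiag, hX (by simp [hi.eq_iff])]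
    refine Subtype.ext ?_
    simp [coe_pr]
    ring
  have hmap : ∀ p, (Ideal.span {p}).map (ψ : MvPolynomial (Sym2 (Fin n)) k →+* veronese k n 2) =
      Ideal.span {ψ p} := fun p => by
    rw [Ideal.map_span, Set.image_singleton]
    rfl
  have hsq := map_varIdeal_eq_monIdeal hdiag subset_rfl
  change _ = sqIdeal k n at hsq
  refine hasBackelinRoosProperty_of_quadricPair _ (ψ := ψ) ?_ (fun j x hx => ?_)
    (fun t ht x hx h => ?_) hpair hf hg (mem_of_X_diag_mul_mem hdiag) ?_ ?_ ?_
    (𝓛' := (fun b => monIdeal k (varExps n b)) '' Set.Iic n)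
    ⟨n, Set.mem_Iic.2 le_rfl, monIdeal_varExps_eq_maxIdeal⟩ ?_
  · refine pairMap_surjective.comp fun x => ⟨shift s(i 2, i 3) (-B) x, shift_shift ?_ ?_ x⟩
    · rw [map_neg, hB]
    · rw [add_neg_cancel]
  · exact pairMap_mem j _ (shift_isHomogeneous hB1 hx)
  · have h1 := eq_zero_of_pairMap_eq_zero t ht _ (shift_isHomogeneous hB1 hx) h
    have h2 := shift_shift (hB (-B)) (neg_add_cancel B) x
    rw [← h2, h1, map_zero]
  · intro t ht y hy h
    rw [Ideal.map_sup, hmap, hsq, hb']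
    rw [hsq, hv] at h
    exact hab t ht y hy h
  · intro t ht y hy h
    rw [varIdeal_insert, Ideal.map_sup, hmap, hsq, hv]
    rw [hsq, hb'] at h
    exact hba t ht y hy h
  · intro t ht y hy
    rw [varIdeal_insert, varIdeal_insert, Ideal.map_sup, Ideal.map_sup, hmap, hmap, hsq, hv,
      hX (by simp [hi.eq_iff])]
    exact htop t ht y hy
  · rintro _ ⟨a, ha, rfl⟩
    exact linFlag_varExps a ha

end ExactPair
end BackelinRoos
end

noncomputable section
set_option linter.unusedSectionVars false
namespace BackelinRoos
open MvPolynomial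

/-! ### Multiplication by the quadric modulo squares. -/

section Quadric

variable {k : Type*} [Field k] {n : ℕ}

theorem exists_two_mul_one_sub_sq_eq_zero (k : Type*) [Field k] :
    ∃ ε : k, 2 * (1 - ε ^ 2) = 0 ∧ 1 + ε ^ 2 ≠ 0 := by
  by_cases h : (2 : k) = 0
  · exact ⟨0, by rw [h, zero_mul], by simp⟩
  · exact ⟨1, by simp, by norm_num; exact h⟩

theorem pr_self_mul_mem {L : Ideal (veronese k n 2)} (hL : sqIdeal k n ≤ L) (j : Fin n)
    (y : veronese k n 2) : pr k j j * y ∈ L :=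
  L.mul_mem_right _ (hL (pr_self_mem_sqIdeal j))

theorem eq_pr_mul_pr {a b c d : Fin n} {y : veronese k n 2}
    (hy : y.1 = ∏ i ∈ ({a, b, c, d} : Finset (Fin n)), X i)
    (h : a ∉ ({b, c, d} : Finset (Fin n)) ∧ b ∉ ({c, d} : Finset (Fin n)) ∧ c ≠ d) :
    y = pr k a b * pr k c d := by
  refine Subtype.ext ?_
  rw [hy, Finset.prod_insert h.1, Finset.prod_insert h.2.1, Finset.prod_pair h.2.2]
  simp only [MulMemClass.coe_mul, coe_pr]
  ring

variable {i : Fin 4 → Fin n} {ε : k} {L : Ideal (veronese k n 2)}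

/-- Modulo squares, q x_0 and q x_3 are combinations of x_0x_2x_3 and x_0x_1x_3 with determinant 1 +
ε², and q x_1 and q x_2 behave alike with x_1x_2x_3 and x_0x_1x_2. Inverting gives all four cubics;
the factor x_l restores even degree. -/
theorem cubic_mul_mem (hL : sqIdeal k n ≤ L) (hε : 1 + ε ^ 2 ≠ 0) {l : Fin n}
    (h : ∀ j, quadric i (algebraMap k _ ε) * pr k (i j) l ∈ L) :
    pr k (i 0) (i 2) * pr k (i 3) l ∈ L ∧ pr k (i 0) (i 1) * pr k (i 3) l ∈ L ∧
    pr k (i 1) (i 2) * pr k (i 3) l ∈ L ∧ pr k (i 0) (i 1) * pr k (i 2) l ∈ L := by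
  set E := algebraMap k (veronese k n 2) ε with hE
  have hu : IsUnit (1 + E ^ 2) := by
    rw [hE, ← map_pow, ← map_one (algebraMap k (veronese k n 2)), ← map_add]
    exact (isUnit_iff_ne_zero.2 hε).map _
  have key : ∀ {x y : veronese k n 2}, y ∈ L → (1 + E ^ 2) * x = y → x ∈ L := fun hy hxy =>
    (Ideal.unit_mul_mem_iff_mem L hu).1 (hxy ▸ hy)
  refine ⟨key (y := quadric i E * pr k (i 0) l + E * (quadric i E * pr k (i 3) l) -
      pr k (i 0) (i 0) * (pr k (i 1) l + E * pr k (i 2) l) -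
      pr k (i 3) (i 3) * (E * (pr k (i 2) l - E * pr k (i 1) l))) ?_ ?_,
    key (y := quadric i E * pr k (i 3) l - E * (quadric i E * pr k (i 0) l) -
      pr k (i 3) (i 3) * (pr k (i 2) l - E * pr k (i 1) l) +
      pr k (i 0) (i 0) * (E * (pr k (i 1) l + E * pr k (i 2) l))) ?_ ?_,
    key (y := quadric i E * pr k (i 1) l - E * (quadric i E * pr k (i 2) l) -
      pr k (i 1) (i 1) * (pr k (i 0) l - E * pr k (i 3) l) +
      pr k (i 2) (i 2) * (E * (pr k (i 3) l + E * pr k (i 0) l))) ?_ ?_,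
    key (y := quadric i E * pr k (i 2) l + E * (quadric i E * pr k (i 1) l) -
      pr k (i 2) (i 2) * (pr k (i 3) l + E * pr k (i 0) l) -
      pr k (i 1) (i 1) * (E * (pr k (i 0) l - E * pr k (i 3) l))) ?_ ?_⟩
  · exact sub_mem (sub_mem (add_mem (h 0) (L.mul_mem_left _ (h 3))) (pr_self_mul_mem hL _ _))
      (pr_self_mul_mem hL _ _)
  · refine Subtype.ext ?_
    simp [quadric, coe_pr]
    ring
  · exact add_mem (sub_mem (sub_mem (h 3) (L.mul_mem_left _ (h 0))) (pr_self_mul_mem hL _ _))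
      (pr_self_mul_mem hL _ _)
  · refine Subtype.ext ?_
    simp [quadric, coe_pr]
    ring
  · exact add_mem (sub_mem (sub_mem (h 1) (L.mul_mem_left _ (h 2))) (pr_self_mul_mem hL _ _))
      (pr_self_mul_mem hL _ _)
  · refine Subtype.ext ?_
    simp [quadric, coe_pr]
    ring
  · exact sub_mem (sub_mem (add_mem (h 2) (L.mul_mem_left _ (h 1))) (pr_self_mul_mem hL _ _))
      (pr_self_mul_mem hL _ _)
  · refine Subtype.ext ?_
    simp [quadric, coe_pr]
    ring

theorem quadric_mul_pr_mem (i : Fin 4 → Fin n) (E : veronese k n 2) :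
    quadric i E * pr k (i 0) (i 1) - pr k (i 0) (i 1) * pr k (i 2) (i 3) ∈ sqIdeal k n ∧
    quadric i E * pr k (i 2) (i 3) - pr k (i 0) (i 1) * pr k (i 2) (i 3) ∈ sqIdeal k n ∧
    quadric i E * pr k (i 0) (i 2) + E * (pr k (i 0) (i 1) * pr k (i 2) (i 3)) ∈ sqIdeal k n ∧
    quadric i E * pr k (i 1) (i 3) - E * (pr k (i 0) (i 1) * pr k (i 2) (i 3)) ∈ sqIdeal k n ∧
    quadric i E * pr k (i 0) (i 3) ∈ sqIdeal k n ∧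
    quadric i E * pr k (i 1) (i 2) ∈ sqIdeal k n := by
  have key : ∀ {x : veronese k n 2} (y₀ y₁ y₂ y₃ : veronese k n 2),
      x = pr k (i 0) (i 0) * y₀ + pr k (i 1) (i 1) * y₁ + pr k (i 2) (i 2) * y₂ +
        pr k (i 3) (i 3) * y₃ → x ∈ sqIdeal k n := by
    rintro _ y₀ y₁ y₂ y₃ rfl
    exact add_mem (add_mem (add_mem (pr_self_mul_mem le_rfl _ _) (pr_self_mul_mem le_rfl _ _))
      (pr_self_mul_mem le_rfl _ _)) (pr_self_mul_mem le_rfl _ _)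
  refine ⟨key (pr k (i 1) (i 1) + E * pr k (i 1) (i 2)) (-(E * pr k (i 0) (i 3))) 0 0 ?_,
    key 0 0 (pr k (i 3) (i 3) + E * pr k (i 0) (i 3)) (-(E * pr k (i 1) (i 2))) ?_,
    key (pr k (i 1) (i 2) + E * pr k (i 2) (i 2)) 0 (pr k (i 0) (i 3)) 0 ?_,
    key 0 (pr k (i 0) (i 3) - E * pr k (i 3) (i 3)) 0 (pr k (i 1) (i 2)) ?_,
    key (pr k (i 1) (i 3) + E * pr k (i 2) (i 3)) 0 0
      (pr k (i 0) (i 2) - E * pr k (i 0) (i 1)) ?_,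
    key 0 (pr k (i 0) (i 2) - E * pr k (i 2) (i 3))
      (pr k (i 1) (i 3) + E * pr k (i 0) (i 1)) 0 ?_⟩ <;>
  · refine Subtype.ext ?_
    simp [quadric, coe_pr]
    ring

theorem quadric_mul_pr_mul_pr_mem (i : Fin 4 → Fin n) (E : veronese k n 2) :
    quadric i E * (pr k (i 0) (i 1) * pr k (i 2) (i 3)) ∈ sqIdeal k n := by
  have h := (sqIdeal k n).mul_mem_right (pr k (i 2) (i 3)) (quadric_mul_pr_mem i E).1
  have h' := pr_self_mul_mem (le_refl (sqIdeal k n)) (i 2) (pr k (i 0) (i 1) * pr k (i 3) (i 3))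
  convert add_mem h h' using 1
  refine Subtype.ext ?_
  simp [quadric, coe_pr]
  ring

theorem quadric_sq_mem (i : Fin 4 → Fin n) (hε : 2 * (1 - ε ^ 2) = 0) :
    quadric i (algebraMap k _ ε) ^ 2 ∈ sqIdeal k n := by
  set E := algebraMap k (veronese k n 2) ε with hE
  have hE' : 2 * (1 - E ^ 2) = 0 := by
    have := congrArg (algebraMap k (veronese k n 2)) hε
    rwa [map_mul, map_sub, map_one, map_pow, map_ofNat, map_zero] at this
  obtain ⟨h1, h2, h3, h4, -, -⟩ := quadric_mul_pr_mem i E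
  convert add_mem (add_mem h1 h2) ((sqIdeal k n).mul_mem_left E (sub_mem h3 h4)) using 1
  conv_lhs => rw [sq]; arg 2; rw [quadric]
  linear_combination (pr k (i 0) (i 1) * pr k (i 2) (i 3)) * hE'

end Quadric

/-! ### Four and five variables. -/

section FourAndFive

variable {k : Type*} [Field k]

/-- Here μ = 0, so a = b = q and the pair (p, q) plays no role beyond being admissible; the
annihilator conditions hold because q and the squares generate everything in degrees at least 2. -/
theorem hasBackelinRoosProperty_veronese_of_top {n : ℕ} {i : Fin 4 → Fin n}
    (hi : Function.Injective i) {ε : k} (hε : 2 * (1 - ε ^ 2) = 0)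
    (h : ∀ t, 2 ≤ t → ∀ y ∈ veroneseGrading k n 2 t,
      y ∈ sqIdeal k n ⊔ Ideal.span {quadric i (algebraMap k _ ε)}) :
    HasBackelinRoosProperty (veroneseGrading k n 2) :=
  hasBackelinRoosProperty_veronese_of_quadric hi (p := i 0) (q := i 2) (μ := 0)
    (hi.ne (by decide)) (by simp [hi.eq_iff]) (by simp [hi.eq_iff]) hε
    (a := quadric i (algebraMap k _ ε)) (b := quadric i (algebraMap k _ ε)) (by simp) (by simp)
    (fun t ht y hy _ => h t ht y hy) (fun t ht y hy _ => h t ht y hy)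
    (fun t ht y hy => Ideal.mem_sup_left (h t ht y hy))

theorem hasBackelinRoosProperty_veronese_four :
    HasBackelinRoosProperty (veroneseGrading k 4 2) := by
  obtain ⟨ε, hε, hε'⟩ := exists_two_mul_one_sub_sq_eq_zero k
  refine hasBackelinRoosProperty_veronese_of_top (i := id) Function.injective_id hε
    fun t ht y hy => ?_
  set L := sqIdeal k 4 ⊔ Ideal.span {quadric id (algebraMap k (veronese k 4 2) ε)}
  have hL : sqIdeal k 4 ≤ L := le_sup_left
  obtain rfl | ht : t = 2 ∨ 2 < t := by omega
  · refine mem_of_forall_squarefree (M := L.restrictScalars k) hL (fun s y hs hy => ?_) hy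
    have h := cubic_mul_mem (i := id) (l := 1) hL hε' fun j =>
      L.mul_mem_right _ (Ideal.mem_sup_right (Ideal.mem_span_singleton_self _))
    obtain rfl : s = {0, 2, 3, 1} := by
      clear hy
      revert s
      decide
    rw [eq_pr_mul_pr hy (by decide)]
    exact h.1
  · exact hL (mem_sqIdeal_of_lt (by omega) hy)

theorem hasBackelinRoosProperty_veronese_five :
    HasBackelinRoosProperty (veroneseGrading k 5 2) := by
  obtain ⟨ε, hε, hε'⟩ := exists_two_mul_one_sub_sq_eq_zero k
  have hi : Function.Injective (Fin.castSucc : Fin 4 → Fin 5) := Fin.castSucc_injective 4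
  refine hasBackelinRoosProperty_veronese_of_top hi hε fun t ht y hy => ?_
  set L := sqIdeal k 5 ⊔ Ideal.span {quadric Fin.castSucc (algebraMap k (veronese k 5 2) ε)}
  have hL : sqIdeal k 5 ≤ L := le_sup_left
  obtain rfl | ht : t = 2 ∨ 2 < t := by omega
  · refine mem_of_forall_squarefree (M := L.restrictScalars k) hL (fun s y hs hy => ?_) hy
    have h := fun l => cubic_mul_mem (i := Fin.castSucc) (l := l) hL hε' fun j =>
      L.mul_mem_right _ (Ideal.mem_sup_right (Ideal.mem_span_singleton_self _))
    -- Each squarefree quartic in five variables is a cubic in the first four times a further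
    -- variable.
    have hs' : s = {0, 2, 3, 1} ∨ s = {0, 2, 3, 4} ∨ s = {0, 1, 3, 4} ∨ s = {1, 2, 3, 4} ∨
        s = {0, 1, 2, 4} := by
      clear hy
      revert s
      decide
    rcases hs' with rfl | rfl | rfl | rfl | rfl <;> rw [eq_pr_mul_pr hy (by decide)]
    exacts [(h 1).1, (h 4).1, (h 4).2.1, (h 4).2.2.1, (h 4).2.2.2]
  · exact hL (mem_sqIdeal_of_lt (by omega) hy)

end FourAndFive
end BackelinRoos
end

noncomputable section
set_option linter.unusedSectionVars false
namespace BackelinRoos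
open MvPolynomial

/-! ### Six variables. -/

section Six

variable {k : Type*} [Field k]

/-- The first four of six indices. -/
def firstFour : Fin 4 → Fin 6 := Fin.castLE (by decide)

theorem firstFour_injective : Function.Injective firstFour := Fin.castLE_injective _

/-- The quadric `x_0 x_1 + x_2 x_3 + ε (x_0 x_2 - x_1 x_3) + τ x_4 x_5`. -/
def quadricSix (ε τ : k) : veronese k 6 2 :=
  quadric firstFour (algebraMap k _ ε) + algebraMap k _ τ * pr k 4 5

variable {ε τ : k}

/-- The extra term x_4x_5 becomes a multiple of a square when multiplied by x_4 or x_5, so there the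
new quadric acts like q. -/
theorem quadricSix_mul_mem {L : Ideal (veronese k 6 2)} (hL : sqIdeal k 6 ≤ L)
    (h : quadricSix ε τ ∈ L) (j : Fin 6) :
    quadric firstFour (algebraMap k _ ε) * pr k j 4 ∈ L ∧
    quadric firstFour (algebraMap k _ ε) * pr k j 5 ∈ L := by
  constructor
  · convert sub_mem (L.mul_mem_right (pr k j 4) h)
      (pr_self_mul_mem hL 4 (algebraMap k _ τ * pr k j 5)) using 1
    refine Subtype.ext ?_
    simp [quadricSix, coe_pr]
    ring
  · convert sub_mem (L.mul_mem_right (pr k j 5) h)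
      (pr_self_mul_mem hL 5 (algebraMap k _ τ * pr k j 4)) using 1
    refine Subtype.ext ?_
    simp [quadricSix, coe_pr]
    ring

/-- Quartics with exactly one of x_4, x_5 are reached through `cubic_mul_mem`. For those with both,
q x_i x_j ≡ c·x_0x_1x_2x_3 modulo squares, so x_i x_j x_4x_5 ≡ -τc·x_0x_1x_2x_3. Only x_0x_1x_2x_3
remains. -/
theorem exists_sub_smul_mem_of_mem_two (hε : 1 + ε ^ 2 ≠ 0) (hτ : τ ^ 2 = 1)
    {y : veronese k 6 2} (hy : y ∈ veroneseGrading k 6 2 2) :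
    ∃ c : k, y - algebraMap k _ c * (pr k 0 1 * pr k 2 3) ∈
      sqIdeal k 6 ⊔ Ideal.span {quadricSix ε τ} := by
  set L := sqIdeal k 6 ⊔ Ideal.span {quadricSix ε τ} with hLdef
  have hL : sqIdeal k 6 ≤ L := le_sup_left
  have hq : quadricSix ε τ ∈ L := Ideal.mem_sup_right (Ideal.mem_span_singleton_self _)
  let M : Submodule k (veronese k 6 2) :=
    L.restrictScalars k ⊔ Submodule.span k {pr k 0 1 * pr k 2 3}
  have hLM : ∀ {x}, x ∈ L → x ∈ M := fun {x} hx =>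
    Submodule.mem_sup_left (S := L.restrictScalars k) hx
  have hP : pr k 0 1 * pr k 2 3 ∈ M := Submodule.mem_sup_right (Submodule.mem_span_singleton_self _)
  suffices hM : y ∈ M by
    obtain ⟨x, hx, z, hz, rfl⟩ := Submodule.mem_sup.1 hM
    obtain ⟨c, rfl⟩ := Submodule.mem_span_singleton.1 hz
    refine ⟨c, ?_⟩
    rw [← Algebra.smul_def, add_sub_cancel_right]
    exact hx
  have h4 := cubic_mul_mem (i := firstFour) (l := 4) hL hε fun j =>
    (quadricSix_mul_mem hL hq _).1
  have h5 := cubic_mul_mem (i := firstFour) (l := 5) hL hε fun j =>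
    (quadricSix_mul_mem hL hq _).2
  have key : ∀ (x : veronese k 6 2) (c : k),
      quadric firstFour (algebraMap k _ ε) * x - c • (pr k 0 1 * pr k 2 3) ∈ sqIdeal k 6 →
      x * pr k 4 5 ∈ M := by
    intro x c hx
    have h1 : algebraMap k _ τ * (quadricSix ε τ * x -
        (quadric firstFour (algebraMap k _ ε) * x - c • (pr k 0 1 * pr k 2 3))) ∈ L :=
      L.mul_mem_left _ (sub_mem (L.mul_mem_right _ hq) (hL hx))
    have h2 : x * pr k 4 5 = algebraMap k _ τ * (quadricSix ε τ * x -
        (quadric firstFour (algebraMap k _ ε) * x - c • (pr k 0 1 * pr k 2 3))) -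
        (τ * c) • (pr k 0 1 * pr k 2 3) := by
      have hτ' : algebraMap k (veronese k 6 2) τ ^ 2 = 1 := by rw [← map_pow, hτ, map_one]
      rw [Algebra.smul_def, Algebra.smul_def, map_mul, quadricSix]
      linear_combination (-x * pr k 4 5) * hτ'
    rw [h2]
    exact sub_mem (hLM h1) (M.smul_mem _ hP)
  obtain ⟨q1, q2, q3, q4, q5, q6⟩ := quadric_mul_pr_mem firstFour (algebraMap k (veronese k 6 2) ε)
  refine mem_of_forall_squarefree (M := M) (fun x hx => hLM (hL hx)) (fun s y hs hy => ?_) hy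
  have hs' : s = {0, 2, 3, 4} ∨ s = {0, 1, 3, 4} ∨ s = {1, 2, 3, 4} ∨ s = {0, 1, 2, 4} ∨
      s = {0, 2, 3, 5} ∨ s = {0, 1, 3, 5} ∨ s = {1, 2, 3, 5} ∨ s = {0, 1, 2, 5} ∨
      s = {0, 1, 2, 3} ∨ s = {0, 1, 4, 5} ∨ s = {2, 3, 4, 5} ∨ s = {0, 2, 4, 5} ∨
      s = {1, 3, 4, 5} ∨ s = {0, 3, 4, 5} ∨ s = {1, 2, 4, 5} := by
    clear hy
    revert s
    decide
  rcases hs' with rfl | rfl | rfl | rfl | rfl | rfl | rfl | rfl | rfl | rfl | rfl | rfl | rfl |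
    rfl | rfl <;> rw [eq_pr_mul_pr hy (by decide)]
  · exact hLM h4.1
  · exact hLM h4.2.1
  · exact hLM h4.2.2.1
  · exact hLM h4.2.2.2
  · exact hLM h5.1
  · exact hLM h5.2.1
  · exact hLM h5.2.2.1
  · exact hLM h5.2.2.2
  · exact hP
  · refine key _ 1 ?_
    rw [one_smul]
    exact q1
  · refine key _ 1 ?_
    rw [one_smul]
    exact q2
  · refine key _ (-ε) ?_
    rw [neg_smul, sub_neg_eq_add, Algebra.smul_def]
    exact q3
  · refine key _ ε ?_
    rw [Algebra.smul_def]
    exact q4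
  · refine key _ 0 ?_
    rw [zero_smul, sub_zero]
    exact q5
  · refine key _ 0 ?_
    rw [zero_smul, sub_zero]
    exact q6

theorem quadricSix_mul_sub_mem (ε τ : k) :
    quadricSix ε τ * (pr k 0 1 * pr k 2 3) -
      algebraMap k _ τ * (pr k 0 1 * pr k 2 3 * pr k 4 5) ∈ sqIdeal k 6 := by
  convert quadric_mul_pr_mul_pr_mem firstFour (algebraMap k (veronese k 6 2) ε) using 1
  change (quadric firstFour _ + _) * (pr k 0 1 * pr k 2 3) - _ =
    quadric firstFour _ * (pr k 0 1 * pr k 2 3)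
  ring

theorem mem_of_mem_three (hτ : τ ^ 2 = 1) {y : veronese k 6 2}
    (hy : y ∈ veroneseGrading k 6 2 3) : y ∈ sqIdeal k 6 ⊔ Ideal.span {quadricSix ε τ} := by
  set L := sqIdeal k 6 ⊔ Ideal.span {quadricSix ε τ} with hLdef
  have hL : sqIdeal k 6 ≤ L := le_sup_left
  refine mem_of_forall_squarefree (M := L.restrictScalars k) hL (fun s y hs hy => ?_) hy
  obtain rfl : s = Finset.univ := Finset.eq_univ_of_card _ hs
  have hy' : y = pr k 0 1 * pr k 2 3 * pr k 4 5 := by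
    refine Subtype.ext ?_
    rw [hy, Fin.prod_univ_six]
    simp only [MulMemClass.coe_mul, coe_pr]
    ring
  have h1 : quadricSix ε τ * (pr k 0 1 * pr k 2 3) ∈ L :=
    L.mul_mem_right _ (Ideal.mem_sup_right (Ideal.mem_span_singleton_self _))
  have h2 := L.mul_mem_left (algebraMap k _ τ) (sub_mem h1 (hL (quadricSix_mul_sub_mem ε τ)))
  have hτ' : algebraMap k (veronese k 6 2) τ ^ 2 = 1 := by rw [← map_pow, hτ, map_one]
  change y ∈ L
  convert h2 using 1
  rw [hy']
  linear_combination (-(pr k 0 1 * pr k 2 3 * pr k 4 5)) * hτ'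

theorem eq_zero_of_algebraMap_mul_mem {c : k}
    (h : algebraMap k _ c * (pr k 0 1 * pr k 2 3 * pr k 4 5) ∈ sqIdeal k 6) : c = 0 := by
  classical
  by_contra hc
  rw [pr, pr, pr, mon_mul_mon, mon_mul_mon, sqIdeal, mem_monIdeal] at h
  obtain ⟨i, -, hi⟩ := exists_mem_sqExps.1 (h _ (by
    rw [mem_support_iff]
    change coeff _ (C c * monomial _ 1) ≠ 0
    rw [coeff_C_mul, coeff_monomial, if_pos rfl, mul_one]
    exact hc))
  simp only [Finsupp.add_apply, Finsupp.single_apply] at hi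
  revert i
  decide

theorem quadricSix_mul_neg_mem (hε : 2 * (1 - ε ^ 2) = 0) :
    quadricSix ε τ * quadricSix ε (-τ) ∈ sqIdeal k 6 := by
  convert sub_mem (quadric_sq_mem firstFour hε)
    (pr_self_mul_mem le_rfl 4 (algebraMap k _ τ ^ 2 * pr k 5 5)) using 1
  have h : pr k (4 : Fin 6) 5 ^ 2 = pr k 4 4 * pr k 5 5 := by
    refine Subtype.ext ?_
    simp [coe_pr]
    ring
  rw [quadricSix, quadricSix, map_neg]
  linear_combination (-algebraMap k _ τ ^ 2) * h

/-- In degree 2, y is c·x_0x_1x_2x_3 modulo squares and the conjugate quadric, which the given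
quadric annihilates modulo squares. Multiplying leaves cτ·x_0⋯x_5, which is nonzero modulo squares
unless c = 0. In higher degrees every y lies in the ideal. -/
theorem mem_of_quadricSix_mul_mem (hε : 2 * (1 - ε ^ 2) = 0) (hε' : 1 + ε ^ 2 ≠ 0)
    (hτ : τ ^ 2 = 1) {t : ℕ} (ht : 2 ≤ t) {y : veronese k 6 2}
    (hy : y ∈ veroneseGrading k 6 2 t) (h : quadricSix ε τ * y ∈ sqIdeal k 6) :
    y ∈ sqIdeal k 6 ⊔ Ideal.span {quadricSix ε (-τ)} := by
  have hτ' : (-τ) ^ 2 = 1 := by rw [neg_sq, hτ]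
  obtain rfl | rfl | ht : t = 2 ∨ t = 3 ∨ 3 < t := by omega
  · obtain ⟨c, hc⟩ := exists_sub_smul_mem_of_mem_two hε' hτ' hy
    suffices hc0 : c = 0 by simpa [hc0] using hc
    obtain ⟨s, hs, z, hz, hsz⟩ := Submodule.mem_sup.1 hc
    obtain ⟨r, rfl⟩ := Ideal.mem_span_singleton'.1 hz
    have hτ0 : τ ≠ 0 := by
      rintro rfl
      simp at hτ
    refine (mul_eq_zero.1 (eq_zero_of_algebraMap_mul_mem (c := c * τ) ?_)).resolve_right hτ0
    have h1 := (sqIdeal k 6).mul_mem_left (quadricSix ε τ) hs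
    have h2 := (sqIdeal k 6).mul_mem_left r (quadricSix_mul_neg_mem (τ := τ) hε)
    have h3 := (sqIdeal k 6).mul_mem_left (algebraMap k _ c) (quadricSix_mul_sub_mem ε τ)
    convert sub_mem (sub_mem (sub_mem h h1) h2) h3 using 1
    rw [map_mul]
    linear_combination quadricSix ε τ * hsz
  · exact mem_of_mem_three hτ' hy
  · exact Ideal.mem_sup_left (mem_sqIdeal_of_lt (by omega) hy)

theorem hasBackelinRoosProperty_veronese_six :
    HasBackelinRoosProperty (veroneseGrading k 6 2) := by
  obtain ⟨ε, hε, hε'⟩ := exists_two_mul_one_sub_sq_eq_zero k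
  have h1 : (-1 : k) ^ 2 = 1 := by rw [neg_sq, one_pow]
  refine hasBackelinRoosProperty_veronese_of_quadric firstFour_injective (p := 4) (q := 5)
    (μ := 1) (by decide) (by decide) (by decide) hε (a := quadricSix ε (-1))
    (b := quadricSix ε 1) ?_ ?_ (fun t ht y hy h => ?_)
    (fun t ht y hy h => mem_of_quadricSix_mul_mem hε hε' (one_pow 2) ht hy h)
    (fun t ht y hy => ?_)
  · rw [quadricSix, map_neg]
    ring
  · rfl
  · have := mem_of_quadricSix_mul_mem hε hε' h1 ht hy h
    rwa [neg_neg] at this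
  · obtain rfl | rfl | ht : t = 2 ∨ t = 3 ∨ 3 < t := by omega
    -- The remaining quartic x_0x_1x_2x_3 is a multiple of x_0x_1, the image of the variable x_c.
    · obtain ⟨c, hc⟩ := exists_sub_smul_mem_of_mem_two hε' h1 hy
      rw [← sub_add_cancel y (algebraMap k _ c * (pr k 0 1 * pr k 2 3))]
      refine add_mem (Ideal.mem_sup_left hc) (Ideal.mem_sup_right ?_)
      exact Ideal.mul_mem_left _ _ (Ideal.mul_mem_right _ _ (Ideal.mem_span_singleton_self _))
    · exact Ideal.mem_sup_left (mem_of_mem_three h1 hy)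
    · exact Ideal.mem_sup_left (Ideal.mem_sup_left (mem_sqIdeal_of_lt (by omega) hy))

end Six
end BackelinRoos
end

theorem mainTheorem4 (k : Type*) [Field k] (n : ℕ) (hn : n ≤ 6) :
    BackelinRoos.HasBackelinRoosProperty (BackelinRoos.veroneseGrading k n 2) := by
  obtain h | rfl | rfl | rfl : n ≤ 3 ∨ n = 4 ∨ n = 5 ∨ n = 6 := by omega
  · exact BackelinRoos.hasBackelinRoosProperty_veronese_of_le_three h
  · exact BackelinRoos.hasBackelinRoosProperty_veronese_four
  · exact BackelinRoos.hasBackelinRoosProperty_veronese_five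
  · exact BackelinRoos.hasBackelinRoosProperty_veronese_six
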